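/- Let $n\ge 0$ be an integer and let $\mathcal H_n\subset \mathrm{Mat}(\mathbb C,2n)$ be the real algebra of all matrices $\begin{pmatrix} X & Y\\ -\overline{Y} & \overline{X}\end{pmatrix}$ with $X,Y\in \mathrm{Mat}(\mathbb C,n)$ (the complex model of the quaternionic $n\times n$ matrices). Regard $\mathrm{Mat}(\mathbb R,n)$, $\mathrm{Mat}(\mathbb C,n)$ and $\mathcal H_n$ as real algebras. A subset $M$ of one of these algebras $\mathcal A$ is called conjugacy invariant if $CXC^{-1}\in M$ for every $X\in M$ and every invertible element $C$ of $\mathcal A$. Embedded submanifolds are $C^\infty$, and codimensions are real codimensions in $\mathcal A$. (1) In each of $\mathrm{Mat}(\mathbb R,n)$, $\mathrm{Mat}(\mathbb C,n)$ and $\mathcal H_n$, the set of all nilpotent elements is the disjoint union of a finite number of nonempty, conjugacy invariant, embedded submanifolds of codimension greater than or equal to $n$, $2n$ and $4n$, respectively. In all three cases exactly one of these submanifolds has codimension equal to this bound. (2) In each of $\mathrm{Mat}(\mathbb R,n)$, $\mathrm{Mat}(\mathbb C,n)$ and $\mathcal H_n$, the set of all elements with purely imaginary spectrum (all complex eigenvalues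 of the matrix have real part $0$; the eigenvalue $0$ is allowed) is the disjoint union of a finite number of nonempty, conjugacy invariant, embedded submanifolds of codimension greater than or equal to $\lceil n/2\rceil$, $n$ and $n$, respectively. In all three cases exactly one of these submanifolds has codimension equal to this bound. -/

import Mathlib

/-
The norm on matrices is the Frobenius norm. Every space of matrices below is a finite-dimensional
real vector space, so its topology and its smooth structure do not depend on this choice.
-/
open scoped ContDiff Matrix.Norms.Frobenius

/-- `M` is a smooth embedded submanifold of codimension `c` (without boundary, of pure dimension)
of the finite-dimensional real normed space `E`: around each of its points there is a smooth slice
chart, that is, a `C^∞` diffeomorphism `Φ` from an open subset of `E` onto an open subset of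
`ℝ^d × ℝ^c`, with `d + c = dim E`, that turns `M` into `ℝ^d × {0}`. -/
def IsEmbeddedSubmanifoldOfCodim {E : Type*} [NormedAddCommGroup E] [NormedSpace ℝ E]
    (M : Set E) (c : ℕ) : Prop :=
  ∃ d : ℕ, d + c = Module.finrank ℝ E ∧
    ∀ p ∈ M, ∃ Φ : OpenPartialHomeomorph E
        (EuclideanSpace ℝ (Fin d) × EuclideanSpace ℝ (Fin c)),
      p ∈ Φ.source ∧
      ContDiffOn ℝ ∞ Φ Φ.source ∧
      ContDiffOn ℝ ∞ Φ.symm Φ.target ∧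
      ∀ x ∈ Φ.source, x ∈ M ↔ (Φ x).2 = 0

/-- `M` is invariant under conjugation by the invertible elements of the algebra `A`. -/
def IsConjugacyInvariant {A : Type*} [Monoid A] (M : Set A) : Prop :=
  ∀ X ∈ M, ∀ C : Aˣ, (C : A) * X * ((C⁻¹ : Aˣ) : A) ∈ M

/-- `S` is the disjoint union of finitely many nonempty, conjugacy invariant, embedded submanifolds
`M i` of the real algebra `A`, where `M i` has real codimension `c i ≥ b`, and exactly one of the
`M i` has codimension equal to `b`. -/
def IsDisjointUnionOfSubmanifolds {A : Type*} [NormedRing A] [NormedAlgebra ℝ A]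
    (S : Set A) (b : ℕ) : Prop :=
  ∃ (r : ℕ) (M : Fin r → Set A) (c : Fin r → ℕ),
    (⋃ i, M i) = S ∧
    Pairwise (fun i j => Disjoint (M i) (M j)) ∧
    (∀ i, (M i).Nonempty) ∧
    (∀ i, IsConjugacyInvariant (M i)) ∧
    (∀ i, IsEmbeddedSubmanifoldOfCodim (M i) (c i)) ∧
    (∀ i, b ≤ c i) ∧
    ∃! i, c i = b

/-- All complex eigenvalues of the complex matrix `Z` lie on the imaginary axis (`0` is allowed). -/
def HasImaginarySpectrum {m : Type*} [Fintype m] [DecidableEq m] (Z : Matrix m m ℂ) : Prop :=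
  ∀ z ∈ spectrum ℂ Z, z.re = 0

/-- The complex model of the quaternionic `n × n` matrices: the real algebra of all complex
`2n × 2n` matrices of the block form `(X, Y; -Ȳ, X̄)`. -/
def quaternionicMatrices (n : ℕ) : Subalgebra ℝ (Matrix (Fin n ⊕ Fin n) (Fin n ⊕ Fin n) ℂ) where
  carrier := {Z | ∃ X Y : Matrix (Fin n) (Fin n) ℂ,
    Z = Matrix.fromBlocks X Y (-(Y.map (starRingEnd ℂ))) (X.map (starRingEnd ℂ))}
  mul_mem' := by
    rintro _ _ ⟨X, Y, rfl⟩ ⟨X', Y', rfl⟩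
    refine ⟨X * X' - Y * Y'.map (starRingEnd ℂ), X * Y' + Y * X'.map (starRingEnd ℂ), ?_⟩
    have h : ∀ U : Matrix (Fin n) (Fin n) ℂ,
        (U.map (starRingEnd ℂ)).map (starRingEnd ℂ) = U := by
      intro U; ext i j; simp
    rw [Matrix.fromBlocks_multiply]
    congr 1
    · simp [sub_eq_add_neg]
    · rw [Matrix.map_add _ (map_add _), Matrix.map_mul, Matrix.map_mul, h]
      simp [add_comm]
    · rw [Matrix.map_sub _ (map_sub _), Matrix.map_mul, Matrix.map_mul, h]
      simp [sub_eq_add_neg, add_comm]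
  add_mem' := by
    rintro _ _ ⟨X, Y, rfl⟩ ⟨X', Y', rfl⟩
    refine ⟨X + X', Y + Y', ?_⟩
    rw [Matrix.fromBlocks_add, Matrix.map_add _ (map_add _), Matrix.map_add _ (map_add _),
      neg_add]
  algebraMap_mem' := by
    intro r
    refine ⟨algebraMap ℝ _ r, 0, ?_⟩
    ext i j
    rcases i with i | i <;> rcases j with j | j <;> by_cases h : i = j <;>
      simp [Matrix.algebraMap_matrix_apply, h]

/-! Each of the three algebras consists of the complex linear maps commuting with a family `τ` of κ
≤ 1 antilinear maps squaring to ε: none for complex matrices, one with ε = 1 for real matrices, one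
with ε = -1 for quaternionic ones. Everything is proved at once for `equivariantMaps τ τ`, whose
real dimension times 1 + κ is 2N², where N is the complex dimension of the space acted on.

An endomorphism is recorded by its nullities dim ker (X - μ)^j. A stratum consists of the elements
with a given `spectralType`: multiplicity of 0, number of eigenvalues, sum of all nullities,
expected codimension. Nullities are upper semicontinuous. If a small perturbation keeps the
multiplicity of 0 and the number of eigenvalues, no eigenvalue splits; if it also keeps the sum of
the nullities, it keeps every single nullity. So near X the stratum consists of the endomorphisms of
the Jordan type of X whose nonzero eigenvalues move along the imaginary axis.

This is a submanifold (`hasLocalStratum`). Splitting off eigenvalues, conjugate pairs together when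
κ = 1, and conjugating nearby endomorphisms to block diagonal form by the inverse function theorem
(`hasLocalStratum_diag`, `hasLocalStratum_of_swap`) reduces to one eigenvalue; subtracting the mean
trace reduces further to nilpotents (`hasLocalStratum_of_single`). A nilpotent X is treated by
recursion on V / ker X (`exists_isSubmanifoldAt_nullityStratum`). Writing w_j for the increments of
the nullities at an eigenvalue, (1 + κ) times the codimension is the sum over the eigenvalues of 2 ∑
w_j², lowered by 1 for each nonzero eigenvalue.

The bounds are then arithmetic. In the nilpotent case let a = 1, or a = 2 for quaternions, where all
kernels have even dimension. Since a divides w_j, ∑ w_j² ≥ a ∑ w_j = aN, with equality only for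
nullities min(aj, N). For imaginary spectrum a nonzero eigenvalue of multiplicity k contributes at
least 2k - 1 ≥ k, and the eigenvalue 0 at least 2k. Equality needs simple nonzero eigenvalues and
the least possible multiplicity of 0, which is n mod 2 for real matrices and 0 otherwise. In both
cases equality determines the spectral type, hence the stratum. -/

open Filter Topology

/-! ### Local parametrizations and slice charts of submanifolds -/

section LocalSubmanifold

variable {E F : Type*} [NormedAddCommGroup E] [NormedSpace ℝ E]
  [NormedAddCommGroup F] [NormedSpace ℝ F]

/-- Near its point `p`, the set `M` is an embedded analytic submanifold of dimension `d`: it has an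
analytic parametrization `ψ` with an analytic local left inverse `r` defined on the ambient space.
-/
def IsSubmanifoldAt (M : Set E) (p : E) (d : ℕ) : Prop :=
  p ∈ M ∧ ∃ (r : E → EuclideanSpace ℝ (Fin d)) (ψ : EuclideanSpace ℝ (Fin d) → E),
    ContDiffAt ℝ ω r p ∧ ContDiffAt ℝ ω ψ (r p) ∧
    (∀ᶠ y in 𝓝 (r p), ψ y ∈ M ∧ r (ψ y) = y) ∧ ∀ᶠ x in 𝓝 p, x ∈ M → ψ (r x) = x

theorem IsSubmanifoldAt.of_param [FiniteDimensional ℝ F] {M : Set E} {p : E} (hp : p ∈ M)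
    (r : E → F) (ψ : F → E) (hr : ContDiffAt ℝ ω r p) (hψ : ContDiffAt ℝ ω ψ (r p))
    (h1 : ∀ᶠ y in 𝓝 (r p), ψ y ∈ M ∧ r (ψ y) = y) (h2 : ∀ᶠ x in 𝓝 p, x ∈ M → ψ (r x) = x) :
    IsSubmanifoldAt M p (Module.finrank ℝ F) := by
  have e : F ≃L[ℝ] EuclideanSpace ℝ (Fin (Module.finrank ℝ F)) :=
    ContinuousLinearEquiv.ofFinrankEq (by simp)
  refine ⟨hp, fun x => e (r x), fun y => ψ (e.symm y), e.contDiff.contDiffAt.comp p hr, ?_, ?_, ?_⟩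
  · exact ContDiffAt.comp (e (r p)) (by simpa using hψ) e.symm.contDiff.contDiffAt
  · have ht : Tendsto e.symm (𝓝 (e (r p))) (𝓝 (r p)) := by
      simpa using e.symm.continuous.tendsto (e (r p))
    filter_upwards [ht.eventually h1] with y hy
    exact ⟨hy.1, by simp [hy.2]⟩
  · filter_upwards [h2] with x hx hxM
    simpa using hx hxM

/-- The maps `r` and `ψ` need to be mutually inverse only between `M` and `N`, so `E` and `F` may
have different dimensions. This is how a set of endomorphisms is identified with a product of
simpler sets. -/
theorem IsSubmanifoldAt.transfer {M : Set E} {N : Set F} {p : E} {d : ℕ} (r : E → F) (ψ : F → E)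
    (hN : IsSubmanifoldAt N (r p) d) (hp : p ∈ M)
    (hr : ContDiffAt ℝ ω r p) (hψ : ContDiffAt ℝ ω ψ (r p))
    (h1 : ∀ᶠ y in 𝓝 (r p), y ∈ N → ψ y ∈ M ∧ r (ψ y) = y)
    (h2 : ∀ᶠ x in 𝓝 p, x ∈ M → r x ∈ N ∧ ψ (r x) = x) :
    IsSubmanifoldAt M p d := by
  obtain ⟨hpN, s, φ, hs, hφ, h3, h4⟩ := hN
  have hφs : φ (s (r p)) = r p := h4.self_of_nhds hpN
  have hφt : Tendsto φ (𝓝 (s (r p))) (𝓝 (r p)) := by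
    have := hφ.continuousAt.tendsto
    rwa [hφs] at this
  refine ⟨hp, fun x => s (r x), fun y => ψ (φ y), hs.comp p hr, ?_, ?_, ?_⟩
  · exact ContDiffAt.comp (s (r p)) (by rwa [hφs]) hφ
  · filter_upwards [h3, hφt.eventually h1] with y hy hy1
    obtain ⟨hm, he⟩ := hy1 hy.1
    exact ⟨hm, by rw [he, hy.2]⟩
  · filter_upwards [h2, hr.continuousAt.tendsto.eventually h4] with x hx hx4 hxM
    obtain ⟨hm, he⟩ := hx hxM
    rw [hx4 hm, he]

theorem Submodule.isSubmanifoldAt [FiniteDimensional ℝ E] (S : Submodule ℝ E) {p : E}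
    (hp : p ∈ S) : IsSubmanifoldAt (S : Set E) p (Module.finrank ℝ S) := by
  obtain ⟨f, hf⟩ := S.subtype.exists_leftInverse_of_injective S.ker_subtype
  have hf' : ∀ y : S, f y = y := fun y => by simpa using LinearMap.congr_fun hf y
  refine IsSubmanifoldAt.of_param hp (fun x => f.toContinuousLinearMap x)
    (fun y => S.subtypeL y) ?_ ?_ ?_ ?_
  · exact (ContinuousLinearMap.contDiff _).contDiffAt
  · exact (ContinuousLinearMap.contDiff _).contDiffAt
  · exact Eventually.of_forall fun y => ⟨y.2, by simp [hf']⟩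
  · refine Eventually.of_forall fun x hx => ?_
    have := hf' ⟨x, hx⟩
    simp only at this
    simp [this]

theorem IsSubmanifoldAt.prod {M : Set E} {N : Set F} {p : E} {q : F} {d e : ℕ}
    (hM : IsSubmanifoldAt M p d) (hN : IsSubmanifoldAt N q e) :
    IsSubmanifoldAt (M ×ˢ N) (p, q) (d + e) := by
  obtain ⟨hp, r, ψ, hr, hψ, h1, h2⟩ := hM
  obtain ⟨hq, s, φ, hs, hφ, h3, h4⟩ := hN
  have := IsSubmanifoldAt.of_param (M := M ×ˢ N) (p := (p, q)) ⟨hp, hq⟩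
    (Prod.map r s) (Prod.map ψ φ) (ContDiffAt.prodMap hr hs) (ContDiffAt.prodMap hψ hφ) ?_ ?_
  · simpa using this
  · have := h1.prod_nhds h3
    simp only [Prod.map_apply]
    filter_upwards [this] with y hy
    exact ⟨⟨hy.1.1, hy.2.1⟩, Prod.ext hy.1.2 hy.2.2⟩
  · filter_upwards [h2.prod_nhds h4] with y hy hyM
    exact Prod.ext (hy.1 hyM.1) (hy.2 hyM.2)

/-- The chart is x ↦ (r x, π (x - ψ (r x))), where π has the tangent space, the image of dψ, as
kernel. Its derivative is injective because dr ∘ dψ = id, and the second coordinate measures the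
failure of x = ψ (r x). -/
theorem IsSubmanifoldAt.exists_sliceChart [FiniteDimensional ℝ E] {M : Set E} {p : E} {d c : ℕ}
    (hM : IsSubmanifoldAt M p d) (hdc : d + c = Module.finrank ℝ E) :
    ∃ Φ : OpenPartialHomeomorph E (EuclideanSpace ℝ (Fin d) × EuclideanSpace ℝ (Fin c)),
      p ∈ Φ.source ∧ ContDiffOn ℝ ∞ Φ Φ.source ∧ ContDiffOn ℝ ∞ Φ.symm Φ.target ∧
      ∀ x ∈ Φ.source, x ∈ M ↔ (Φ x).2 = 0 := by
  have : CompleteSpace E := FiniteDimensional.complete ℝ E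
  obtain ⟨hp, r, ψ, hr, hψ, h1, h2⟩ := hM
  have hψr : ψ (r p) = p := h2.self_of_nhds hp
  set A := fderiv ℝ r p with hA
  set B := fderiv ℝ ψ (r p) with hB
  have hr' : HasFDerivAt r A p := (hr.differentiableAt (by simp)).hasFDerivAt
  have hψ' : HasFDerivAt ψ B (r p) := (hψ.differentiableAt (by simp)).hasFDerivAt
  have hAB : ∀ w, A (B w) = w := by
    have h5 : HasFDerivAt (r ∘ ψ) (A.comp B) (r p) :=
      HasFDerivAt.comp (r p) (by rwa [hψr]) hψ'
    have h6 : HasFDerivAt (r ∘ ψ) (ContinuousLinearMap.id ℝ _) (r p) :=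
      (hasFDerivAt_id (r p)).congr_of_eventuallyEq (h1.mono fun y hy => hy.2)
    intro w
    simpa using DFunLike.congr_fun (h5.unique h6) w
  set R := LinearMap.range (B : EuclideanSpace ℝ (Fin d) →ₗ[ℝ] E) with hR
  have hRd : Module.finrank ℝ R = d := by
    rw [hR, LinearMap.finrank_range_of_inj (Function.LeftInverse.injective hAB)]
    simp
  have hq : Module.finrank ℝ (E ⧸ R) = Module.finrank ℝ (EuclideanSpace ℝ (Fin c)) := by
    have := R.finrank_quotient_add_finrank
    simp only [finrank_euclideanSpace, Fintype.card_fin]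
    omega
  let π : E →L[ℝ] EuclideanSpace ℝ (Fin c) :=
    ((LinearEquiv.ofFinrankEq _ _ hq).toLinearMap ∘ₗ R.mkQ).toContinuousLinearMap
  have hπ : ∀ v, π v = 0 → v ∈ R := by
    intro v hv
    have : (LinearEquiv.ofFinrankEq _ _ hq) (R.mkQ v) = 0 := hv
    simpa using this
  let f : E → EuclideanSpace ℝ (Fin d) × EuclideanSpace ℝ (Fin c) :=
    fun x => (r x, π (x - ψ (r x)))
  have hψr' : ContDiffAt ℝ ω (fun x => ψ (r x)) p := ContDiffAt.comp p hψ hr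
  have hf : ContDiffAt ℝ ω f p :=
    hr.prodMk (π.contDiff.contDiffAt.comp p (contDiffAt_id.sub hψr'))
  let L : E →L[ℝ] EuclideanSpace ℝ (Fin d) × EuclideanSpace ℝ (Fin c) :=
    A.prod (π.comp (ContinuousLinearMap.id ℝ E - B.comp A))
  have hfL : HasFDerivAt f L p :=
    hr'.prodMk (π.hasFDerivAt.comp p ((hasFDerivAt_id p).sub (hψ'.comp p hr')))
  have hLinj : Function.Injective L := by
    rw [injective_iff_map_eq_zero]
    intro v hv
    have hv1 : A v = 0 := congrArg Prod.fst hv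
    have hv2 : π (v - B (A v)) = 0 := congrArg Prod.snd hv
    rw [hv1, map_zero, sub_zero] at hv2
    obtain ⟨w, hw⟩ := hπ v hv2
    have hw' : B w = v := hw
    have : w = 0 := by rw [← hAB w, hw', hv1]
    rw [← hw', this, map_zero]
  let e : E ≃L[ℝ] EuclideanSpace ℝ (Fin d) × EuclideanSpace ℝ (Fin c) :=
    (LinearEquiv.ofInjectiveOfFinrankEq L.toLinearMap hLinj
      (by simp [hdc])).toContinuousLinearEquiv
  have he : (e : E →L[ℝ] _) = L := by ext v <;> rfl
  have hfe : HasFDerivAt f (e : E →L[ℝ] _) p := by rwa [he]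
  let Φ := hf.toOpenPartialHomeomorph f hfe (by simp)
  have hΦ : ∀ x, Φ x = f x := fun _ => rfl
  have hpΦ : p ∈ Φ.source := hf.mem_toOpenPartialHomeomorph_source hfe _
  have hsymm : ContDiffAt ℝ ω Φ.symm (f p) := by
    apply Φ.contDiffAt_symm (Φ.map_source hpΦ)
    · rw [Φ.left_inv hpΦ]; exact hfe
    · rw [Φ.left_inv hpΦ]; exact hf
  have hev : ∀ᶠ x in 𝓝 p, ContDiffAt ℝ ω f x ∧ ContDiffAt ℝ ω Φ.symm (f x) ∧
      (ψ (r x) ∈ M ∧ r (ψ (r x)) = r x) ∧ (x ∈ M → ψ (r x) = x) ∧ ψ (r x) ∈ Φ.source := by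
    have h5 := hf.eventually (by simp)
    have h6 := hf.continuousAt.tendsto.eventually (hsymm.eventually (by simp))
    have h7 := hr.continuousAt.tendsto.eventually h1
    have h8 : ∀ᶠ x in 𝓝 p, ψ (r x) ∈ Φ.source :=
      hψr'.continuousAt.tendsto.eventually (by rw [hψr]; exact Φ.open_source.mem_nhds hpΦ)
    filter_upwards [h5, h6, h7, h2, h8] with x a b c d e using ⟨a, b, c, d, e⟩
  -- On `O` both the chart and its inverse are analytic and all local identities hold, so the chart
  -- is restricted to `O`.
  obtain ⟨O, hO, hOo, hpO⟩ := eventually_nhds_iff.1 hev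
  refine ⟨Φ.restrOpen O hOo, ⟨hpΦ, hpO⟩, ?_, ?_, ?_⟩
  · intro x hx
    exact ((hO x hx.2).1.of_le (by simp)).contDiffWithinAt
  · intro y hy
    have hy1 : y ∈ Φ.target := hy.1
    have hy2 : Φ.symm y ∈ O := by
      have := (Φ.restrOpen O hOo).map_target hy
      exact this.2
    have := (hO _ hy2).2.1
    rw [← hΦ, Φ.right_inv hy1] at this
    exact (this.of_le (by simp)).contDiffWithinAt
  · rintro x ⟨hx, hxO⟩
    obtain ⟨-, -, ⟨hm, he1⟩, hx1, hx2⟩ := hO x hxO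
    change x ∈ M ↔ π (x - ψ (r x)) = 0
    constructor
    · intro h
      rw [hx1 h, sub_self, map_zero]
    · intro h
      have : ψ (r x) = x := by
        -- Both x and ψ (r x) have the coordinates (r x, 0).
        refine Φ.injOn hx2 hx ?_
        rw [hΦ, hΦ]
        simp only [f, he1, h, sub_self, map_zero]
      rwa [this] at hm

theorem isEmbeddedSubmanifoldOfCodim_of_isSubmanifoldAt [FiniteDimensional ℝ E] {M : Set E}
    {d c : ℕ} (hdc : d + c = Module.finrank ℝ E) (hM : ∀ p ∈ M, IsSubmanifoldAt M p d) :
    IsEmbeddedSubmanifoldOfCodim M c :=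
  ⟨d, hdc, fun p hp => (hM p hp).exists_sliceChart hdc⟩

end LocalSubmanifold

/-! ### Dimensions of the kernels of powers -/

section Nullity

open Module

variable {V W : Type*} [AddCommGroup V] [Module ℂ V] [AddCommGroup W] [Module ℂ W]

/-- The dimension of the kernel of `(f - μ) ^ j`. -/
noncomputable def nullity (f : End ℂ V) (μ : ℂ) (j : ℕ) : ℕ :=
  finrank ℂ (LinearMap.ker ((f - algebraMap ℂ (End ℂ V) μ) ^ j))

/-- Only real linearity of `e` is required, so that antilinear bijections, which turn μ into its
conjugate, are covered too. -/
theorem nullity_eq_of_realEquiv (f : End ℂ V) (g : End ℂ W) (μ ν : ℂ) (e : V ≃ₗ[ℝ] W)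
    (h : ∀ v, e (f v - μ • v) = g (e v) - ν • e v) (j : ℕ) : nullity f μ j = nullity g ν j := by
  have hpow : ∀ (j : ℕ) v, e (((f - algebraMap ℂ (End ℂ V) μ) ^ j) v) =
      ((g - algebraMap ℂ (End ℂ W) ν) ^ j) (e v) := by
    intro j
    induction j with
    | zero => intro v; simp
    | succ j ih =>
      intro v
      rw [pow_succ, pow_succ, Module.End.mul_apply, Module.End.mul_apply, ih]
      congr 1
      simpa [Module.algebraMap_end_apply] using h v
  have e' : LinearMap.ker ((f - algebraMap ℂ (End ℂ V) μ) ^ j) ≃ₗ[ℝ]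
      LinearMap.ker ((g - algebraMap ℂ (End ℂ W) ν) ^ j) := by
    refine LinearEquiv.ofBijective
      (LinearMap.codRestrict
        ((LinearMap.ker ((g - algebraMap ℂ (End ℂ W) ν) ^ j)).restrictScalars ℝ)
        (e.toLinearMap ∘ₗ ((LinearMap.ker ((f - algebraMap ℂ (End ℂ V) μ) ^ j)).restrictScalars
          ℝ).subtype) ?_) ⟨?_, ?_⟩
    · rintro ⟨v, hv⟩
      have hv' : ((f - algebraMap ℂ (End ℂ V) μ) ^ j) v = 0 := hv
      simp [← hpow, hv']
    · rintro ⟨v, hv⟩ ⟨w, hw⟩ h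
      have : e v = e w := congrArg Subtype.val h
      exact Subtype.ext (e.injective this)
    · rintro ⟨w, hw⟩
      refine ⟨⟨e.symm w, ?_⟩, Subtype.ext (e.apply_symm_apply w)⟩
      have hw' : ((g - algebraMap ℂ (End ℂ W) ν) ^ j) w = 0 := hw
      have := hpow j (e.symm w)
      rw [e.apply_symm_apply, hw'] at this
      simpa using this
  have h1 := finrank_real_of_complex (LinearMap.ker ((f - algebraMap ℂ (End ℂ V) μ) ^ j))
  have h2 := finrank_real_of_complex (LinearMap.ker ((g - algebraMap ℂ (End ℂ W) ν) ^ j))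
  have h3 := e'.finrank_eq
  simp only [nullity]
  omega

theorem nullity_eq_of_equiv (f : End ℂ V) (g : End ℂ W) (e : V ≃ₗ[ℂ] W)
    (h : ∀ v, e (f v) = g (e v)) : nullity f = nullity g := by
  funext μ j
  exact nullity_eq_of_realEquiv f g μ μ (e.restrictScalars ℝ) (fun v => by simp [h]) j

theorem nullity_prodMap [FiniteDimensional ℂ V] [FiniteDimensional ℂ W] (f : End ℂ V)
    (g : End ℂ W) : nullity (V := V × W) (f.prodMap g) = nullity f + nullity g := by
  funext μ j
  have h1 : (f.prodMap g - algebraMap ℂ (End ℂ (V × W)) μ) =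
      (f - algebraMap ℂ (End ℂ V) μ).prodMap (g - algebraMap ℂ (End ℂ W) μ) := by
    ext <;> simp [Module.algebraMap_end_apply]
  have h2 : ∀ (a : End ℂ V) (b : End ℂ W), (a.prodMap b : End ℂ (V × W)) ^ j =
      (a ^ j).prodMap (b ^ j) := by
    intro a b
    induction j with
    | zero => rfl
    | succ j ih => rw [pow_succ, pow_succ, pow_succ, ih]; rfl
  simp only [nullity, Pi.add_apply]
  rw [h1, h2, LinearMap.ker_prodMap, ← finrank_prod]
  exact LinearEquiv.finrank_eq
    { toFun := fun x => (⟨x.1.1, x.2.1⟩, ⟨x.1.2, x.2.2⟩)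
      invFun := fun x => ⟨(x.1.1, x.2.1), ⟨x.1.2, x.2.2⟩⟩
      map_add' := fun _ _ => rfl
      map_smul' := fun _ _ => rfl
      left_inv := fun _ => rfl
      right_inv := fun _ => rfl }

@[simp] theorem nullity_zero_right (f : End ℂ V) (μ : ℂ) : nullity f μ 0 = 0 := by
  rw [nullity, pow_zero, Module.End.one_eq_id, LinearMap.ker_id, finrank_bot]

variable [FiniteDimensional ℂ V]

theorem nullity_le_finrank (f : End ℂ V) (μ : ℂ) (j : ℕ) : nullity f μ j ≤ finrank ℂ V :=
  Submodule.finrank_le _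

theorem nullity_mono (f : End ℂ V) (μ : ℂ) : Monotone (nullity f μ) := by
  refine monotone_nat_of_le_succ fun j => Submodule.finrank_mono fun v hv => ?_
  simp only [LinearMap.mem_ker] at hv ⊢
  rw [pow_succ', Module.End.mul_apply, hv, map_zero]

theorem nullity_one_ne_zero_iff (f : End ℂ V) (μ : ℂ) :
    nullity f μ 1 ≠ 0 ↔ f.HasEigenvalue μ := by
  rw [Module.End.hasEigenvalue_iff, Module.End.eigenspace_def, nullity, pow_one, Ne,
    Submodule.finrank_eq_zero, Algebra.algebraMap_eq_smul_one]

/-- The map (f - μ)^j sends ker (f - μ)^(j+1) into ker (f - μ), and its kernel there lies in ker (f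
- μ)^j. -/
theorem nullity_succ_le (f : End ℂ V) (μ : ℂ) (j : ℕ) :
    nullity f μ (j + 1) ≤ nullity f μ j + nullity f μ 1 := by
  set g := f - algebraMap ℂ (End ℂ V) μ with hg
  let T : LinearMap.ker (g ^ (j + 1)) →ₗ[ℂ] LinearMap.ker (g ^ 1) :=
    LinearMap.restrict (g ^ j) (fun v hv => by
      simp only [LinearMap.mem_ker] at hv ⊢
      rwa [← Module.End.mul_apply, ← pow_add, add_comm])
  have h1 := T.finrank_range_add_finrank_ker
  have h2 : finrank ℂ (LinearMap.range T) ≤ nullity f μ 1 := Submodule.finrank_le _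
  have h3 : finrank ℂ (LinearMap.ker T) ≤ nullity f μ j := by
    let U : LinearMap.ker T →ₗ[ℂ] LinearMap.ker (g ^ j) :=
      LinearMap.codRestrict _ ((LinearMap.ker (g ^ (j + 1))).subtype ∘ₗ (LinearMap.ker T).subtype)
        (fun v => by
          have := v.2
          rw [LinearMap.mem_ker] at this
          exact congrArg Subtype.val this)
    refine LinearMap.finrank_le_finrank_of_injective (f := U) ?_
    intro a b hab
    exact Subtype.ext (Subtype.ext (congrArg (fun x : LinearMap.ker (g ^ j) => (x : V)) hab))
  have h4 : finrank ℂ (LinearMap.ker (g ^ (j + 1))) = nullity f μ (j + 1) := rfl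
  omega

theorem nullity_eq_zero_of_not_hasEigenvalue {f : End ℂ V} {μ : ℂ} (h : ¬ f.HasEigenvalue μ) :
    nullity f μ = 0 := by
  have h1 : nullity f μ 1 = 0 := not_not.1 (mt (nullity_one_ne_zero_iff f μ).1 h)
  funext j
  induction j with
  | zero => simp
  | succ j ih =>
    have := nullity_succ_le f μ j
    simp only [Pi.zero_apply] at ih ⊢
    omega

theorem nullity_ne_zero_iff (f : End ℂ V) (μ : ℂ) : nullity f μ ≠ 0 ↔ f.HasEigenvalue μ :=
  ⟨fun h => not_not.1 (mt nullity_eq_zero_of_not_hasEigenvalue h),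
    fun h h0 => (nullity_one_ne_zero_iff f μ).2 h (congrFun h0 1)⟩

theorem nullity_eq_of_stationary {f : End ℂ V} {μ : ℂ} {j : ℕ}
    (h : nullity f μ (j + 1) = nullity f μ j) (m : ℕ) : nullity f μ (j + m) = nullity f μ j := by
  have hk : LinearMap.ker ((f - algebraMap ℂ (End ℂ V) μ) ^ j) =
      LinearMap.ker ((f - algebraMap ℂ (End ℂ V) μ) ^ (j + 1)) := by
    refine Submodule.eq_of_le_of_finrank_eq (fun v hv => ?_) h.symm
    simp only [LinearMap.mem_ker] at hv ⊢
    rw [pow_succ', Module.End.mul_apply, hv, map_zero]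
  have := Module.End.ker_pow_constant hk m
  simp only [nullity]
  rw [← this]

theorem nullity_eq_of_finrank_le (f : End ℂ V) (μ : ℂ) {j : ℕ} (hj : finrank ℂ V ≤ j) :
    nullity f μ j = nullity f μ (finrank ℂ V) := by
  have := Module.End.ker_pow_eq_ker_pow_finrank_of_le (f := f - algebraMap ℂ (End ℂ V) μ) hj
  simp only [nullity]
  rw [this]

theorem finite_nullity_ne_zero (f : End ℂ V) : {μ | nullity f μ ≠ 0}.Finite := by
  simp only [nullity_ne_zero_iff]
  exact Module.End.finite_hasEigenvalue f

/-- For `J` at least the dimension, the nullity is the multiplicity of μ as a root of the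
characteristic polynomial. -/
theorem finsum_nullity (f : End ℂ V) {J : ℕ} (hJ : finrank ℂ V ≤ J) :
    ∑ᶠ μ, nullity f μ J = finrank ℂ V := by
  have h1 : ∀ μ, nullity f μ J = f.charpoly.rootMultiplicity μ := by
    intro μ
    rw [nullity_eq_of_finrank_le f μ hJ, ← LinearMap.finrank_maxGenEigenspace_eq,
      Module.End.maxGenEigenspace_eq_genEigenspace_finrank, Module.End.genEigenspace_nat,
      nullity, Algebra.algebraMap_eq_smul_one]
  simp only [h1]
  rw [finsum_eq_sum_of_support_subset (s := f.charpoly.roots.toFinset)]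
  · simp only [← Polynomial.count_roots]
    rw [Multiset.toFinset_sum_count_eq, ← LinearMap.charpoly_natDegree f]
    exact (Polynomial.splits_iff_card_roots.1 (IsAlgClosed.splits _))
  · intro μ hμ
    have : f.charpoly.rootMultiplicity μ ≠ 0 := hμ
    rw [← Polynomial.count_roots] at this
    simpa [Multiset.count_ne_zero, and_comm] using this

theorem isNilpotent_iff_nullity (f : End ℂ V) {J : ℕ} (hJ : finrank ℂ V ≤ J) :
    IsNilpotent f ↔ nullity f 0 J = finrank ℂ V := by
  constructor
  · intro h
    have h1 : f ^ finrank ℂ V = 0 := by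
      have := LinearMap.aeval_self_charpoly f
      rwa [h.charpoly_eq_X_pow_finrank, map_pow, Polynomial.aeval_X] at this
    rw [nullity, map_zero, sub_zero, pow_eq_zero_of_le hJ h1, LinearMap.ker_zero, finrank_top]
  · intro h
    refine ⟨J, LinearMap.ker_eq_top.1 ?_⟩
    apply Submodule.eq_top_of_finrank_eq
    rwa [nullity, map_zero, sub_zero] at h

end Nullity

/-! ### Discrete invariants summed over the spectrum -/

section SpectralSum

/-- The sum over all `μ` of a numerical function of the nullities at `μ`. -/
noncomputable def spectralSum (F : ℂ → (ℕ → ℕ) → ℕ) (n : ℂ → ℕ → ℕ) : ℕ := ∑ᶠ μ, F μ (n μ)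

variable {F : ℂ → (ℕ → ℕ) → ℕ}

theorem spectralSum_eq_sum (hF : ∀ μ, F μ 0 = 0) {n : ℂ → ℕ → ℕ} {s : Finset ℂ}
    (hs : ∀ μ, n μ ≠ 0 → μ ∈ s) : spectralSum F n = ∑ μ ∈ s, F μ (n μ) := by
  refine finsum_eq_sum_of_support_subset _ fun μ hμ => hs μ fun h => hμ ?_
  simp only [h, hF]

theorem spectralSum_add (hF : ∀ μ, F μ 0 = 0) {n m : ℂ → ℕ → ℕ} (hn : {μ | n μ ≠ 0}.Finite)
    (hm : {μ | m μ ≠ 0}.Finite) (h : ∀ μ, n μ = 0 ∨ m μ = 0) :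
    spectralSum F (n + m) = spectralSum F n + spectralSum F m := by
  have hs : ∀ {k : ℂ → ℕ → ℕ}, {μ | k μ ≠ 0}.Finite →
      (Function.support fun μ => F μ (k μ)).Finite := fun hk =>
    hk.subset fun μ hμ h0 => hμ (by simp only [h0, hF])
  rw [spectralSum, spectralSum, spectralSum, ← finsum_add_distrib (hs hn) (hs hm)]
  refine finsum_congr fun μ => ?_
  rcases h μ with h | h <;> simp [h, hF]

theorem spectralSum_comp_conj (hF : ∀ μ, F (starRingEnd ℂ μ) = F μ) (n : ℂ → ℕ → ℕ) :
    spectralSum F (fun μ => n (starRingEnd ℂ μ)) = spectralSum F n := by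
  rw [spectralSum, spectralSum,
    ← finsum_comp_equiv (starRingAut : RingAut ℂ).toEquiv (f := fun μ => F μ (n μ))]
  refine finsum_congr fun μ => ?_
  exact (congrFun (hF μ) _).symm

theorem spectralSum_of_forall_ne (hF : ∀ μ, F μ 0 = 0) {n : ℂ → ℕ → ℕ} (μ : ℂ)
    (h : ∀ ν, ν ≠ μ → n ν = 0) : spectralSum F n = F μ (n μ) := by
  rw [spectralSum_eq_sum hF (s := {μ}) (fun ν hν => ?_), Finset.sum_singleton]
  simpa using not_imp_comm.1 (h ν) hν

/-- Summand counting eigenvalues. -/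
noncomputable def eigenCount (_ : ℂ) (k : ℕ → ℕ) : ℕ := if k 1 = 0 then 0 else 1

/-- Summand adding up the nullities of the first powers. -/
def eigenTotal (J : ℕ) (_ : ℂ) (k : ℕ → ℕ) : ℕ := ∑ j ∈ Finset.range (J + 1), k j

/-- Twice the complex codimension of the orbit of a block, minus one if its eigenvalue is
allowed to vary in a line. -/
noncomputable def eigenCodim (J : ℕ) (μ : ℂ) (k : ℕ → ℕ) : ℕ :=
  2 * ∑ j ∈ Finset.range J, (k (j + 1) - k j) ^ 2 - if μ = 0 then 0 else 1

@[simp] theorem eigenCount_zero (μ : ℂ) : eigenCount μ 0 = 0 := by simp [eigenCount]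
@[simp] theorem eigenTotal_zero (J : ℕ) (μ : ℂ) : eigenTotal J μ 0 = 0 := by simp [eigenTotal]
-- When `μ ≠ 0` this is the truncated difference 0 - 1 = 0. Hence numbers that are not eigenvalues
-- contribute nothing to the spectral sum.
@[simp] theorem eigenCodim_zero (J : ℕ) (μ : ℂ) : eigenCodim J μ 0 = 0 := by simp [eigenCodim]

theorem eigenCodim_conj (J : ℕ) (μ : ℂ) : eigenCodim J (starRingEnd ℂ μ) = eigenCodim J μ := by
  funext k
  simp [eigenCodim]

/-- The discrete invariants of a spectral type. -/
structure SpectralType where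
  zeroMult : ℕ
  count : ℕ
  total : ℕ
  codim : ℕ

/-- The discrete invariants determined by the nullities. -/
noncomputable def spectralType (J : ℕ) (n : ℂ → ℕ → ℕ) : SpectralType where
  zeroMult := n 0 J
  count := spectralSum eigenCount n
  total := spectralSum (eigenTotal J) n
  codim := spectralSum (eigenCodim J) n

end SpectralSum

/-! ### Slices for conjugation via the exponential -/

section Slice

open NormedSpace

variable {A : Type*} [NormedRing A] [NormedAlgebra ℝ A]

/-- Conjugation of the component `β z` by the exponential of the complementary component. -/
noncomputable def sliceMap (β : A →L[ℝ] A) (z : A) : A :=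
  exp (z - β z) * β z * exp (-(z - β z))

variable [FiniteDimensional ℝ A]

theorem contDiff_sliceMap (β : A →L[ℝ] A) : ContDiff ℝ ω (sliceMap β) := by
  have : CompleteSpace A := FiniteDimensional.complete ℝ A
  have hexp : ContDiff ℝ ω (exp : A → A) :=
    contDiff_iff_contDiffAt.2 fun y => (exp_analytic (𝕂 := ℝ) y).contDiffAt
  have h1 : ContDiff ℝ ω (fun z : A => z - β z) := contDiff_id.sub β.contDiff
  exact ((hexp.comp h1).mul β.contDiff).mul (hexp.comp h1.neg)

/-- Inverse function theorem: the derivative of `sliceMap β` at x is v ↦ β v + [v - β v, x]. If it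
kills v, applying β removes the bracket and gives β v = 0; then v commutes with x and vanishes by
`hinj`. -/
theorem exists_local_inverse_sliceMap (β : A →L[ℝ] A) (hβ : ∀ z, β (β z) = β z) {x : A}
    (hx : β x = x) (hc : ∀ c, β c = 0 → β (c * x - x * c) = 0)
    (hinj : ∀ c, β c = 0 → c * x = x * c → c = 0) :
    ∃ r : A → A, ContDiffAt ℝ ω r x ∧ r x = x ∧ (∀ᶠ y in 𝓝 x, sliceMap β (r y) = y) ∧
      ∀ᶠ z in 𝓝 x, r (sliceMap β z) = z := by
  have : CompleteSpace A := FiniteDimensional.complete ℝ A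
  have hG : ContDiffAt ℝ ω (sliceMap β) x := (contDiff_sliceMap β).contDiffAt
  let δ : A →L[ℝ] A := ContinuousLinearMap.id ℝ A - β
  let L : A →L[ℝ] A := β + ((ContinuousLinearMap.mul ℝ A).flip x).comp δ -
    ((ContinuousLinearMap.mul ℝ A) x).comp δ
  have hL : ∀ v, L v = β v + ((v - β v) * x - x * (v - β v)) := fun v => by
    simp only [L, δ, sub_apply, add_apply,
      ContinuousLinearMap.comp_apply, ContinuousLinearMap.flip_apply,
      ContinuousLinearMap.mul_apply',
      ContinuousLinearMap.id_apply, add_sub_assoc]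
  have hδ : HasFDerivAt (fun z : A => z - β z) δ x := (hasFDerivAt_id x).sub β.hasFDerivAt
  -- Both exponentials are evaluated at 0, where the derivative of `exp` is the identity.
  have h0 : x - β x = 0 := by rw [hx, sub_self]
  have he : HasFDerivAt (fun z : A => exp (z - β z)) δ x := by
    have h1 : HasFDerivAt (exp : A → A) (1 : A →L[ℝ] A) (x - β x) := by
      rw [h0]; exact (hasStrictFDerivAt_exp_zero (𝕂 := ℝ)).hasFDerivAt
    exact h1.comp x hδ
  have he' : HasFDerivAt (fun z : A => exp (-(z - β z))) (-δ) x := by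
    have h1 : HasFDerivAt (exp : A → A) (1 : A →L[ℝ] A) (-(x - β x)) := by
      rw [h0, neg_zero]; exact (hasStrictFDerivAt_exp_zero (𝕂 := ℝ)).hasFDerivAt
    exact h1.comp x hδ.neg
  have hGL : HasFDerivAt (sliceMap β) L x := by
    have := (he.mul' β.hasFDerivAt).mul' he'
    refine this.congr_fderiv ?_
    ext v
    simp [hx, hL, δ]
    noncomm_ring
  have hinjL : Function.Injective L := by
    rw [injective_iff_map_eq_zero]
    intro v hv
    have hc0 : β (v - β v) = 0 := by rw [map_sub, hβ, sub_self]
    rw [hL] at hv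
    have h1 : β v = 0 := by
      have := congrArg β hv
      rwa [map_add, hβ, hc _ hc0, add_zero, map_zero] at this
    rw [h1, zero_add, sub_zero] at hv
    exact hinj v h1 (sub_eq_zero.1 hv)
  let e : A ≃L[ℝ] A :=
    (LinearEquiv.ofInjectiveEndo L.toLinearMap hinjL).toContinuousLinearEquiv
  have heL : (e : A →L[ℝ] A) = L := by ext v; rfl
  have hGe : HasFDerivAt (sliceMap β) (e : A →L[ℝ] A) x := by rwa [heL]
  let Φ := hG.toOpenPartialHomeomorph _ hGe (by simp)
  have hΦ : ∀ z, Φ z = sliceMap β z := fun _ => rfl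
  have hGx : sliceMap β x = x := by simp [sliceMap, hx]
  have hxs : x ∈ Φ.source := hG.mem_toOpenPartialHomeomorph_source hGe _
  have hxt : x ∈ Φ.target := by
    have := Φ.map_source hxs
    rwa [hΦ, hGx] at this
  have hsx : Φ.symm x = x := by
    have := Φ.left_inv hxs
    rwa [hΦ, hGx] at this
  refine ⟨Φ.symm, ?_, hsx, ?_, ?_⟩
  · apply Φ.contDiffAt_symm hxt
    · rw [hsx]; exact hGe
    · rw [hsx]; exact hG
  · filter_upwards [Φ.open_target.mem_nhds hxt] with y hy using Φ.right_inv hy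
  · filter_upwards [Φ.open_source.mem_nhds hxs] with z hz using Φ.left_inv hz

theorem sliceMap_map (β : A →L[ℝ] A) (σ : A →+* A) (hσ : Continuous σ)
    (hσβ : ∀ z, β (σ z) = σ (β z)) (z : A) : sliceMap β (σ z) = σ (sliceMap β z) := by
  have : CompleteSpace A := FiniteDimensional.complete ℝ A
  have : NormedAlgebra ℚ A := NormedAlgebra.restrictScalars ℚ ℝ A
  simp only [sliceMap, map_mul, hσβ, NormedSpace.map_exp σ hσ, map_neg, map_sub]

omit [FiniteDimensional ℝ A] in
-- If σ y = y, then σ (r y) is a second preimage of y near x, so it equals r y. Thus the local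
-- inverse preserves the fixed points of σ, in particular the equivariant endomorphisms.
theorem eventually_local_inverse_map {β : A →L[ℝ] A} {σ : A → A} (hσ : Continuous σ)
    (hσβ : ∀ z, sliceMap β (σ z) = σ (sliceMap β z)) {x : A} {r : A → A}
    (hσx : σ x = x) (hr : ContinuousAt r x) (hrx : r x = x)
    (h1 : ∀ᶠ y in 𝓝 x, sliceMap β (r y) = y) (h2 : ∀ᶠ z in 𝓝 x, r (sliceMap β z) = z) :
    ∀ᶠ y in 𝓝 x, σ y = y → σ (r y) = r y := by
  have h3 : Tendsto (fun y => σ (r y)) (𝓝 x) (𝓝 x) := by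
    have := (hσ.continuousAt (x := r x)).tendsto.comp hr.tendsto
    rwa [hrx, hσx] at this
  filter_upwards [h1, h3.eventually h2] with y hy1 hy2 hy
  rw [← hy2, hσβ, hy1, hy]

end Slice

/-! ### Semicontinuity of nullities and stability of disjoint spectra -/

section Semicontinuity

open Module

variable {V W : Type*} [NormedAddCommGroup V] [NormedSpace ℂ V] [FiniteDimensional ℂ V]
  [NormedAddCommGroup W] [NormedSpace ℂ W] [FiniteDimensional ℂ W]

omit [FiniteDimensional ℂ W] in
theorem eventually_isUnit_nhds_one [FiniteDimensional ℂ W] :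
    ∀ᶠ u : W →L[ℂ] W in 𝓝 1, IsUnit u := by
  have : CompleteSpace W := FiniteDimensional.complete ℂ W
  have h : IsOpen {u : W →L[ℂ] W | IsUnit u} := Units.isOpen
  exact h.mem_nhds isUnit_one

/-- On a complement U of ker f the map f has a left inverse P, and P ∘ g on U stays invertible for g
near f. Hence ker g meets U trivially and projects injectively to ker f. -/
theorem eventually_finrank_ker_le (f : V →L[ℂ] W) : ∀ᶠ g : V →L[ℂ] W in 𝓝 f,
    finrank ℂ (LinearMap.ker (g : V →ₗ[ℂ] W)) ≤ finrank ℂ (LinearMap.ker (f : V →ₗ[ℂ] W)) := by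
  have : CompleteSpace V := FiniteDimensional.complete ℂ V
  set K := LinearMap.ker (f : V →ₗ[ℂ] W) with hK
  obtain ⟨U, hU⟩ := K.exists_isCompl
  have : CompleteSpace U := FiniteDimensional.complete ℂ U
  have hinj : Function.Injective ((f : V →ₗ[ℂ] W) ∘ₗ U.subtype) := by
    rw [← LinearMap.ker_eq_bot, LinearMap.ker_eq_bot']
    intro u hu
    have : (u : V) ∈ K ⊓ U := ⟨hu, u.2⟩
    rw [hU.inf_eq_bot] at this
    exact Subtype.ext this
  obtain ⟨P, hP⟩ := LinearMap.exists_leftInverse_of_injective _ (LinearMap.ker_eq_bot.2 hinj)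
  let Pc : W →L[ℂ] U := P.toContinuousLinearMap
  have h1 : Pc.comp (f.comp U.subtypeL) = 1 := by
    ext u : 1
    exact LinearMap.congr_fun hP u
  have hcont : Continuous fun g : V →L[ℂ] W => Pc.comp (g.comp U.subtypeL) := by fun_prop
  have h2 : ∀ᶠ g : V →L[ℂ] W in 𝓝 f, IsUnit (Pc.comp (g.comp U.subtypeL)) := by
    have h3 := hcont.tendsto f
    simp only [h1] at h3
    exact h3.eventually eventually_isUnit_nhds_one
  filter_upwards [h2] with g hg
  let T : LinearMap.ker (g : V →ₗ[ℂ] W) →ₗ[ℂ] K :=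
    (K.projectionOnto U hU) ∘ₗ (LinearMap.ker (g : V →ₗ[ℂ] W)).subtype
  refine LinearMap.finrank_le_finrank_of_injective (f := T) ?_
  rw [← LinearMap.ker_eq_bot, LinearMap.ker_eq_bot']
  rintro ⟨v, hv⟩ hvT
  have hvU : v ∈ U := (Submodule.projectionOnto_apply_eq_zero_iff hU).1 hvT
  have hv0 : g v = 0 := hv
  have h3 : (Pc.comp (g.comp U.subtypeL)) ⟨v, hvU⟩ = 0 := by simp [hv0]
  have h4 : (⟨v, hvU⟩ : U) = 0 := by
    obtain ⟨u, hu⟩ := hg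
    rw [← hu] at h3
    calc (⟨v, hvU⟩ : U) = (↑u⁻¹ * ↑u : U →L[ℂ] U) ⟨v, hvU⟩ := by simp
      _ = (↑u⁻¹ : U →L[ℂ] U) ((↑u : U →L[ℂ] U) ⟨v, hvU⟩) := rfl
      _ = 0 := by rw [h3, map_zero]
  have h5 : v = 0 := congrArg Subtype.val h4
  exact Subtype.ext h5

/-- Semicontinuity is joint in the endomorphism and in μ, because the eigenvalues move with the
endomorphism. -/
theorem eventually_nullity_le (f : V →L[ℂ] V) (μ : ℂ) (j : ℕ) :
    ∀ᶠ q : (V →L[ℂ] V) × ℂ in 𝓝 (f, μ),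
      nullity (q.1 : V →ₗ[ℂ] V) q.2 j ≤ nullity (f : V →ₗ[ℂ] V) μ j := by
  have hcoe : ∀ (g : V →L[ℂ] V) (ν : ℂ), nullity (g : V →ₗ[ℂ] V) ν j =
      finrank ℂ (LinearMap.ker (((g - ν • 1) ^ j : V →L[ℂ] V) : V →ₗ[ℂ] V)) := by
    intro g ν
    have : (((g - ν • 1) ^ j : V →L[ℂ] V) : V →ₗ[ℂ] V) =
        ((g : V →ₗ[ℂ] V) - algebraMap ℂ (End ℂ V) ν) ^ j := by
      induction j with
      | zero => rfl
      | succ j ih =>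
        rw [pow_succ, pow_succ, ← ih]
        rfl
    rw [this]
    rfl
  simp only [hcoe]
  have hc : Continuous fun q : (V →L[ℂ] V) × ℂ => (q.1 - q.2 • (1 : V →L[ℂ] V)) ^ j := by fun_prop
  exact (hc.tendsto (f, μ)).eventually (eventually_finrank_ker_le _)

theorem norm_le_of_nullity_ne_zero {f : V →L[ℂ] V} {μ : ℂ}
    (h : nullity (f : V →ₗ[ℂ] V) μ ≠ 0) : ‖μ‖ ≤ ‖f‖ := by
  obtain ⟨v, hv⟩ := ((nullity_ne_zero_iff _ _).1 h).exists_hasEigenvector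
  have h1 : f v = μ • v := hv.apply_eq_smul
  have h2 := f.le_opNorm v
  rw [h1, norm_smul] at h2
  exact le_of_mul_le_mul_right h2 (norm_pos_iff.2 hv.2)

theorem nullity_eq_zero_of_one {f : End ℂ V} {μ : ℂ} (h : nullity f μ 1 = 0) : nullity f μ = 0 :=
  nullity_eq_zero_of_not_hasEigenvalue fun h' => (nullity_one_ne_zero_iff f μ).2 h' h

/-- For each fixed μ this follows from semicontinuity. Uniformity in μ comes from compactness of a
ball that contains the spectrum of every endomorphism near f. -/
theorem eventually_nullity_eq_zero_or {f : V →L[ℂ] V} {g : W →L[ℂ] W}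
    (h : ∀ μ, nullity (f : V →ₗ[ℂ] V) μ = 0 ∨ nullity (g : W →ₗ[ℂ] W) μ = 0) :
    ∀ᶠ q : (V →L[ℂ] V) × (W →L[ℂ] W) in 𝓝 (f, g),
      ∀ μ, nullity (q.1 : V →ₗ[ℂ] V) μ = 0 ∨ nullity (q.2 : W →ₗ[ℂ] W) μ = 0 := by
  have h1 : ∀ᶠ q : (V →L[ℂ] V) × (W →L[ℂ] W) in 𝓝 (f, g), ∀ μ ∈ Metric.closedBall (0 : ℂ)
      (‖f‖ + 1), nullity (q.1 : V →ₗ[ℂ] V) μ = 0 ∨ nullity (q.2 : W →ₗ[ℂ] W) μ = 0 := by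
    refine (isCompact_closedBall (0 : ℂ) (‖f‖ + 1)).eventually_forall_of_forall_eventually
      fun μ _ => ?_
    rcases h μ with h | h
    · have := eventually_nullity_le f μ 1
      have hc : Continuous fun z : ((V →L[ℂ] V) × (W →L[ℂ] W)) × ℂ => (z.1.1, z.2) := by fun_prop
      filter_upwards [(hc.tendsto ((f, g), μ)).eventually this] with z hz
      rw [h] at hz
      exact Or.inl (nullity_eq_zero_of_one (by simpa using hz))
    · have := eventually_nullity_le g μ 1
      have hc : Continuous fun z : ((V →L[ℂ] V) × (W →L[ℂ] W)) × ℂ => (z.1.2, z.2) := by fun_prop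
      filter_upwards [(hc.tendsto ((f, g), μ)).eventually this] with z hz
      rw [h] at hz
      exact Or.inr (nullity_eq_zero_of_one (by simpa using hz))
  have h2 : ∀ᶠ q : (V →L[ℂ] V) × (W →L[ℂ] W) in 𝓝 (f, g), ‖q.1‖ < ‖f‖ + 1 := by
    have hc : Continuous fun q : (V →L[ℂ] V) × (W →L[ℂ] W) => ‖q.1‖ := by fun_prop
    exact hc.continuousAt.eventually (gt_mem_nhds (lt_add_one _))
  filter_upwards [h1, h2] with q hq1 hq2 μ
  by_cases hμ : nullity (q.1 : V →ₗ[ℂ] V) μ = 0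
  · exact Or.inl hμ
  · refine hq1 μ ?_
    have := norm_le_of_nullity_ne_zero hμ
    simp only [Metric.mem_closedBall, dist_zero_right]
    linarith

omit [FiniteDimensional ℂ V] in
-- Sylvester's argument: φ maps the generalized eigenspace of g at μ into that of f at μ, and one of
-- the two is zero.
theorem eq_zero_of_intertwines {f : V →L[ℂ] V} {g : W →L[ℂ] W} [FiniteDimensional ℂ V]
    (h : ∀ μ, nullity (f : V →ₗ[ℂ] V) μ = 0 ∨ nullity (g : W →ₗ[ℂ] W) μ = 0)
    (φ : W →ₗ[ℂ] V) (hφ : ∀ w, f (φ w) = φ (g w)) : φ = 0 := by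
  have hker : ∀ μ, Module.End.maxGenEigenspace (g : W →ₗ[ℂ] W) μ ≤ LinearMap.ker φ := by
    intro μ w hw
    obtain ⟨k, hk⟩ := (Module.End.mem_maxGenEigenspace _ _ _).1 hw
    have hpow : ∀ (k : ℕ) (w : W), (((f : V →ₗ[ℂ] V) - μ • (1 : End ℂ V)) ^ k) (φ w) =
        φ ((((g : W →ₗ[ℂ] W) - μ • (1 : End ℂ W)) ^ k) w) := by
      intro k
      induction k with
      | zero => intro w; rfl
      | succ k ih =>
        intro w
        rw [pow_succ, pow_succ, Module.End.mul_apply, Module.End.mul_apply, ← ih]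
        congr 1
        simp [hφ]
    have h1 : (((f : V →ₗ[ℂ] V) - μ • (1 : End ℂ V)) ^ k) (φ w) = 0 := by rw [hpow, hk, map_zero]
    rcases h μ with h | h
    · have h2 : LinearMap.ker (((f : V →ₗ[ℂ] V) - algebraMap ℂ (End ℂ V) μ) ^ k) = ⊥ :=
        Submodule.finrank_eq_zero.1 (congrFun h k)
      rw [Algebra.algebraMap_eq_smul_one] at h2
      have h3 : φ w ∈ (⊥ : Submodule ℂ V) := h2 ▸ h1
      exact h3
    · have h2 : LinearMap.ker (((g : W →ₗ[ℂ] W) - algebraMap ℂ (End ℂ W) μ) ^ k) = ⊥ :=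
        Submodule.finrank_eq_zero.1 (congrFun h k)
      rw [Algebra.algebraMap_eq_smul_one] at h2
      have h3 : w ∈ (⊥ : Submodule ℂ W) := h2 ▸ hk
      rw [(Submodule.mem_bot ℂ).1 h3]
      exact zero_mem _
  rw [← LinearMap.ker_eq_top, eq_top_iff, ← Module.End.iSup_maxGenEigenspace_eq_top (g : W →ₗ[ℂ] W)]
  exact iSup_le hker

end Semicontinuity

/-! ### Linear maps commuting with real or quaternionic structures -/

section Equivariant

open Module

variable {κ : ℕ} {V W U : Type*} [NormedAddCommGroup V] [NormedSpace ℂ V]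
  [NormedAddCommGroup W] [NormedSpace ℂ W] [NormedAddCommGroup U] [NormedSpace ℂ U]

/-- A family of antilinear maps squaring to `ε`. It is used for families with at most one member;
`ε = 1` gives a real structure, and `ε = -1` a quaternionic structure. -/
def IsConjStructure (ε : ℝ) (τ : Fin κ → V →L⋆[ℂ] V) : Prop :=
  ∀ t v, τ t (τ t v) = (ε : ℂ) • v

/-- The complex linear maps commuting with given antilinear maps. -/
def equivariantMaps (τ : Fin κ → V →L⋆[ℂ] V) (τ' : Fin κ → W →L⋆[ℂ] W) :
    Submodule ℝ (V →L[ℂ] W) where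
  carrier := {f | ∀ t v, f (τ t v) = τ' t (f v)}
  add_mem' := fun {f g} hf hg t v => by simp [hf t v, hg t v]
  zero_mem' := fun t v => by simp
  smul_mem' := fun r f hf t v => by
    have : ∀ x : W, r • x = (r : ℂ) • x := fun x => (Complex.coe_smul r x).symm
    change r • f (τ t v) = τ' t (r • f v)
    rw [this, this, hf t v, (τ' t).map_smulₛₗ, Complex.conj_ofReal]

theorem mem_equivariantMaps {τ : Fin κ → V →L⋆[ℂ] V} {τ' : Fin κ → W →L⋆[ℂ] W} {f : V →L[ℂ] W} :
    f ∈ equivariantMaps τ τ' ↔ ∀ t v, f (τ t v) = τ' t (f v) := Iff.rfl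

theorem comp_mem_equivariantMaps {τ : Fin κ → V →L⋆[ℂ] V} {τ' : Fin κ → W →L⋆[ℂ] W}
    {τ'' : Fin κ → U →L⋆[ℂ] U} {g : W →L[ℂ] U} {f : V →L[ℂ] W}
    (hg : g ∈ equivariantMaps τ' τ'') (hf : f ∈ equivariantMaps τ τ') :
    g.comp f ∈ equivariantMaps τ τ'' := fun t v => by
  simp [hf t v, hg t (f v)]

/-- Conjugation of a linear map by antilinear maps. -/
noncomputable def conjMap (ε : ℝ) (σ : V →L⋆[ℂ] V) (σ' : W →L⋆[ℂ] W) (f : V →L[ℂ] W) :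
    V →L[ℂ] W :=
  (ε : ℂ) • σ'.comp (f.comp σ)

@[simp] theorem conjMap_apply (ε : ℝ) (σ : V →L⋆[ℂ] V) (σ' : W →L⋆[ℂ] W) (f : V →L[ℂ] W) (v : V) :
    conjMap ε σ σ' f v = (ε : ℂ) • σ' (f (σ v)) := rfl

theorem map_eps_smul (σ : V →L⋆[ℂ] V) (ε : ℝ) (v : V) : σ ((ε : ℂ) • v) = (ε : ℂ) • σ v := by
  rw [σ.map_smulₛₗ, Complex.conj_ofReal]

theorem eps_smul_eps_smul {ε : ℝ} (hε : ε * ε = 1) (v : V) : (ε : ℂ) • (ε : ℂ) • v = v := by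
  rw [smul_smul, ← Complex.ofReal_mul, hε, Complex.ofReal_one, one_smul]

/-- Since ε² = 1, the inverse of σ is εσ, so `conjMap` is f ↦ σ' f σ⁻¹ and its fixed points are the
equivariant maps. -/
theorem conjMap_eq_self_iff {ε : ℝ} (hε : ε * ε = 1) {σ : V →L⋆[ℂ] V} {σ' : W →L⋆[ℂ] W}
    (hσ : ∀ v, σ (σ v) = (ε : ℂ) • v) (f : V →L[ℂ] W) :
    conjMap ε σ σ' f = f ↔ ∀ v, f (σ v) = σ' (f v) := by
  constructor
  · intro h v
    conv_lhs => rw [← h]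
    rw [conjMap_apply, hσ, map_smul, map_eps_smul, eps_smul_eps_smul hε]
  · intro h
    ext v
    rw [conjMap_apply, ← h, hσ, map_smul, eps_smul_eps_smul hε]

/-- Conjugation by an antilinear map squaring to `ε` is a ring homomorphism. -/
noncomputable def conjRingHom (ε : ℝ) (hε : ε * ε = 1) (σ : V →L⋆[ℂ] V)
    (hσ : ∀ v, σ (σ v) = (ε : ℂ) • v) : (V →L[ℂ] V) →+* (V →L[ℂ] V) where
  toFun := conjMap ε σ σ
  map_one' := by
    ext v
    simp only [conjMap_apply, one_apply_eq_self, hσ, eps_smul_eps_smul hε]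
  map_mul' f g := by
    ext v
    change (ε : ℂ) • σ (f (g (σ v))) = (ε : ℂ) • σ (f (σ ((ε : ℂ) • σ (g (σ v)))))
    rw [map_eps_smul, hσ, eps_smul_eps_smul hε]
  map_zero' := by ext v; simp
  map_add' f g := by ext v; simp

@[simp] theorem conjRingHom_apply (ε : ℝ) (hε : ε * ε = 1) (σ : V →L⋆[ℂ] V)
    (hσ : ∀ v, σ (σ v) = (ε : ℂ) • v) (f : V →L[ℂ] V) :
    conjRingHom ε hε σ hσ f = conjMap ε σ σ f := rfl

theorem continuous_conjMap (ε : ℝ) (σ : V →L⋆[ℂ] V) (σ' : W →L⋆[ℂ] W) :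
    Continuous (conjMap ε σ σ') := by
  have h1 : Continuous fun f : V →L[ℂ] W => f.comp σ :=
    ((ContinuousLinearMap.compSL V V W (starRingEnd ℂ) (RingHom.id ℂ)).flip σ).continuous
  have h2 : Continuous fun f : V →L⋆[ℂ] W => σ'.comp f :=
    (ContinuousLinearMap.compSL V W W (starRingEnd ℂ) (starRingEnd ℂ) σ').continuous
  exact (h2.comp h1).const_smul (ε : ℂ)

variable [FiniteDimensional ℂ V] [FiniteDimensional ℂ W]

theorem finrank_real_continuousLinearMap :
    finrank ℝ (V →L[ℂ] W) = 2 * (finrank ℂ V * finrank ℂ W) := by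
  rw [finrank_real_of_complex, ← LinearEquiv.finrank_eq LinearMap.toContinuousLinearMap,
    finrank_linearMap]

/-- For κ = 1 the equivariant maps are the fixed points S of an antilinear involution of the space
of all maps, which therefore is S ⊕ iS. For κ = 0 there is no condition. -/
theorem finrank_equivariantMaps (hκ : κ ≤ 1) {ε : ℝ} (hε : ε * ε = 1)
    {τ : Fin κ → V →L⋆[ℂ] V} {τ' : Fin κ → W →L⋆[ℂ] W} (hτ : IsConjStructure ε τ)
    (hτ' : IsConjStructure ε τ') :
    (1 + κ) * finrank ℝ (equivariantMaps τ τ') = 2 * (finrank ℂ V * finrank ℂ W) := by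
  rw [← finrank_real_continuousLinearMap (V := V) (W := W)]
  obtain rfl | rfl : κ = 0 ∨ κ = 1 := by omega
  · have : equivariantMaps τ τ' = ⊤ := by
      rw [eq_top_iff]
      exact fun f _ t => Fin.elim0 t
    rw [this, finrank_top, add_zero, one_mul]
  · set S := equivariantMaps τ τ' with hS
    have hmem : ∀ f, f ∈ S ↔ conjMap ε (τ 0) (τ' 0) f = f := by
      intro f
      rw [conjMap_eq_self_iff hε (hτ 0), hS, mem_equivariantMaps]
      exact ⟨fun h => h 0, fun h t => by rw [Subsingleton.elim t 0]; exact h⟩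
    let T : (S × S) →ₗ[ℝ] (V →L[ℂ] W) :=
      { toFun := fun q => (q.1 : V →L[ℂ] W) + Complex.I • (q.2 : V →L[ℂ] W)
        map_add' := fun p q => by simp only [Prod.fst_add, Prod.snd_add, Submodule.coe_add]; module
        map_smul' := fun r q => by
          simp only [Prod.smul_fst, Prod.smul_snd, Submodule.coe_smul, RingHom.id_apply, smul_add]
          rw [smul_comm] }
    have hT : Function.Bijective T := by
      have hc : ∀ q, conjMap ε (τ 0) (τ' 0) (T q) =
          (q.1 : V →L[ℂ] W) - Complex.I • (q.2 : V →L[ℂ] W) := by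
        intro q
        have h1 := (hmem _).1 q.1.2
        have h2 := (hmem _).1 q.2.2
        conv_rhs => rw [← h1, ← h2]
        ext v
        simp only [T, LinearMap.coe_mk, AddHom.coe_mk, conjMap_apply, add_apply, smul_apply,
          map_add,
          ContinuousLinearMap.map_smulₛₗ, Complex.conj_I, sub_apply]
        module
      constructor
      · rw [injective_iff_map_eq_zero]
        intro q hq
        have hq' : T q = 0 := hq
        have h1 := hc q
        have h3 : (q.1 : V →L[ℂ] W) + Complex.I • (q.2 : V →L[ℂ] W) = 0 := hq'
        have h2 : (q.1 : V →L[ℂ] W) - Complex.I • (q.2 : V →L[ℂ] W) = 0 := by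
          rw [← h1, hq']; ext v; simp
        have h4 : (q.1 : V →L[ℂ] W) = 0 := by
          have : (2 : ℂ) • (q.1 : V →L[ℂ] W) = 0 := by
            calc (2 : ℂ) • (q.1 : V →L[ℂ] W) = ((q.1 : V →L[ℂ] W) - Complex.I • (q.2 : V →L[ℂ] W)) +
                  ((q.1 : V →L[ℂ] W) + Complex.I • (q.2 : V →L[ℂ] W)) := by module
              _ = 0 := by rw [h2, h3, add_zero]
          simpa using this
        have h5 : (q.2 : V →L[ℂ] W) = 0 := by
          rw [h4, zero_add] at h3
          simpa using h3
        exact Prod.ext (Subtype.ext h4) (Subtype.ext h5)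
      · intro f
        set g := conjMap ε (τ 0) (τ' 0) f with hg
        have hgg : conjMap ε (τ 0) (τ' 0) g = f := by
          ext v
          simp only [hg, conjMap_apply, map_eps_smul, hτ 0, hτ' 0, map_smul, eps_smul_eps_smul hε]
        have ha : (1 / 2 : ℂ) • (f + g) ∈ S := by
          rw [hmem]
          conv_rhs => rw [← hgg, hg]
          ext v
          simp [hg, map_ofNat]
          module
        have hb : (-Complex.I / 2 : ℂ) • (f - g) ∈ S := by
          rw [hmem]
          conv_rhs => rw [← hgg, hg]
          ext v
          simp [hg, map_ofNat]
          module
        refine ⟨(⟨_, ha⟩, ⟨_, hb⟩), ?_⟩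
        simp only [T, LinearMap.coe_mk, AddHom.coe_mk, smul_smul]
        rw [show Complex.I * (-Complex.I / 2) = 1 / 2 by
          rw [mul_div_assoc', mul_neg, Complex.I_mul_I, neg_neg]]
        module
    rw [← (LinearEquiv.ofBijective T hT).finrank_eq, finrank_prod]
    ring

/-- Averaging a projection onto K with its conjugate under τ gives a projection onto K commuting
with τ; its kernel is the complement. -/
theorem exists_isCompl_invariant (hκ : κ ≤ 1) {ε : ℝ} (hε : ε * ε = 1) {τ : Fin κ → V →L⋆[ℂ] V}
    (hτ : IsConjStructure ε τ) (K : Submodule ℂ V) (hK : ∀ t, ∀ v ∈ K, τ t v ∈ K) :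
    ∃ L : Submodule ℂ V, IsCompl K L ∧ ∀ t, ∀ v ∈ L, τ t v ∈ L := by
  obtain ⟨L₀, hL₀⟩ := K.exists_isCompl
  obtain rfl | rfl : κ = 0 ∨ κ = 1 := by omega
  · exact ⟨L₀, hL₀, fun t => Fin.elim0 t⟩
  · let π : V →L[ℂ] V := (K.subtype ∘ₗ K.projectionOnto L₀ hL₀).toContinuousLinearMap
    have hπK : ∀ v, π v ∈ K := fun v => (K.projectionOnto L₀ hL₀ v).2
    have hπ : ∀ v ∈ K, π v = v := fun v hv =>
      congrArg Subtype.val (Submodule.projectionOnto_apply_left hL₀ ⟨v, hv⟩)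
    let ρ : V →L[ℂ] V := (1 / 2 : ℂ) • (π + conjMap ε (τ 0) (τ 0) π)
    have hρv : ∀ v, ρ v = (1 / 2 : ℂ) • (π v + (ε : ℂ) • τ 0 (π (τ 0 v))) := fun v => rfl
    have hρK : ∀ v, ρ v ∈ K := fun v =>
      K.smul_mem _ (K.add_mem (hπK v) (K.smul_mem _ (hK 0 _ (hπK _))))
    have hρ : ∀ v ∈ K, ρ v = v := by
      intro v hv
      rw [hρv, hπ v hv, hπ _ (hK 0 v hv), hτ 0, eps_smul_eps_smul hε]
      module
    have hρτ : ∀ v, ρ (τ 0 v) = τ 0 (ρ v) := by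
      intro v
      simp only [hρv, hτ 0, ContinuousLinearMap.map_smulₛₗ, map_add, Complex.conj_ofReal,
        RingHom.id_apply, map_div₀, map_one, map_ofNat, eps_smul_eps_smul hε]
      rw [add_comm]
    refine ⟨LinearMap.ker (ρ : V →ₗ[ℂ] V), ?_, ?_⟩
    · have := LinearMap.isCompl_of_proj
        (f := (ρ : V →ₗ[ℂ] V).codRestrict K hρK) (fun v => Subtype.ext (hρ v v.2))
      rwa [LinearMap.ker_codRestrict] at this
    · intro t v hv
      rw [Subsingleton.elim t 0]
      have hv' : ρ v = 0 := hv
      change ρ (τ 0 v) = 0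
      rw [hρτ, hv', map_zero]

/-- The restriction of an antilinear map to an invariant subspace. -/
noncomputable def restrictConj (σ : V →L⋆[ℂ] V) (K : Submodule ℂ V) (hK : ∀ v ∈ K, σ v ∈ K) :
    K →L⋆[ℂ] K :=
  (σ.comp K.subtypeL).codRestrict K fun v => hK v v.2

/-- A decomposition of `V` as a direct sum. -/
structure Splitting (V W U : Type*) [NormedAddCommGroup V] [NormedSpace ℂ V]
    [NormedAddCommGroup W] [NormedSpace ℂ W] [NormedAddCommGroup U] [NormedSpace ℂ U] where
  i₁ : W →L[ℂ] V
  p₁ : V →L[ℂ] W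
  i₂ : U →L[ℂ] V
  p₂ : V →L[ℂ] U
  p₁_i₁ : ∀ x, p₁ (i₁ x) = x
  p₂_i₁ : ∀ x, p₂ (i₁ x) = 0
  p₁_i₂ : ∀ x, p₁ (i₂ x) = 0
  p₂_i₂ : ∀ x, p₂ (i₂ x) = x
  sum_eq : ∀ v, i₁ (p₁ v) + i₂ (p₂ v) = v

/-- The splitting given by complementary subspaces. -/
noncomputable def Splitting.ofIsCompl {K L : Submodule ℂ V} (h : IsCompl K L) :
    Splitting V K L where
  i₁ := K.subtypeL
  p₁ := (K.projectionOnto L h).toContinuousLinearMap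
  i₂ := L.subtypeL
  p₂ := (L.projectionOnto K h.symm).toContinuousLinearMap
  p₁_i₁ x := Submodule.projectionOnto_apply_left h x
  p₂_i₁ x := Submodule.projectionOnto_apply_right h.symm x
  p₁_i₂ x := Submodule.projectionOnto_apply_right h x
  p₂_i₂ x := Submodule.projectionOnto_apply_left h.symm x
  sum_eq v := Submodule.projection_add_projection_eq_self h v

namespace Splitting

/-- The splitting is compatible with antilinear maps. -/
structure IsEquivariant (s : Splitting V W U) (τ : Fin κ → V →L⋆[ℂ] V)
    (τ₁ : Fin κ → W →L⋆[ℂ] W) (τ₂ : Fin κ → U →L⋆[ℂ] U) : Prop where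
  i₁ : s.i₁ ∈ equivariantMaps τ₁ τ
  p₁ : s.p₁ ∈ equivariantMaps τ τ₁
  i₂ : s.i₂ ∈ equivariantMaps τ₂ τ
  p₂ : s.p₂ ∈ equivariantMaps τ τ₂

omit [FiniteDimensional ℂ V] [FiniteDimensional ℂ W] in
theorem isEquivariant_of_inclusions (s : Splitting V W U) {τ : Fin κ → V →L⋆[ℂ] V}
    {τ₁ : Fin κ → W →L⋆[ℂ] W} {τ₂ : Fin κ → U →L⋆[ℂ] U} (h₁ : s.i₁ ∈ equivariantMaps τ₁ τ)
    (h₂ : s.i₂ ∈ equivariantMaps τ₂ τ) : s.IsEquivariant τ τ₁ τ₂ := by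
  have key : ∀ t v, τ t v = s.i₁ (τ₁ t (s.p₁ v)) + s.i₂ (τ₂ t (s.p₂ v)) := fun t v => by
    rw [h₁ t, h₂ t, ← map_add, s.sum_eq]
  refine ⟨h₁, fun t v => ?_, h₂, fun t v => ?_⟩
  · rw [key, map_add, s.p₁_i₁, s.p₁_i₂, add_zero]
  · rw [key, map_add, s.p₂_i₁, s.p₂_i₂, zero_add]

theorem ofIsCompl_isEquivariant {ε : ℝ} {τ : Fin κ → V →L⋆[ℂ] V}
    (hτ : IsConjStructure ε τ) {K L : Submodule ℂ V} (h : IsCompl K L)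
    (hK : ∀ t, ∀ v ∈ K, τ t v ∈ K) (hL : ∀ t, ∀ v ∈ L, τ t v ∈ L) :
    ∃ (τ₁ : Fin κ → K →L⋆[ℂ] K) (τ₂ : Fin κ → L →L⋆[ℂ] L), IsConjStructure ε τ₁ ∧
      IsConjStructure ε τ₂ ∧ (ofIsCompl h).IsEquivariant τ τ₁ τ₂ :=
  ⟨fun t => restrictConj (τ t) K (hK t), fun t => restrictConj (τ t) L (hL t),
    fun t v => Subtype.ext (hτ t v), fun t v => Subtype.ext (hτ t v),
    isEquivariant_of_inclusions _ (fun _ _ => rfl) (fun _ _ => rfl)⟩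

variable [FiniteDimensional ℂ U]

/-- The linear equivalence with the product. -/
def equivProd (s : Splitting V W U) : V ≃ₗ[ℂ] W × U where
  toFun v := (s.p₁ v, s.p₂ v)
  map_add' v w := by simp
  map_smul' c v := by simp
  invFun q := s.i₁ q.1 + s.i₂ q.2
  left_inv v := s.sum_eq v
  right_inv q := by simp [s.p₁_i₁, s.p₂_i₁, s.p₁_i₂, s.p₂_i₂]

omit [FiniteDimensional ℂ V] in
theorem finrank_eq (s : Splitting V W U) : finrank ℂ V = finrank ℂ W + finrank ℂ U := by
  rw [s.equivProd.finrank_eq, finrank_prod]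

/-- The block diagonal endomorphism. -/
def diag (s : Splitting V W U) (f : W →L[ℂ] W) (g : U →L[ℂ] U) : V →L[ℂ] V :=
  s.i₁.comp (f.comp s.p₁) + s.i₂.comp (g.comp s.p₂)

omit [FiniteDimensional ℂ V] in
theorem nullity_diag (s : Splitting V W U) (f : W →L[ℂ] W) (g : U →L[ℂ] U) :
    nullity (s.diag f g : V →ₗ[ℂ] V) =
      nullity (f : W →ₗ[ℂ] W) + nullity (g : U →ₗ[ℂ] U) := by
  rw [← nullity_prodMap]
  refine nullity_eq_of_equiv _ _ s.equivProd fun v => ?_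
  simp [diag, equivProd, s.p₁_i₁, s.p₂_i₁, s.p₁_i₂, s.p₂_i₂]

end Splitting

end Equivariant

/-! ### Nilpotent endomorphisms with prescribed nullities -/

section NilpotentStratum

open Module

universe u

/-- Here W is a model of V / ker f and g is the map induced by f, so ker f^(j+1) is the preimage of
ker g^j. Passing from f to g thus drops the first increment of the nullity sequence. -/
theorem nullity_succ_add_finrank {V W : Type*} [AddCommGroup V] [Module ℂ V] [AddCommGroup W]
    [Module ℂ W] [FiniteDimensional ℂ V] [FiniteDimensional ℂ W] (f : End ℂ V) (g : End ℂ W)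
    (π : V →ₗ[ℂ] W) (hπ : Function.Surjective π) (hker : ∀ v, π v = 0 ↔ f v = 0)
    (h : ∀ v, π (f v) = g (π v)) (j : ℕ) :
    nullity f 0 (j + 1) + finrank ℂ W = finrank ℂ V + nullity g 0 j := by
  have hpow : ∀ j v, π ((f ^ j) v) = (g ^ j) (π v) := by
    intro j
    induction j with
    | zero => intro v; rfl
    | succ j ih =>
      intro v
      rw [pow_succ', pow_succ', Module.End.mul_apply, Module.End.mul_apply, h, ih]
  have h1 : LinearMap.ker (f ^ (j + 1)) = LinearMap.ker ((g ^ j) ∘ₗ π) := by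
    ext v
    rw [LinearMap.mem_ker, LinearMap.mem_ker, LinearMap.comp_apply, ← hpow, hker, pow_succ',
      Module.End.mul_apply]
  have h2 := LinearMap.finrank_range_add_finrank_ker ((g ^ j) ∘ₗ π)
  have h3 := LinearMap.finrank_range_add_finrank_ker (g ^ j)
  rw [LinearMap.range_comp_of_range_eq_top _ (LinearMap.range_eq_top.2 hπ)] at h2
  rw [nullity, nullity, map_zero, sub_zero, map_zero, sub_zero, h1]
  omega

/-- The equivariant endomorphisms whose first powers have the same nullities as those of `X`. -/
def nullityStratum {κ : ℕ} {V : Type*} [NormedAddCommGroup V] [NormedSpace ℂ V]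
    (τ : Fin κ → V →L⋆[ℂ] V) (J : ℕ) (X : V →L[ℂ] V) : Set (V →L[ℂ] V) :=
  {Y | Y ∈ equivariantMaps τ τ ∧
    ∀ j ≤ J, nullity (Y : V →ₗ[ℂ] V) 0 j = nullity (X : V →ₗ[ℂ] V) 0 j}

section Factorization

variable {V K W : Type*} [NormedAddCommGroup V] [NormedSpace ℂ V]
  [NormedAddCommGroup K] [NormedSpace ℂ K] [NormedAddCommGroup W] [NormedSpace ℂ W]

/-- The projection onto `W` along the kernel of `X`, if `P ∘ X` is invertible on `W` and `X` has
the rank of `W`. -/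
noncomputable def kernelProj (s : Splitting V K W) (P : V →L[ℂ] W) (X : V →L[ℂ] V) : V →L[ℂ] W :=
  (Ring.inverse (P.comp (X.comp s.i₂))).comp (P.comp X)

/-- Coordinates on the endomorphisms of constant rank. -/
noncomputable def rankCoord (s : Splitting V K W) (P : V →L[ℂ] W) (X : V →L[ℂ] V) :
    (K →L[ℂ] W) × (W →L[ℂ] K) × (W →L[ℂ] W) :=
  ((kernelProj s P X).comp s.i₁, s.p₁.comp (X.comp s.i₂),
    (kernelProj s P X).comp (X.comp s.i₂))

/-- The injective factor of an endomorphism with given coordinates. -/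
def rankInjFactor (s : Splitting V K W) (y : (K →L[ℂ] W) × (W →L[ℂ] K) × (W →L[ℂ] W)) :
    W →L[ℂ] V :=
  s.i₁.comp y.2.1 + s.i₂.comp (y.2.2 - y.1.comp y.2.1)

/-- The surjective factor of an endomorphism with given coordinates. -/
def rankSurjFactor (s : Splitting V K W) (y : (K →L[ℂ] W) × (W →L[ℂ] K) × (W →L[ℂ] W)) :
    V →L[ℂ] W :=
  s.p₂ + y.1.comp s.p₁

/-- The endomorphism with given coordinates. -/
def rankParam (s : Splitting V K W) (y : (K →L[ℂ] W) × (W →L[ℂ] K) × (W →L[ℂ] W)) :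
    V →L[ℂ] V :=
  (rankInjFactor s y).comp (rankSurjFactor s y)

variable (s : Splitting V K W) {P : V →L[ℂ] W}

theorem rankSurjFactor_i₂ (y : (K →L[ℂ] W) × (W →L[ℂ] K) × (W →L[ℂ] W)) (w : W) :
    rankSurjFactor s y (s.i₂ w) = w := by
  simp [rankSurjFactor, s.p₂_i₂, s.p₁_i₂]

theorem rankSurjFactor_i₁ (y : (K →L[ℂ] W) × (W →L[ℂ] K) × (W →L[ℂ] W)) (x : K) :
    rankSurjFactor s y (s.i₁ x) = y.1 x := by
  simp [rankSurjFactor, s.p₂_i₁, s.p₁_i₁]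

theorem p₁_rankInjFactor (y : (K →L[ℂ] W) × (W →L[ℂ] K) × (W →L[ℂ] W)) (w : W) :
    s.p₁ (rankInjFactor s y w) = y.2.1 w := by
  simp [rankInjFactor, s.p₁_i₁, s.p₁_i₂]

/-- The correction term in `rankInjFactor` is there to make this composite, the endomorphism induced
on W ≅ V / ker, exactly the third coordinate. -/
theorem rankSurjFactor_rankInjFactor (y : (K →L[ℂ] W) × (W →L[ℂ] K) × (W →L[ℂ] W)) (w : W) :
    rankSurjFactor s y (rankInjFactor s y w) = y.2.2 w := by
  simp [rankInjFactor, rankSurjFactor, s.p₁_i₁, s.p₁_i₂, s.p₂_i₁, s.p₂_i₂]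

theorem kernelProj_i₂ {X : V →L[ℂ] V} (hX : IsUnit (P.comp (X.comp s.i₂))) (w : W) :
    kernelProj s P X (s.i₂ w) = w :=
  DFunLike.congr_fun (Ring.inverse_mul_cancel _ hX) w

theorem kernelProj_rankParam {y : (K →L[ℂ] W) × (W →L[ℂ] K) × (W →L[ℂ] W)}
    (hy : IsUnit (P.comp (rankInjFactor s y))) :
    kernelProj s P (rankParam s y) = rankSurjFactor s y := by
  have h1 : P.comp ((rankParam s y).comp s.i₂) = P.comp (rankInjFactor s y) := by
    ext w
    simp [rankParam, rankSurjFactor_i₂]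
  ext v
  rw [kernelProj, h1]
  exact DFunLike.congr_fun (Ring.inverse_mul_cancel _ hy) (rankSurjFactor s y v)

theorem rankCoord_rankParam {y : (K →L[ℂ] W) × (W →L[ℂ] K) × (W →L[ℂ] W)}
    (hy : IsUnit (P.comp (rankInjFactor s y))) : rankCoord s P (rankParam s y) = y := by
  rw [rankCoord, kernelProj_rankParam s hy]
  refine Prod.ext ?_ (Prod.ext ?_ ?_) <;> ext w
  · simp [rankSurjFactor_i₁]
  · simp [rankParam, rankSurjFactor_i₂, p₁_rankInjFactor]
  · simp [rankParam, rankSurjFactor_i₂, rankSurjFactor_rankInjFactor]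

/-- The vector v - i₂ (kernelProj v) is killed by `kernelProj`, hence by X. So X factors as (X ∘ i₂)
∘ kernelProj. -/
theorem rankParam_rankCoord {X : V →L[ℂ] V} (hX : IsUnit (P.comp (X.comp s.i₂)))
    (hker : ∀ v, kernelProj s P X v = 0 → X v = 0) : rankParam s (rankCoord s P X) = X := by
  have h1 : rankSurjFactor s (rankCoord s P X) = kernelProj s P X := by
    ext v
    conv_rhs => rw [← s.sum_eq v, map_add, kernelProj_i₂ s hX]
    simp [rankSurjFactor, rankCoord, add_comm]
  have h2 : rankInjFactor s (rankCoord s P X) = X.comp s.i₂ := by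
    ext w
    have h3 : kernelProj s P X (X (s.i₂ w)) =
        kernelProj s P X (s.i₁ (s.p₁ (X (s.i₂ w)))) + s.p₂ (X (s.i₂ w)) := by
      conv_lhs => rw [← s.sum_eq (X (s.i₂ w)), map_add, kernelProj_i₂ s hX]
    simp [rankInjFactor, rankCoord, h3, s.sum_eq]
  ext v
  rw [rankParam, h1, h2]
  have h4 : X (v - s.i₂ (kernelProj s P X v)) = 0 :=
    hker _ (by rw [map_sub, kernelProj_i₂ s hX, sub_self])
  rw [map_sub, sub_eq_zero] at h4
  exact h4.symm

theorem contDiffAt_rankCoord [FiniteDimensional ℂ W] {X : V →L[ℂ] V}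
    (hX : IsUnit (P.comp (X.comp s.i₂))) : ContDiffAt ℝ ω (rankCoord s P) X := by
  have : CompleteSpace W := FiniteDimensional.complete ℂ W
  obtain ⟨u, hu⟩ := hX
  have h0 : ContDiffAt ℂ ω (fun Y : V →L[ℂ] V => P.comp (Y.comp s.i₂)) X := by fun_prop
  have h1 : ContDiffAt ℂ ω (fun Y : V →L[ℂ] V => Ring.inverse (P.comp (Y.comp s.i₂))) X := by
    refine ContDiffAt.comp X (g := Ring.inverse) ?_ h0
    rw [← hu]
    exact contDiffAt_ringInverse ℂ u
  have h2 : ContDiffAt ℂ ω (fun Y : V →L[ℂ] V => kernelProj s P Y) X :=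
    h1.clm_comp (contDiffAt_const.clm_comp contDiffAt_id)
  have h3 : ContDiffAt ℂ ω (rankCoord s P) X :=
    (h2.clm_comp contDiffAt_const).prodMk
      ((contDiffAt_const.clm_comp (contDiffAt_id.clm_comp contDiffAt_const)).prodMk
        (h2.clm_comp (contDiffAt_id.clm_comp contDiffAt_const)))
  exact h3.restrict_scalars ℝ

theorem contDiff_rankInjFactor : ContDiff ℂ ω (rankInjFactor s) := by
  unfold rankInjFactor
  fun_prop

theorem contDiff_rankParam : ContDiff ℝ ω (rankParam s) := by
  have h : ContDiff ℂ ω (rankParam s) := by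
    refine (contDiff_rankInjFactor s).clm_comp ?_
    unfold rankSurjFactor
    fun_prop
  exact h.restrict_scalars ℝ

end Factorization

/-- With K = ker X, an endomorphism near X of the same rank amounts to three free data: a map K → W
whose negative has the kernel as its graph, a map W → K, and the induced endomorphism of W. The
nullity conditions constrain only the last one, and there they are the same conditions with one step
fewer. -/
theorem isSubmanifoldAt_nullityStratum_of_splitting {κ : ℕ} {V K W : Type*}
    [NormedAddCommGroup V] [NormedSpace ℂ V] [FiniteDimensional ℂ V]
    [NormedAddCommGroup K] [NormedSpace ℂ K] [FiniteDimensional ℂ K]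
    [NormedAddCommGroup W] [NormedSpace ℂ W] [FiniteDimensional ℂ W]
    {τ : Fin κ → V →L⋆[ℂ] V} {τ₁ : Fin κ → K →L⋆[ℂ] K} {τ₂ : Fin κ → W →L⋆[ℂ] W}
    (s : Splitting V K W) (hs : s.IsEquivariant τ τ₁ τ₂) {X : V →L[ℂ] V}
    (hX : X ∈ equivariantMaps τ τ) {P : V →L[ℂ] W} (hP : P.comp (X.comp s.i₂) = 1)
    (hXi : ∀ x, X (s.i₁ x) = 0) {D : W →L[ℂ] W} (hD : D = s.p₂.comp (X.comp s.i₂)) {J d : ℕ}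
    (hnX : ∀ j, nullity (X : V →ₗ[ℂ] V) 0 (j + 1) + finrank ℂ W =
      finrank ℂ V + nullity (D : W →ₗ[ℂ] W) 0 j)
    (hd : IsSubmanifoldAt (nullityStratum τ₂ J D) D d) :
    IsSubmanifoldAt (nullityStratum τ (J + 1) X) X (finrank ℝ (equivariantMaps τ₁ τ₂) +
      (finrank ℝ (equivariantMaps τ₂ τ₁) + d)) := by
  have hPX : IsUnit (P.comp (X.comp s.i₂)) := by rw [hP]; exact isUnit_one
  have hϖ : kernelProj s P X = s.p₂ := by
    ext v : 1
    conv_lhs => rw [← s.sum_eq v, map_add, kernelProj_i₂ s hPX]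
    simp [kernelProj, hXi]
  have hr : rankCoord s P X = (0, s.p₁.comp (X.comp s.i₂), D) := by
    rw [rankCoord, hϖ, hD]
    refine Prod.ext ?_ rfl
    ext x : 1
    exact s.p₂_i₁ x
  have hN : IsSubmanifoldAt (((equivariantMaps τ₁ τ₂ : Submodule ℝ _) : Set (K →L[ℂ] W)) ×ˢ
      (((equivariantMaps τ₂ τ₁ : Submodule ℝ _) : Set (W →L[ℂ] K)) ×ˢ nullityStratum τ₂ J D))
      (rankCoord s P X) (finrank ℝ (equivariantMaps τ₁ τ₂) +
        (finrank ℝ (equivariantMaps τ₂ τ₁) + d)) := by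
    rw [hr]
    exact (Submodule.isSubmanifoldAt _ (zero_mem _)).prod ((Submodule.isSubmanifoldAt _
      (comp_mem_equivariantMaps hs.p₁ (comp_mem_equivariantMaps hX hs.i₂))).prod hd)
  refine IsSubmanifoldAt.transfer (rankCoord s P) (rankParam s) hN ⟨hX, fun _ _ => rfl⟩
    (contDiffAt_rankCoord s hPX) (contDiff_rankParam s).contDiffAt ?_ ?_
  · have hc : Continuous fun y => P.comp (rankInjFactor s y) :=
      continuous_const.clm_comp (contDiff_rankInjFactor s).continuous
    have h1 : P.comp (rankInjFactor s (rankCoord s P X)) = 1 := by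
      rw [← hP, hr]
      congr 1
      ext w
      simp [rankInjFactor, hD, s.sum_eq]
    have h2 : ∀ᶠ y in 𝓝 (rankCoord s P X), IsUnit (P.comp (rankInjFactor s y)) := by
      have h3 := hc.tendsto (rankCoord s P X)
      rw [h1] at h3
      exact h3.eventually eventually_isUnit_nhds_one
    filter_upwards [h2] with y hy hyN
    obtain ⟨hχ, hB, hDy, hDn⟩ := hyN
    refine ⟨⟨?_, ?_⟩, rankCoord_rankParam s hy⟩
    · refine comp_mem_equivariantMaps (add_mem (comp_mem_equivariantMaps hs.i₁ hB)
        (comp_mem_equivariantMaps hs.i₂ (sub_mem hDy (comp_mem_equivariantMaps hχ hB)))) ?_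
      exact add_mem hs.p₂ (comp_mem_equivariantMaps hχ hs.p₁)
    · have hYinj : ∀ w, rankInjFactor s y w = 0 → w = 0 := by
        intro w hw
        have := DFunLike.congr_fun (Ring.inverse_mul_cancel _ hy) w
        rw [← show (1 : W →L[ℂ] W) w = w from rfl, ← this]
        simp [hw]
      have hny := nullity_succ_add_finrank (rankParam s y : V →ₗ[ℂ] V) (y.2.2 : W →ₗ[ℂ] W)
        (rankSurjFactor s y : V →ₗ[ℂ] W) (fun w => ⟨_, rankSurjFactor_i₂ s y w⟩)
        (fun v => ⟨fun h => (show rankInjFactor s y (rankSurjFactor s y v) = 0 from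
          (congrArg (rankInjFactor s y) h).trans (map_zero _)),
          fun h => hYinj _ h⟩)
        (fun v => rankSurjFactor_rankInjFactor s y _)
      intro j hj
      rcases j with _ | j
      · simp
      · have h3 := hny j
        have h4 := hnX j
        have h5 := hDn j (by omega)
        omega
  · have hc : Continuous fun Y : V →L[ℂ] V => P.comp (Y.comp s.i₂) := by fun_prop
    have h2 : ∀ᶠ Y in 𝓝 X, IsUnit (P.comp (Y.comp s.i₂)) := by
      have h3 := hc.tendsto X
      simp only [hP] at h3
      exact h3.eventually eventually_isUnit_nhds_one
    filter_upwards [h2] with Y hY hYM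
    obtain ⟨hYS, hYn⟩ := hYM
    set ϖ := kernelProj s P Y with hϖY
    have hϖi : ∀ w, ϖ (s.i₂ w) = w := kernelProj_i₂ s hY
    have hϖsurj : Function.Surjective ϖ := fun w => ⟨_, hϖi w⟩
    have hle : LinearMap.ker (Y : V →ₗ[ℂ] V) ≤ LinearMap.ker (ϖ : V →ₗ[ℂ] W) := by
      intro v hv
      have hv' : Y v = 0 := hv
      change ϖ v = 0
      simp [hϖY, kernelProj, hv']
    -- Equality of the first nullities of X and Y is used here: it makes the two kernels equal in
    -- dimension.
    have heq : LinearMap.ker (Y : V →ₗ[ℂ] V) = LinearMap.ker (ϖ : V →ₗ[ℂ] W) := by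
      refine Submodule.eq_of_le_of_finrank_eq hle ?_
      have h3 := LinearMap.finrank_range_add_finrank_ker (ϖ : V →ₗ[ℂ] W)
      rw [LinearMap.range_eq_top.2 hϖsurj, finrank_top] at h3
      have h4 := hnX 0
      have h5 := hYn 1 (by omega)
      have h6 : nullity (Y : V →ₗ[ℂ] V) 0 1 = finrank ℂ (LinearMap.ker (Y : V →ₗ[ℂ] V)) := by
        rw [nullity, map_zero, sub_zero, pow_one]
      rw [nullity_zero_right] at h4
      simp only [zero_add] at h4
      omega
    have hker : ∀ v, ϖ v = 0 ↔ Y v = 0 := fun v => (SetLike.ext_iff.1 heq v).symm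
    have hYϖ : ∀ v, Y v = Y (s.i₂ (ϖ v)) := by
      intro v
      have h4 : Y (v - s.i₂ (ϖ v)) = 0 :=
        (hker _).1 (by rw [map_sub, hϖi, sub_self])
      rwa [map_sub, sub_eq_zero] at h4
    have hϖS : ϖ ∈ equivariantMaps τ τ₂ := by
      intro t v
      -- The kernel of ϖ is that of Y, so it is preserved by τ.
      have h3 : ϖ (τ t (v - s.i₂ (ϖ v))) = 0 := by
        rw [hker, hYS t, map_sub, ← hYϖ, sub_self, map_zero]
      rw [map_sub, map_sub, sub_eq_zero, ← hs.i₂ t, hϖi] at h3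
      exact h3
    have hnY := nullity_succ_add_finrank (Y : V →ₗ[ℂ] V)
      (ϖ.comp (Y.comp s.i₂) : W →ₗ[ℂ] W) (ϖ : V →ₗ[ℂ] W) hϖsurj hker
      (fun v => congrArg ϖ (hYϖ v))
    refine ⟨⟨comp_mem_equivariantMaps hϖS hs.i₁,
      comp_mem_equivariantMaps hs.p₁ (comp_mem_equivariantMaps hYS hs.i₂),
      comp_mem_equivariantMaps hϖS (comp_mem_equivariantMaps hYS hs.i₂), ?_⟩,
      rankParam_rankCoord s hY fun v hv => (hker v).1 hv⟩
    intro j hj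
    have h3 := hnY j
    have h4 := hnX j
    have h5 := hYn (j + 1) (by omega)
    change nullity ((ϖ.comp (Y.comp s.i₂) : W →L[ℂ] W) : W →ₗ[ℂ] W) 0 j = _
    omega

/-- Induction on `J`, replacing V by a τ-invariant complement W of ker X, which models V / ker X.
Each step leaves the maps between ker X and W free and loses the endomorphisms of ker X, which
accounts for one square in the sum. -/
theorem exists_isSubmanifoldAt_nullityStratum {κ : ℕ} (hκ : κ ≤ 1) {ε : ℝ} (hε : ε * ε = 1)
    (J : ℕ) : ∀ {V : Type u} [NormedAddCommGroup V] [NormedSpace ℂ V] [FiniteDimensional ℂ V]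
    {τ : Fin κ → V →L⋆[ℂ] V} (_ : IsConjStructure ε τ) {X : V →L[ℂ] V}
    (_ : X ∈ equivariantMaps τ τ) (_ : (X : V →ₗ[ℂ] V) ^ J = 0),
    ∃ d, IsSubmanifoldAt (nullityStratum τ J X) X d ∧
      (1 + κ) * d + 2 * ∑ j ∈ Finset.range J,
        (nullity (X : V →ₗ[ℂ] V) 0 (j + 1) - nullity (X : V →ₗ[ℂ] V) 0 j) ^ 2 =
      2 * (finrank ℂ V * finrank ℂ V) := by
  induction J with
  | zero =>
    intro V _ _ _ τ hτ X hX _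
    refine ⟨finrank ℝ (equivariantMaps τ τ), ?_, by rw [Finset.sum_range_zero, mul_zero, add_zero,
      finrank_equivariantMaps hκ hε hτ hτ]⟩
    have : nullityStratum τ 0 X = (equivariantMaps τ τ : Set (V →L[ℂ] V)) := by
      ext Y
      simp [nullityStratum]
    rw [this]
    exact Submodule.isSubmanifoldAt _ hX
  | succ J ih =>
    intro V _ _ _ τ hτ X hX hXJ
    set K := LinearMap.ker (X : V →ₗ[ℂ] V) with hK
    have hmemK : ∀ v, v ∈ K ↔ X v = 0 := fun v => Iff.rfl
    obtain ⟨W, hKW, hWτ⟩ := exists_isCompl_invariant hκ hε hτ K (fun t v hv => by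
      rw [hmemK] at hv ⊢
      rw [hX t, hv, map_zero])
    obtain ⟨τ₁, τ₂, hτ₁, hτ₂, hs⟩ := Splitting.ofIsCompl_isEquivariant hτ hKW (fun t v hv => by
      rw [hmemK] at hv ⊢
      rw [hX t, hv, map_zero]) hWτ
    set s := Splitting.ofIsCompl hKW with hs_def
    have hXi : ∀ x, X (s.i₁ x) = 0 := fun x => x.2
    have hXp : ∀ v, s.p₂ v = 0 ↔ X v = 0 := by
      intro v
      constructor
      · intro hv
        rw [← s.sum_eq v, hv, map_zero, add_zero, hXi]
      · intro hv
        exact (Submodule.projectionOnto_apply_eq_zero_iff hKW.symm).2 hv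
    have hinj : Function.Injective ((X : V →ₗ[ℂ] V) ∘ₗ (s.i₂ : W →ₗ[ℂ] V)) := by
      rw [injective_iff_map_eq_zero]
      intro w hw
      have := (hXp _).2 hw
      exact (s.p₂_i₂ w).symm.trans this
    obtain ⟨P', hP'⟩ := LinearMap.exists_leftInverse_of_injective _ (LinearMap.ker_eq_bot.2 hinj)
    obtain ⟨P, hP⟩ : ∃ P : V →L[ℂ] W, P.comp (X.comp s.i₂) = 1 :=
      ⟨P'.toContinuousLinearMap, by ext w : 1; exact LinearMap.congr_fun hP' w⟩
    obtain ⟨D, hD⟩ : ∃ D : W →L[ℂ] W, D = s.p₂.comp (X.comp s.i₂) := ⟨_, rfl⟩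
    have hDp : ∀ v, s.p₂ (X v) = D (s.p₂ v) := by
      intro v
      conv_lhs => rw [← s.sum_eq v, map_add, hXi, zero_add]
      rw [hD]
      rfl
    have hsurj : Function.Surjective s.p₂ := fun w => ⟨_, s.p₂_i₂ w⟩
    have hnX := nullity_succ_add_finrank (X : V →ₗ[ℂ] V) (D : W →ₗ[ℂ] W) (s.p₂ : V →ₗ[ℂ] W)
      hsurj hXp hDp
    have hDS : D ∈ equivariantMaps τ₂ τ₂ := hD ▸
      comp_mem_equivariantMaps hs.p₂ (comp_mem_equivariantMaps hX hs.i₂)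
    have hDJ : (D : W →ₗ[ℂ] W) ^ J = 0 := by
      rw [← LinearMap.ker_eq_top]
      refine Submodule.eq_top_of_finrank_eq ?_
      have h1 := hnX J
      have h2 : nullity (X : V →ₗ[ℂ] V) 0 (J + 1) = finrank ℂ V := by
        rw [nullity, map_zero, sub_zero, hXJ, LinearMap.ker_zero, finrank_top]
      have h3 : nullity (D : W →ₗ[ℂ] W) 0 J = finrank ℂ (LinearMap.ker ((D : W →ₗ[ℂ] W) ^ J)) := by
        rw [nullity, map_zero, sub_zero]
      omega
    obtain ⟨d, hd, hdim⟩ := ih hτ₂ hDS hDJ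
    refine ⟨_, isSubmanifoldAt_nullityStratum_of_splitting s hs hX hP hXi hD hnX hd, ?_⟩
    have h1 := finrank_equivariantMaps hκ hε hτ₁ hτ₂
    have h2 := finrank_equivariantMaps hκ hε hτ₂ hτ₁
    have h3 := s.finrank_eq
    have h4 : ∀ j, nullity (X : V →ₗ[ℂ] V) 0 (j + 1) =
        finrank ℂ K + nullity (D : W →ₗ[ℂ] W) 0 j := fun j => by
      have := hnX j
      omega
    rw [Finset.sum_range_succ', nullity_zero_right, h4 0, nullity_zero_right]
    simp only [h4, Nat.add_sub_add_left, add_zero, Nat.sub_zero]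
    rw [h3]
    -- Expansion of (dim K + dim W)²: `h1` and `h2` give the mixed terms, `hdim` the square of dim
    -- W, and the square of dim K is the first summand, split off above.
    linear_combination h1 + h2 + hdim

end NilpotentStratum

/-! ### Local strata, and the case of a single eigenvalue -/

section LocalStrata

open Module

variable {κ : ℕ} {V : Type*} [NormedAddCommGroup V] [NormedSpace ℂ V]

/-- The nullities of a continuous endomorphism. -/
noncomputable abbrev nul (X : V →L[ℂ] V) : ℂ → ℕ → ℕ := nullity (X : V →ₗ[ℂ] V)

/-- The nullities are supported on the imaginary axis. -/
def ImaginarySupport (n : ℂ → ℕ → ℕ) : Prop := ∀ μ, n μ ≠ 0 → μ.re = 0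

/-- Near `X`, the equivariant endomorphisms with imaginary spectrum and with the spectral type of
`X` form a submanifold of the expected dimension. -/
def HasLocalStratum (J : ℕ) (τ : Fin κ → V →L⋆[ℂ] V) (X : V →L[ℂ] V) : Prop :=
  ∃ (M : Set (V →L[ℂ] V)) (d : ℕ), IsSubmanifoldAt M X d ∧
    (1 + κ) * d + spectralSum (eigenCodim J) (nul X) = 2 * (finrank ℂ V * finrank ℂ V) ∧
    (∀ Y ∈ M, Y ∈ equivariantMaps τ τ ∧ ImaginarySupport (nul Y) ∧
      spectralType J (nul Y) = spectralType J (nul X)) ∧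
    -- Inequalities are recorded, rather than only the case of equality, because they add up over
    -- blocks: equality of the sums then forces equality in every block.
    ∀ᶠ Y in 𝓝 X, Y ∈ equivariantMaps τ τ → ImaginarySupport (nul Y) →
      spectralSum eigenCount (nul X) ≤ spectralSum eigenCount (nul Y) ∧
      (nul Y 0 J = nul X 0 J →
        spectralSum eigenCount (nul Y) = spectralSum eigenCount (nul X) →
        spectralSum (eigenTotal J) (nul Y) ≤ spectralSum (eigenTotal J) (nul X) ∧
        (spectralSum (eigenTotal J) (nul Y) = spectralSum (eigenTotal J) (nul X) → Y ∈ M))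

section

variable {V : Type*} [AddCommGroup V] [Module ℂ V] [FiniteDimensional ℂ V]

theorem nullity_eq_zero_of_eq_zero {f : End ℂ V} {μ : ℂ} {J : ℕ} (hJ : finrank ℂ V ≤ J)
    (h : nullity f μ J = 0) : nullity f μ = 0 := by
  funext j
  have h1 := nullity_mono f μ (le_max_left j J)
  have h2 := nullity_eq_of_finrank_le f μ (hJ.trans (le_max_right j J))
  have h3 := nullity_eq_of_finrank_le f μ hJ
  simp only [Pi.zero_apply]
  omega

theorem nullity_eq_zero_of_ne {f : End ℂ V} {μ : ℂ} {J : ℕ} (hJ : finrank ℂ V ≤ J)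
    (h : nullity f μ J = finrank ℂ V) {ν : ℂ} (hν : ν ≠ μ) : nullity f ν = 0 := by
  refine nullity_eq_zero_of_eq_zero hJ ?_
  have h1 := finsum_nullity f hJ
  rw [finsum_eq_sum_of_support_subset (s := (finite_nullity_ne_zero f).toFinset ∪ {μ, ν})] at h1
  · have h2 := Finset.add_le_sum (f := fun μ => nullity f μ J)
      (s := (finite_nullity_ne_zero f).toFinset ∪ {μ, ν}) (i := μ) (j := ν)
      (fun _ _ => Nat.zero_le _) (by simp) (by simp) hν.symm
    omega
  · intro α hα
    have : nullity f α ≠ 0 := fun h0 => hα (by simp [h0])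
    simp [this]

theorem nullity_eq_finrank_of_forall_ne {f : End ℂ V} {μ : ℂ} {J : ℕ} (hJ : finrank ℂ V ≤ J)
    (h : ∀ ν, ν ≠ μ → nullity f ν = 0) : nullity f μ J = finrank ℂ V := by
  rw [← finsum_nullity f hJ, finsum_eq_single _ μ fun ν hν => by rw [h ν hν]; rfl]

omit [FiniteDimensional ℂ V] in
theorem nullity_sub_algebraMap (f : End ℂ V) (c μ : ℂ) :
    nullity (f - algebraMap ℂ (End ℂ V) c) μ = nullity f (μ + c) := by
  funext j
  rw [nullity, nullity, sub_sub, ← map_add, add_comm c μ]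

theorem spectralSum_eigenCount_pos {f : End ℂ V} (h : finrank ℂ V ≠ 0) :
    0 < spectralSum eigenCount (nullity f) := by
  obtain ⟨μ, hμ⟩ : ∃ μ, nullity f μ ≠ 0 := by
    by_contra! h0
    apply h
    rw [← finsum_nullity f le_rfl]
    exact finsum_eq_zero_of_forall_eq_zero fun μ => by rw [h0 μ]; rfl
  rw [spectralSum_eq_sum eigenCount_zero (s := (finite_nullity_ne_zero f).toFinset)
    (fun μ hμ => by simpa using hμ)]
  refine Finset.sum_pos' (fun _ _ => Nat.zero_le _) ⟨μ, by simpa using hμ, ?_⟩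
  have : nullity f μ 1 ≠ 0 := (nullity_one_ne_zero_iff f μ).2 ((nullity_ne_zero_iff f μ).1 hμ)
  simp [eigenCount, this]

theorem exists_of_spectralSum_eigenCount_eq_one {f : End ℂ V}
    (h : spectralSum eigenCount (nullity f) = 1) :
    ∃ μ, nullity f μ ≠ 0 ∧ ∀ ν, ν ≠ μ → nullity f ν = 0 := by
  have h1 : ∀ μ, nullity f μ ≠ 0 → eigenCount μ (nullity f μ) = 1 := fun μ hμ => by
    have : nullity f μ 1 ≠ 0 := (nullity_one_ne_zero_iff f μ).2 ((nullity_ne_zero_iff f μ).1 hμ)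
    simp [eigenCount, this]
  rw [spectralSum_eq_sum eigenCount_zero (s := (finite_nullity_ne_zero f).toFinset)
    (fun μ hμ => by simpa using hμ), Finset.sum_congr rfl (fun μ hμ => h1 μ (by simpa using hμ)),
    Finset.sum_const, smul_eq_mul, mul_one, Finset.card_eq_one] at h
  obtain ⟨μ, hμ⟩ := h
  have hmem : ∀ ν, nullity f ν ≠ 0 ↔ ν = μ := fun ν => by
    have := Finset.ext_iff.1 hμ ν
    simpa using this
  exact ⟨μ, (hmem μ).2 rfl, fun ν hν => not_not.1 (mt (hmem ν).1 hν)⟩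

theorem trace_eq_of_forall_ne {f : End ℂ V} {μ : ℂ} (h : ∀ ν, ν ≠ μ → nullity f ν = 0) :
    LinearMap.trace ℂ V f = finrank ℂ V * μ := by
  have h1 : IsNilpotent (f - algebraMap ℂ (End ℂ V) μ) := by
    rw [isNilpotent_iff_nullity _ le_rfl, nullity_sub_algebraMap, zero_add]
    exact nullity_eq_finrank_of_forall_ne le_rfl h
  have h2 := (LinearMap.isNilpotent_trace_of_isNilpotent h1).eq_zero
  rw [map_sub, Algebra.algebraMap_eq_smul_one, map_smul, LinearMap.trace_one, sub_eq_zero,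
    smul_eq_mul] at h2
  rw [h2, mul_comm]

end

variable [FiniteDimensional ℂ V]

theorem pow_eq_zero_of_nullity {f : End ℂ V} {J : ℕ} (h : nullity f 0 J = finrank ℂ V) :
    f ^ J = 0 := by
  rw [← LinearMap.ker_eq_top]
  apply Submodule.eq_top_of_finrank_eq
  rwa [nullity, map_zero, sub_zero] at h

theorem nul_eq_of_mem_nullityStratum {J : ℕ} (hJ : finrank ℂ V ≤ J) {τ : Fin κ → V →L⋆[ℂ] V}
    {X Y : V →L[ℂ] V} (hX : ∀ μ, μ ≠ 0 → nul X μ = 0) (hY : Y ∈ nullityStratum τ J X) :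
    nul Y = nul X := by
  have hXJ : nul X 0 J = finrank ℂ V := nullity_eq_finrank_of_forall_ne hJ hX
  have hYJ : nul Y 0 J = finrank ℂ V := by rw [← hXJ]; exact hY.2 J le_rfl
  funext μ
  by_cases hμ : μ = 0
  · subst hμ
    funext j
    rcases le_total j J with hj | hj
    · exact hY.2 j hj
    · have h1 := nullity_mono (Y : V →ₗ[ℂ] V) 0 hj
      have h2 := nullity_mono (X : V →ₗ[ℂ] V) 0 hj
      have h3 := nullity_le_finrank (Y : V →ₗ[ℂ] V) 0 j
      have h4 := nullity_le_finrank (X : V →ₗ[ℂ] V) 0 j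
      simp only [nul] at *
      omega
  · rw [hX μ hμ, nul, nullity_eq_zero_of_ne hJ hYJ hμ]

theorem eventually_eigenTotal_le (J : ℕ) {X : V →L[ℂ] V} {μ : ℂ} {c : (V →L[ℂ] V) → ℂ}
    (hc : Tendsto c (𝓝 X) (𝓝 μ)) :
    ∀ᶠ Y in 𝓝 X, (∀ j ≤ J, nul Y (c Y) j ≤ nul X μ j) := by
  have h : ∀ j ∈ Finset.range (J + 1), ∀ᶠ Y in 𝓝 X, nul Y (c Y) j ≤ nul X μ j := fun j _ =>
    (tendsto_id.prodMk_nhds hc).eventually (eventually_nullity_le X μ j)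
  filter_upwards [(Finset.eventually_all _).2 h] with Y hY j hj
  exact hY j (by simpa [Nat.lt_succ_iff] using hj)

theorem eigenTotal_eq_iff {J : ℕ} {k l : ℕ → ℕ} {μ ν : ℂ} (h : ∀ j ≤ J, k j ≤ l j) :
    eigenTotal J μ k ≤ eigenTotal J ν l ∧
      (eigenTotal J μ k = eigenTotal J ν l → ∀ j ≤ J, k j = l j) := by
  have h' : ∀ j ∈ Finset.range (J + 1), k j ≤ l j := fun j hj =>
    h j (by simpa [Nat.lt_succ_iff] using hj)
  refine ⟨Finset.sum_le_sum h', fun he j hj => ?_⟩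
  exact (Finset.sum_eq_sum_iff_of_le h').1 he j (by simpa [Nat.lt_succ_iff] using hj)

/-- X has at most one eigenvalue, and any endomorphism of a nonzero space has at least one. Keeping
the multiplicity of 0 keeps Y nilpotent, so only the nullities at 0 remain to be compared. -/
theorem hasLocalStratum_of_nilpotent {J : ℕ} (hJ : finrank ℂ V ≤ J) (hκ : κ ≤ 1) {ε : ℝ}
    (hε : ε * ε = 1) {τ : Fin κ → V →L⋆[ℂ] V} (hτ : IsConjStructure ε τ) {X : V →L[ℂ] V}
    (hX : X ∈ equivariantMaps τ τ) (h0 : ∀ μ, μ ≠ 0 → nul X μ = 0) : HasLocalStratum J τ X := by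
  have hXJ : nul X 0 J = finrank ℂ V := nullity_eq_finrank_of_forall_ne hJ h0
  obtain ⟨d, hd, hdim⟩ := exists_isSubmanifoldAt_nullityStratum hκ hε J hτ hX
    (pow_eq_zero_of_nullity hXJ)
  have hsum : ∀ {F : ℂ → (ℕ → ℕ) → ℕ}, (∀ μ, F μ 0 = 0) → spectralSum F (nul X) = F 0 (nul X 0) :=
    fun hF => spectralSum_of_forall_ne hF 0 h0
  refine ⟨_, d, hd, ?_, ?_, ?_⟩
  · rw [hsum (eigenCodim_zero J), eigenCodim, if_pos rfl, Nat.sub_zero]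
    exact hdim
  · intro Y hY
    have := nul_eq_of_mem_nullityStratum hJ h0 hY
    refine ⟨hY.1, ?_, by rw [this]⟩
    rw [this]
    intro μ hμ
    rw [not_imp_comm.1 (h0 μ) hμ, Complex.zero_re]
  · filter_upwards [eventually_eigenTotal_le J (X := X) (μ := 0) (c := fun _ => 0)
      tendsto_const_nhds] with Y hY hYS _
    constructor
    · by_cases hV : finrank ℂ V = 0
      · have h1 := nullity_le_finrank (X : V →ₗ[ℂ] V) 0 1
        rw [hsum eigenCount_zero, eigenCount, if_pos (by simp only [nul]; omega)]
        exact Nat.zero_le _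
      · have h1 := spectralSum_eigenCount_pos (f := (Y : V →ₗ[ℂ] V)) hV
        have h2 : spectralSum eigenCount (nul X) ≤ 1 := by
          rw [hsum eigenCount_zero, eigenCount]
          split_ifs <;> simp
        simp only [nul] at *
        omega
    · intro hz _
      have hY0 : ∀ μ, μ ≠ 0 → nul Y μ = 0 := fun μ hμ =>
        nullity_eq_zero_of_ne hJ (by simp only [nul] at *; omega) hμ
      rw [hsum (eigenTotal_zero J), spectralSum_of_forall_ne (eigenTotal_zero J) 0 hY0]
      obtain ⟨h1, h2⟩ := eigenTotal_eq_iff (J := J) (μ := 0) (ν := 0) hY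
      exact ⟨h1, fun he => ⟨hYS, h2 he⟩⟩

/-- The endomorphism `X - c`. -/
noncomputable def subScalar (X : V →L[ℂ] V) (c : ℂ) : V →L[ℂ] V := X - c • (1 : V →L[ℂ] V)

omit [FiniteDimensional ℂ V] in
theorem nul_subScalar (X : V →L[ℂ] V) (c μ : ℂ) : nul (subScalar X c) μ = nul X (μ + c) :=
  nullity_sub_algebraMap (X : V →ₗ[ℂ] V) c μ

/-- The normalized trace. -/
noncomputable def meanTrace (V : Type*) [NormedAddCommGroup V] [NormedSpace ℂ V]
    [FiniteDimensional ℂ V] : (V →L[ℂ] V) →L[ℂ] ℂ :=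
  (finrank ℂ V : ℂ)⁻¹ • ((LinearMap.trace ℂ V) ∘ₗ
    (ContinuousLinearMap.coeLM ℂ : (V →L[ℂ] V) →ₗ[ℂ] (V →ₗ[ℂ] V))).toContinuousLinearMap

theorem meanTrace_eq (hV : finrank ℂ V ≠ 0) {X : V →L[ℂ] V} {μ : ℂ}
    (h : ∀ ν, ν ≠ μ → nul X ν = 0) : meanTrace V X = μ := by
  have h1 : meanTrace V X = (finrank ℂ V : ℂ)⁻¹ * LinearMap.trace ℂ V (X : V →ₗ[ℂ] V) := rfl
  rw [h1, trace_eq_of_forall_ne h, inv_mul_cancel_left₀ (by exact_mod_cast hV)]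

/-- The only eigenvalue of Y is its normalized trace, an analytic function of Y. Subtracting it
identifies the stratum with a line of imaginary numbers times a nilpotent stratum; the line accounts
for the -1 in `eigenCodim`. -/
theorem hasLocalStratum_of_single {J : ℕ} (hJ : finrank ℂ V ≤ J) {τ : Fin 0 → V →L⋆[ℂ] V}
    {X : V →L[ℂ] V} {μ : ℂ} (hμ : μ ≠ 0) (hμre : μ.re = 0) (hV : finrank ℂ V ≠ 0)
    (h0 : ∀ ν, ν ≠ μ → nul X ν = 0) : HasLocalStratum J τ X := by
  have hS : ∀ Y, Y ∈ equivariantMaps τ τ := fun Y t => Fin.elim0 t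
  have hcim : ∀ c : ℂ, c.re = 0 → (c.im : ℂ) * Complex.I = c := fun c hc => by
    conv_rhs => rw [← Complex.re_add_im c, hc, Complex.ofReal_zero, zero_add]
  set Z := subScalar X μ with hZ
  have hZ0 : ∀ ν, ν ≠ 0 → nul Z ν = 0 := fun ν hν => by
    rw [hZ, nul_subScalar]
    exact h0 _ (by simpa using hν)
  have hZμ : nul Z 0 = nul X μ := by rw [hZ, nul_subScalar, zero_add]
  have hZJ : nul Z 0 J = finrank ℂ V := nullity_eq_finrank_of_forall_ne hJ hZ0
  obtain ⟨d, hd, hdim⟩ := exists_isSubmanifoldAt_nullityStratum zero_le_one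
    (ε := 1) (by norm_num) J (τ := τ) (fun t => Fin.elim0 t) (hS Z) (pow_eq_zero_of_nullity hZJ)
  have hsum : ∀ {F : ℂ → (ℕ → ℕ) → ℕ}, (∀ μ, F μ 0 = 0) → spectralSum F (nul X) = F μ (nul X μ) :=
    fun hF => spectralSum_of_forall_ne hF μ h0
  have hXμ1 : nul X μ 1 ≠ 0 := by
    intro h1
    have h2 : nul X μ = 0 := nullity_eq_zero_of_one h1
    have h3 : nul X μ J = finrank ℂ V := nullity_eq_finrank_of_forall_ne hJ h0
    rw [h2] at h3
    exact hV h3.symm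
  let M : Set (V →L[ℂ] V) := {Y | ∃ c : ℂ, c.re = 0 ∧ c ≠ 0 ∧ subScalar Y c ∈ nullityStratum τ J Z}
  have hMspec : ∀ {Y c}, subScalar Y c ∈ nullityStratum τ J Z →
      nul Y c = nul X μ ∧ ∀ ν, ν ≠ c → nul Y ν = 0 := by
    intro Y c h
    have h1 := nul_eq_of_mem_nullityStratum hJ hZ0 h
    have h2 : ∀ ν, nul Y (ν + c) = nul Z ν := fun ν => by rw [← nul_subScalar, h1]
    refine ⟨by rw [← hZμ, ← h2, zero_add], fun ν hν => ?_⟩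
    have := h2 (ν - c)
    rw [sub_add_cancel] at this
    rw [this, hZ0 _ (sub_ne_zero.2 hν)]
  have hXM : X ∈ M := ⟨μ, hμre, hμ, hS _, fun _ _ => rfl⟩
  let r : (V →L[ℂ] V) → ℝ × (V →L[ℂ] V) := fun Y =>
    ((meanTrace V Y).im, subScalar Y (meanTrace V Y))
  let ψ : ℝ × (V →L[ℂ] V) → (V →L[ℂ] V) := fun y =>
    y.2 + ((y.1 : ℂ) * Complex.I) • (1 : V →L[ℂ] V)
  have htrX : meanTrace V X = μ := meanTrace_eq hV h0
  have hrX : r X = (μ.im, Z) := by simp only [r, htrX, hZ]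
  have htr : ContDiff ℝ ω (fun Y : V →L[ℂ] V => meanTrace V Y) :=
    (meanTrace V).contDiff.restrict_scalars ℝ
  have hr : ContDiff ℝ ω r := by
    refine (Complex.imCLM.contDiff.comp htr).prodMk ?_
    exact contDiff_id.sub (htr.smul contDiff_const)
  have hψ : ContDiff ℝ ω ψ := by
    have h1 : ContDiff ℝ ω fun y : ℝ × (V →L[ℂ] V) => (y.1 : ℂ) * Complex.I :=
      (Complex.ofRealCLM.contDiff.comp contDiff_fst).mul contDiff_const
    exact contDiff_snd.add (h1.smul contDiff_const)
  have hN : IsSubmanifoldAt (((⊤ : Submodule ℝ ℝ) : Set ℝ) ×ˢ nullityStratum τ J Z) (r X)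
      (finrank ℝ (⊤ : Submodule ℝ ℝ) + d) := by
    rw [hrX]
    exact (Submodule.isSubmanifoldAt _ Submodule.mem_top).prod hd
  refine ⟨M, _, IsSubmanifoldAt.transfer r ψ hN hXM hr.contDiffAt hψ.contDiffAt ?_ ?_, ?_, ?_, ?_⟩
  · have h1 : ∀ᶠ y : ℝ × (V →L[ℂ] V) in 𝓝 (r X), y.1 ≠ 0 := by
      rw [hrX]
      refine continuous_fst.continuousAt.eventually_ne ?_
      intro him
      exact hμ (by rw [← hcim μ hμre]; simp only at him; rw [him]; simp)
    filter_upwards [h1] with y hy hyN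
    have hsub : subScalar (ψ y) ((y.1 : ℂ) * Complex.I) = y.2 := by
      simp only [subScalar, ψ, add_sub_cancel_right]
    have hmem : subScalar (ψ y) ((y.1 : ℂ) * Complex.I) ∈ nullityStratum τ J Z := by
      rw [hsub]; exact hyN.2
    refine ⟨⟨(y.1 : ℂ) * Complex.I, by simp, by simpa using hy, hmem⟩, ?_⟩
    have h2 := meanTrace_eq hV (hMspec hmem).2
    refine Prod.ext ?_ ?_
    · simp [r, h2]
    · simp only [r, h2, hsub]
  · refine Eventually.of_forall fun Y hY => ?_
    obtain ⟨c, hc, -, hmem⟩ := hY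
    have h2 := meanTrace_eq hV (hMspec hmem).2
    refine ⟨⟨trivial, by simpa only [r, h2] using hmem⟩, ?_⟩
    simp only [r, ψ, h2, hcim c hc, subScalar, sub_add_cancel]
  · rw [finrank_top, finrank_self, hsum (eigenCodim_zero J), eigenCodim, if_neg hμ]
    simp only [add_zero, one_mul, hZμ] at hdim ⊢
    have hJ0 : 0 < J := lt_of_lt_of_le (Nat.pos_of_ne_zero hV) hJ
    -- The first increment is at least 1, so the subtraction in `eigenCodim` is not truncated.
    have h1 : 1 ≤ ∑ j ∈ Finset.range J, (nul X μ (j + 1) - nul X μ j) ^ 2 := by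
      refine le_trans ?_ (Finset.single_le_sum (fun _ _ => Nat.zero_le _) (Finset.mem_range.2 hJ0))
      have : nul X μ 0 = 0 := nullity_zero_right _ _
      rw [this, zero_add, Nat.sub_zero]
      exact Nat.one_le_pow _ _ (Nat.pos_of_ne_zero hXμ1)
    have h2 : ∑ j ∈ Finset.range J, (nullity (Z : V →ₗ[ℂ] V) 0 (j + 1) -
        nullity (Z : V →ₗ[ℂ] V) 0 j) ^ 2 =
        ∑ j ∈ Finset.range J, (nul X μ (j + 1) - nul X μ j) ^ 2 :=
      Finset.sum_congr rfl fun j _ => by rw [← hZμ]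
    omega
  · rintro Y ⟨c, hc, hc0, hmem⟩
    obtain ⟨h1, h2⟩ := hMspec hmem
    refine ⟨hS Y, fun ν hν => by rwa [not_imp_comm.1 (h2 ν) hν], ?_⟩
    have hsumY : ∀ {F : ℂ → (ℕ → ℕ) → ℕ}, (∀ μ, F μ 0 = 0) →
        spectralSum F (nul Y) = F c (nul X μ) :=
      fun hF => by rw [spectralSum_of_forall_ne hF c h2, h1]
    simp only [spectralType, hsum eigenCount_zero, hsum (eigenTotal_zero J),
      hsum (eigenCodim_zero J), hsumY eigenCount_zero, hsumY (eigenTotal_zero J),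
      hsumY (eigenCodim_zero J), h0 0 hμ.symm, h2 0 hc0.symm, eigenCount, eigenTotal, eigenCodim,
      if_neg hμ, if_neg hc0]
  · have hct : Tendsto (fun Y => meanTrace V Y) (𝓝 X) (𝓝 μ) := by
      have := (meanTrace V).continuous.tendsto X
      rwa [htrX] at this
    filter_upwards [eventually_eigenTotal_le J hct, hct.eventually_ne hμ] with Y hY hY0 _ hYim
    have h1 : spectralSum eigenCount (nul X) = 1 := by
      rw [hsum eigenCount_zero, eigenCount, if_neg hXμ1]
    rw [h1]
    refine ⟨spectralSum_eigenCount_pos hV, fun _ hcount => ?_⟩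
    obtain ⟨ν, hν, hν0⟩ := exists_of_spectralSum_eigenCount_eq_one hcount
    have h2 : meanTrace V Y = ν := meanTrace_eq hV hν0
    rw [h2] at hY hY0
    rw [hsum (eigenTotal_zero J), spectralSum_of_forall_ne (eigenTotal_zero J) ν hν0]
    obtain ⟨h3, h4⟩ := eigenTotal_eq_iff (J := J) (μ := ν) (ν := μ) hY
    refine ⟨h3, fun he => ⟨ν, hYim ν hν, hY0, hS _, fun j hj => ?_⟩⟩
    have := h4 he j hj
    change nul (subScalar Y ν) 0 j = nul Z 0 j
    rw [nul_subScalar, zero_add, hZμ, this]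

end LocalStrata

/-! ### Direct sums of equivariant blocks with disjoint spectra -/

section BlockDiagonal

open Module

variable {κ : ℕ} {V W U : Type*}
  [NormedAddCommGroup V] [NormedSpace ℂ V] [FiniteDimensional ℂ V]
  [NormedAddCommGroup W] [NormedSpace ℂ W] [FiniteDimensional ℂ W]
  [NormedAddCommGroup U] [NormedSpace ℂ U] [FiniteDimensional ℂ U]

theorem exp_mul_exp_neg (c : V →L[ℂ] V) : NormedSpace.exp c * NormedSpace.exp (-c) = 1 := by
  have : CompleteSpace V := FiniteDimensional.complete ℂ V
  have : NormedAlgebra ℚ (V →L[ℂ] V) := NormedAlgebra.restrictScalars ℚ ℝ _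
  rw [← NormedSpace.exp_add_of_commute (Commute.neg_right (Commute.refl c)), add_neg_cancel,
    NormedSpace.exp_zero]

theorem nul_sliceMap (β : (V →L[ℂ] V) →L[ℝ] (V →L[ℂ] V)) (Z : V →L[ℂ] V) :
    nul (sliceMap β Z) = nul (β Z) := by
  set c := Z - β Z with hc
  have h1 : ∀ v, NormedSpace.exp (-c) (NormedSpace.exp c v) = v := fun v => by
    have := exp_mul_exp_neg (-c)
    rw [neg_neg] at this
    exact DFunLike.congr_fun this v
  have h2 : ∀ v, NormedSpace.exp c (NormedSpace.exp (-c) v) = v := fun v =>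
    DFunLike.congr_fun (exp_mul_exp_neg c) v
  refine nullity_eq_of_equiv _ _ (LinearEquiv.ofLinearMap (NormedSpace.exp (-c) : V →L[ℂ] V)
    (NormedSpace.exp c : V →L[ℂ] V) (LinearMap.ext h1) (LinearMap.ext h2)) fun v => ?_
  exact h1 _

namespace Splitting

variable (s : Splitting V W U)

/-- The block diagonal part of an endomorphism. -/
noncomputable def blockPart : (V →L[ℂ] V) →L[ℝ] (V →L[ℂ] V) :=
  LinearMap.toContinuousLinearMap
    { toFun := fun Z => s.diag (s.p₁.comp (Z.comp s.i₁)) (s.p₂.comp (Z.comp s.i₂))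
      map_add' := fun Y Z => by ext v; simp [diag]; abel
      map_smul' := fun r Z => by
        ext v
        simp only [diag, add_apply, ContinuousLinearMap.comp_apply, smul_apply, RingHom.id_apply,
          ← Complex.coe_smul, map_smul, smul_add] }

omit [FiniteDimensional ℂ W] [FiniteDimensional ℂ U] in
theorem blockPart_apply (Z : V →L[ℂ] V) :
    s.blockPart Z = s.diag (s.p₁.comp (Z.comp s.i₁)) (s.p₂.comp (Z.comp s.i₂)) := rfl

omit [FiniteDimensional ℂ W] [FiniteDimensional ℂ U] in
theorem blockPart_diag (f : W →L[ℂ] W) (g : U →L[ℂ] U) : s.blockPart (s.diag f g) = s.diag f g := by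
  rw [blockPart_apply]
  congr 1 <;> ext x <;> simp [diag, s.p₁_i₁, s.p₂_i₁, s.p₁_i₂, s.p₂_i₂]

omit [FiniteDimensional ℂ W] [FiniteDimensional ℂ U] in
theorem blockPart_eq_zero {Z : V →L[ℂ] V} (h : s.blockPart Z = 0) :
    (∀ x, s.p₁ (Z (s.i₁ x)) = 0) ∧ ∀ x, s.p₂ (Z (s.i₂ x)) = 0 := by
  constructor
  · intro x
    have := congrArg s.p₁ (DFunLike.congr_fun h (s.i₁ x))
    simpa [blockPart_apply, diag, s.p₁_i₁, s.p₂_i₁, s.p₁_i₂] using this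
  · intro x
    have := congrArg s.p₂ (DFunLike.congr_fun h (s.i₂ x))
    simpa [blockPart_apply, diag, s.p₂_i₂, s.p₂_i₁, s.p₁_i₂] using this

theorem nul_blockPart (Z : V →L[ℂ] V) : nul (s.blockPart Z) =
    nul (s.p₁.comp (Z.comp s.i₁)) + nul (s.p₂.comp (Z.comp s.i₂)) :=
  s.nullity_diag _ _

/-- The bracket of an off-diagonal map with a diagonal one is off-diagonal. An off-diagonal map
commuting with diag(A, D) has components intertwining A and D, which vanish because the spectra are
disjoint. -/
theorem exists_local_inverse {A : W →L[ℂ] W} {D : U →L[ℂ] U}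
    (h : ∀ μ, nul A μ = 0 ∨ nul D μ = 0) :
    ∃ r : (V →L[ℂ] V) → (V →L[ℂ] V), ContDiffAt ℝ ω r (s.diag A D) ∧
      r (s.diag A D) = s.diag A D ∧
      (∀ᶠ Y in 𝓝 (s.diag A D), sliceMap s.blockPart (r Y) = Y) ∧
      ∀ᶠ Z in 𝓝 (s.diag A D), r (sliceMap s.blockPart Z) = Z := by
  refine exists_local_inverse_sliceMap s.blockPart (fun Z => s.blockPart_diag _ _)
    (s.blockPart_diag A D) ?_ ?_
  · intro c hc
    obtain ⟨h1, h2⟩ := s.blockPart_eq_zero hc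
    have h0 : ∀ f g, s.diag f g = 0 ↔ f = 0 ∧ g = 0 := by
      intro f g
      constructor
      · intro hfg
        constructor
        · ext x
          have := congrArg s.p₁ (DFunLike.congr_fun hfg (s.i₁ x))
          simpa [diag, s.p₁_i₁, s.p₂_i₁, s.p₁_i₂] using this
        · ext x
          have := congrArg s.p₂ (DFunLike.congr_fun hfg (s.i₂ x))
          simpa [diag, s.p₂_i₂, s.p₂_i₁, s.p₁_i₂] using this
      · rintro ⟨rfl, rfl⟩
        ext v
        simp [diag]
    rw [blockPart_apply, h0]
    constructor <;> ext x <;>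
      simp [diag, s.p₁_i₁, s.p₂_i₁, s.p₁_i₂, s.p₂_i₂, h1, h2]
  · intro c hc hcomm
    obtain ⟨h1, h2⟩ := s.blockPart_eq_zero hc
    have h3 : ∀ v, c (s.diag A D v) = s.diag A D (c v) := fun v => DFunLike.congr_fun hcomm v
    have h12 : ((s.p₁.comp (c.comp s.i₂) : U →L[ℂ] W) : U →ₗ[ℂ] W) = 0 := by
      refine eq_zero_of_intertwines h _ fun x => ?_
      have := congrArg s.p₁ (h3 (s.i₂ x))
      simpa [diag, s.p₁_i₁, s.p₂_i₁, s.p₁_i₂, s.p₂_i₂] using this.symm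
    have h21 : ((s.p₂.comp (c.comp s.i₁) : W →L[ℂ] U) : W →ₗ[ℂ] U) = 0 := by
      refine eq_zero_of_intertwines (fun μ => (h μ).symm) _ fun x => ?_
      have := congrArg s.p₂ (h3 (s.i₁ x))
      simpa [diag, s.p₁_i₁, s.p₂_i₁, s.p₁_i₂, s.p₂_i₂] using this.symm
    have h12' : ∀ x, s.p₁ (c (s.i₂ x)) = 0 := fun x => LinearMap.congr_fun h12 x
    have h21' : ∀ x, s.p₂ (c (s.i₁ x)) = 0 := fun x => LinearMap.congr_fun h21 x
    ext v
    rw [← s.sum_eq (c v), ← s.sum_eq v]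
    simp [h1, h2, h12', h21']

omit [FiniteDimensional ℂ W] [FiniteDimensional ℂ U] in
-- Written through the two idempotents, `blockPart` visibly commutes with every ring endomorphism
-- that fixes both idempotents or exchanges them.
theorem blockPart_eq_mul (Z : V →L[ℂ] V) : s.blockPart Z =
    (s.i₁.comp s.p₁) * Z * (s.i₁.comp s.p₁) + (s.i₂.comp s.p₂) * Z * (s.i₂.comp s.p₂) := rfl

end Splitting

theorem spectralSum_nul_add {F : ℂ → (ℕ → ℕ) → ℕ} (hF : ∀ μ, F μ 0 = 0) {A : W →L[ℂ] W}
    {D : U →L[ℂ] U} (h : ∀ μ, nul A μ = 0 ∨ nul D μ = 0) :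
    spectralSum F (nul A + nul D) = spectralSum F (nul A) + spectralSum F (nul D) :=
  spectralSum_add hF (finite_nullity_ne_zero _) (finite_nullity_ne_zero _) h

theorem spectralType_add {J : ℕ} {A A' : W →L[ℂ] W} {D D' : U →L[ℂ] U}
    (h : ∀ μ, nul A μ = 0 ∨ nul D μ = 0) (h' : ∀ μ, nul A' μ = 0 ∨ nul D' μ = 0)
    (hA : spectralType J (nul A') = spectralType J (nul A))
    (hD : spectralType J (nul D') = spectralType J (nul D)) :
    spectralType J (nul A' + nul D') = spectralType J (nul A + nul D) := by
  simp only [spectralType, SpectralType.mk.injEq, spectralSum_nul_add eigenCount_zero h,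
    spectralSum_nul_add (eigenTotal_zero J) h, spectralSum_nul_add (eigenCodim_zero J) h,
    spectralSum_nul_add eigenCount_zero h', spectralSum_nul_add (eigenTotal_zero J) h',
    spectralSum_nul_add (eigenCodim_zero J) h', Pi.add_apply] at *
  omega

/-- Endomorphisms near diag(A, D) are conjugate, by the exponential of a small off-diagonal map, to
block diagonal ones whose blocks have disjoint spectra. The stratum becomes the product of the
strata of A and D with the equivariant maps between W and U; these supply the mixed term of (dim W +
dim U)². -/
theorem hasLocalStratum_diag {J : ℕ} (hκ : κ ≤ 1) {ε : ℝ} (hε : ε * ε = 1)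
    {τ : Fin κ → V →L⋆[ℂ] V} {τ₁ : Fin κ → W →L⋆[ℂ] W} {τ₂ : Fin κ → U →L⋆[ℂ] U}
    (hτ : IsConjStructure ε τ) (hτ₁ : IsConjStructure ε τ₁) (hτ₂ : IsConjStructure ε τ₂)
    (s : Splitting V W U) (hs : s.IsEquivariant τ τ₁ τ₂) {A : W →L[ℂ] W} {D : U →L[ℂ] U}
    (hX : s.diag A D ∈ equivariantMaps τ τ)
    (hAD : ∀ μ, nul A μ = 0 ∨ nul D μ = 0)
    (hA : HasLocalStratum J τ₁ A) (hD : HasLocalStratum J τ₂ D) :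
    HasLocalStratum J τ (s.diag A D) := by
  obtain ⟨r, hr, hrX, hGr, hrG⟩ := s.exists_local_inverse hAD
  set X := s.diag A D with hXdef
  set β := s.blockPart with hβ
  set a : (V →L[ℂ] V) → (W →L[ℂ] W) := fun Z => s.p₁.comp (Z.comp s.i₁) with ha
  set b : (V →L[ℂ] V) → (U →L[ℂ] U) := fun Z => s.p₂.comp (Z.comp s.i₂) with hb
  have hac : Continuous a := by fun_prop
  have hbc : Continuous b := by fun_prop
  have haX : a X = A := by
    ext x; simp [ha, hXdef, Splitting.diag, s.p₁_i₁, s.p₂_i₁]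
  have hbX : b X = D := by
    ext x; simp [hb, hXdef, Splitting.diag, s.p₂_i₂, s.p₁_i₂]
  have har : Tendsto (fun Y => a (r Y)) (𝓝 X) (𝓝 A) := by
    have := (hac.tendsto (r X)).comp hr.continuousAt.tendsto
    rwa [hrX, haX] at this
  have hbr : Tendsto (fun Y => b (r Y)) (𝓝 X) (𝓝 D) := by
    have := (hbc.tendsto (r X)).comp hr.continuousAt.tendsto
    rwa [hrX, hbX] at this
  have hnul : ∀ Z, nul (sliceMap β Z) = nul (a Z) + nul (b Z) := fun Z => by
    rw [nul_sliceMap, hβ, s.nul_blockPart]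
  have hnulX : nul X = nul A + nul D := s.nullity_diag A D
  let σ : Fin κ → (V →L[ℂ] V) →+* (V →L[ℂ] V) := fun t => conjRingHom ε hε (τ t) (hτ t)
  have hσc : ∀ t, Continuous (σ t) := fun t => continuous_conjMap ε (τ t) (τ t)
  have hσS : ∀ Z, Z ∈ equivariantMaps τ τ ↔ ∀ t, σ t Z = Z := fun Z =>
    forall_congr' fun t => (conjMap_eq_self_iff hε (hτ t) Z).symm
  have hσβ : ∀ t Z, β (σ t Z) = σ t (β Z) := by
    intro t Z
    have h1 := (hσS _).1 (comp_mem_equivariantMaps hs.i₁ hs.p₁) t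
    have h2 := (hσS _).1 (comp_mem_equivariantMaps hs.i₂ hs.p₂) t
    rw [hβ, s.blockPart_eq_mul, s.blockPart_eq_mul, map_add, map_mul, map_mul, map_mul, map_mul,
      h1, h2]
  have hσG : ∀ t Z, sliceMap β (σ t Z) = σ t (sliceMap β Z) := fun t =>
    sliceMap_map β (σ t) (hσc t) (hσβ t)
  have hGS : ∀ Z ∈ equivariantMaps τ τ, sliceMap β Z ∈ equivariantMaps τ τ := fun Z hZ =>
    (hσS _).2 fun t => by rw [← hσG, (hσS Z).1 hZ t]
  have hrS : ∀ᶠ Y in 𝓝 X, Y ∈ equivariantMaps τ τ → r Y ∈ equivariantMaps τ τ := by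
    have h1 : ∀ᶠ Y in 𝓝 X, ∀ t, σ t Y = Y → σ t (r Y) = r Y := eventually_all.2 fun t =>
      eventually_local_inverse_map (hσc t) (hσG t) ((hσS X).1 hX t) hr.continuousAt hrX hGr hrG
    filter_upwards [h1] with Y hY hYS
    exact (hσS _).2 fun t => hY t ((hσS Y).1 hYS t)
  have hdisj : ∀ᶠ Y in 𝓝 X, ∀ μ, nul (a (r Y)) μ = 0 ∨ nul (b (r Y)) μ = 0 :=
    (har.prodMk_nhds hbr).eventually (eventually_nullity_eq_zero_or hAD)
  obtain ⟨MA, dA, hMA, hdimA, hMA', hevA⟩ := hA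
  obtain ⟨MD, dD, hMD, hdimD, hMD', hevD⟩ := hD
  let M : Set (V →L[ℂ] V) := {Y | sliceMap β (r Y) = Y ∧ r Y ∈ equivariantMaps τ τ ∧
    a (r Y) ∈ MA ∧ b (r Y) ∈ MD ∧ ∀ μ, nul (a (r Y)) μ = 0 ∨ nul (b (r Y)) μ = 0}
  let rr : (V →L[ℂ] V) → (W →L[ℂ] U) × (U →L[ℂ] W) × (W →L[ℂ] W) × (U →L[ℂ] U) := fun Y =>
    (s.p₂.comp ((r Y).comp s.i₁), s.p₁.comp ((r Y).comp s.i₂), a (r Y), b (r Y))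
  let asm : (W →L[ℂ] U) × (U →L[ℂ] W) × (W →L[ℂ] W) × (U →L[ℂ] U) → (V →L[ℂ] V) := fun y =>
    s.i₂.comp (y.1.comp s.p₁) + s.i₁.comp (y.2.1.comp s.p₂) + s.diag y.2.2.1 y.2.2.2
  have hasm : ContDiff ℝ ω asm := by
    have : ContDiff ℂ ω asm := by
      simp only [asm, Splitting.diag]
      fun_prop
    exact this.restrict_scalars ℝ
  have hsplit : ContDiff ℝ ω fun Z : V →L[ℂ] V =>
      (s.p₂.comp (Z.comp s.i₁), s.p₁.comp (Z.comp s.i₂), a Z, b Z) := by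
    have : ContDiff ℂ ω fun Z : V →L[ℂ] V =>
        (s.p₂.comp (Z.comp s.i₁), s.p₁.comp (Z.comp s.i₂), a Z, b Z) := by
      simp only [ha, hb]
      fun_prop
    exact this.restrict_scalars ℝ
  have hrr : ContDiffAt ℝ ω rr X := hsplit.contDiffAt.comp X hr
  have hsplit_asm : ∀ y, (s.p₂.comp ((asm y).comp s.i₁), s.p₁.comp ((asm y).comp s.i₂),
      a (asm y), b (asm y)) = y := by
    intro y
    refine Prod.ext ?_ (Prod.ext ?_ (Prod.ext ?_ ?_)) <;> ext x <;>
      simp [asm, ha, hb, Splitting.diag, s.p₁_i₁, s.p₂_i₁, s.p₁_i₂, s.p₂_i₂]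
  have hasm_split : ∀ Z, asm (s.p₂.comp (Z.comp s.i₁), s.p₁.comp (Z.comp s.i₂), a Z, b Z) = Z := by
    intro Z
    ext v
    have h1 : Z v = Z (s.i₁ (s.p₁ v)) + Z (s.i₂ (s.p₂ v)) := by rw [← map_add, s.sum_eq]
    rw [h1, ← s.sum_eq (Z (s.i₁ (s.p₁ v))), ← s.sum_eq (Z (s.i₂ (s.p₂ v)))]
    simp only [asm, ha, hb, Splitting.diag, add_apply, ContinuousLinearMap.comp_apply]
    abel
  have hasmX : asm (rr X) = X := (hasm_split (r X)).trans hrX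
  have hrrX : rr X = (0, 0, A, D) := by
    have h1 : rr X = (s.p₂.comp (X.comp s.i₁), s.p₁.comp (X.comp s.i₂), a X, b X) := by
      simp only [rr, hrX]
    rw [h1, haX, hbX]
    refine Prod.ext ?_ (Prod.ext ?_ rfl) <;> ext x <;>
      simp [hXdef, Splitting.diag, s.p₁_i₁, s.p₂_i₁, s.p₁_i₂, s.p₂_i₂]
  have hXM : X ∈ M := by
    refine ⟨hGr.self_of_nhds, by rwa [hrX], ?_, ?_, hdisj.self_of_nhds⟩
    · rw [hrX, haX]; exact hMA.1
    · rw [hrX, hbX]; exact hMD.1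
  have hN : IsSubmanifoldAt (((equivariantMaps τ₁ τ₂ : Submodule ℝ _) : Set (W →L[ℂ] U)) ×ˢ
      (((equivariantMaps τ₂ τ₁ : Submodule ℝ _) : Set (U →L[ℂ] W)) ×ˢ (MA ×ˢ MD))) (rr X)
      (finrank ℝ (equivariantMaps τ₁ τ₂) + (finrank ℝ (equivariantMaps τ₂ τ₁) + (dA + dD))) := by
    rw [hrrX]
    exact (Submodule.isSubmanifoldAt _ (zero_mem _)).prod
      ((Submodule.isSubmanifoldAt _ (zero_mem _)).prod (hMA.prod hMD))
  refine ⟨M, _, IsSubmanifoldAt.transfer rr (fun y => sliceMap β (asm y)) hN hXM hrr ?_ ?_ ?_,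
    ?_, ?_, ?_⟩
  · exact ((contDiff_sliceMap β).comp hasm).contDiffAt
  · have h1 : Tendsto asm (𝓝 (rr X)) (𝓝 X) := by
      have := hasm.continuous.tendsto (rr X)
      rwa [hasmX] at this
    have h2 : ∀ᶠ y in 𝓝 (rr X), ∀ μ, nul y.2.2.1 μ = 0 ∨ nul y.2.2.2 μ = 0 := by
      have hc : Continuous fun y : (W →L[ℂ] U) × (U →L[ℂ] W) × (W →L[ℂ] W) × (U →L[ℂ] U) =>
        (y.2.2.1, y.2.2.2) := by fun_prop
      have h3 := hc.tendsto (rr X)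
      rw [hrrX] at h3 ⊢
      exact h3.eventually (eventually_nullity_eq_zero_or hAD)
    filter_upwards [h1.eventually hrG, h2] with y hy hy2 hyN
    obtain ⟨hy1, hy3, hyA, hyD⟩ := hyN
    have hsy := hsplit_asm y
    have hsa : a (asm y) = y.2.2.1 := congrArg (fun z => z.2.2.1) hsy
    have hsb : b (asm y) = y.2.2.2 := congrArg (fun z => z.2.2.2) hsy
    have hyS : ∀ t, ∀ v, y.2.2.1 (τ₁ t v) = τ₁ t (y.2.2.1 v) := (hMA' _ hyA).1
    have hyS2 : ∀ t, ∀ v, y.2.2.2 (τ₂ t v) = τ₂ t (y.2.2.2 v) := (hMD' _ hyD).1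
    constructor
    · refine ⟨by rw [hy], ?_, ?_, ?_, ?_⟩
      · rw [hy]
        refine add_mem (add_mem ?_ ?_) (add_mem ?_ ?_)
        · exact comp_mem_equivariantMaps hs.i₂ (comp_mem_equivariantMaps hy1 hs.p₁)
        · exact comp_mem_equivariantMaps hs.i₁ (comp_mem_equivariantMaps hy3 hs.p₂)
        · exact comp_mem_equivariantMaps hs.i₁ (comp_mem_equivariantMaps hyS hs.p₁)
        · exact comp_mem_equivariantMaps hs.i₂ (comp_mem_equivariantMaps hyS2 hs.p₂)
      · rw [hy, hsa]; exact hyA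
      · rw [hy, hsb]; exact hyD
      · rw [hy, hsa, hsb]; exact hy2
    · simp only [rr, hy]
      exact hsy
  · refine Eventually.of_forall fun Y hY => ?_
    obtain ⟨hY1, hYS, hYA, hYD, -⟩ := hY
    refine ⟨⟨?_, ?_, hYA, hYD⟩, ?_⟩
    · exact comp_mem_equivariantMaps hs.p₂ (comp_mem_equivariantMaps hYS hs.i₁)
    · exact comp_mem_equivariantMaps hs.p₁ (comp_mem_equivariantMaps hYS hs.i₂)
    · have := hasm_split (r Y)
      change sliceMap β (asm (rr Y)) = Y
      rw [show asm (rr Y) = r Y from this, hY1]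
  · have h1 := finrank_equivariantMaps hκ hε hτ₁ hτ₂
    have h2 := finrank_equivariantMaps hκ hε hτ₂ hτ₁
    rw [hnulX, spectralSum_nul_add (eigenCodim_zero J) hAD, s.finrank_eq]
    linear_combination h1 + h2 + hdimA + hdimD
  · rintro Y ⟨hY1, hYS, hYA, hYD, hYdisj⟩
    have hnY : nul Y = nul (a (r Y)) + nul (b (r Y)) := by rw [← hnul, hY1]
    obtain ⟨-, hAim, hAt⟩ := hMA' _ hYA
    obtain ⟨-, hDim, hDt⟩ := hMD' _ hYD
    refine ⟨hY1 ▸ hGS _ hYS, ?_, ?_⟩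
    · intro μ hμ
      rcases hYdisj μ with h | h
      · refine hDim μ fun h0 => hμ ?_
        rw [hnY, Pi.add_apply, h, h0, add_zero]
      · refine hAim μ fun h0 => hμ ?_
        rw [hnY, Pi.add_apply, h, h0, add_zero]
    · rw [hnY, hnulX]
      exact spectralType_add hAD hYdisj hAt hDt
  · have hz1 := har.eventually (eventually_eigenTotal_le J (X := A) (μ := 0) (c := fun _ => 0)
      tendsto_const_nhds)
    have hz2 := hbr.eventually (eventually_eigenTotal_le J (X := D) (μ := 0) (c := fun _ => 0)
      tendsto_const_nhds)
    filter_upwards [hGr, hrS, hdisj, har.eventually hevA, hbr.eventually hevD, hz1, hz2] with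
      Y hY1 hYS' hYdisj hYA hYD hYz1 hYz2 hYS hYim
    have hrYS := hYS' hYS
    have hnY : nul Y = nul (a (r Y)) + nul (b (r Y)) := by rw [← hnul, hY1]
    have hYA1 := hYA (comp_mem_equivariantMaps hs.p₁ (comp_mem_equivariantMaps hrYS hs.i₁))
      (fun μ hμ => hYim μ (by
        rw [hnY]; intro h0
        exact hμ (funext fun j => by have := congrFun h0 j; simp at this; exact this.1)))
    have hYD1 := hYD (comp_mem_equivariantMaps hs.p₂ (comp_mem_equivariantMaps hrYS hs.i₂))
      (fun μ hμ => hYim μ (by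
        rw [hnY]; intro h0
        exact hμ (funext fun j => by have := congrFun h0 j; simp at this; exact this.2)))
    rw [hnY, hnulX]
    simp only [spectralSum_nul_add eigenCount_zero hAD, spectralSum_nul_add eigenCount_zero hYdisj,
      spectralSum_nul_add (eigenTotal_zero J) hAD, spectralSum_nul_add (eigenTotal_zero J) hYdisj,
      Pi.add_apply]
    -- The multiplicity of 0 can only drop in each block, so when the total is unchanged it is
    -- unchanged in both.
    have hz1 := hYz1 J le_rfl
    have hz2 := hYz2 J le_rfl
    refine ⟨add_le_add hYA1.1 hYD1.1, fun hz hc => ?_⟩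
    obtain ⟨hA1, hA2⟩ := hYA1.2 (by omega) (by have := hYA1.1; have := hYD1.1; omega)
    obtain ⟨hD1, hD2⟩ := hYD1.2 (by omega) (by have := hYA1.1; have := hYD1.1; omega)
    exact ⟨add_le_add hA1 hD1, fun ht => ⟨hY1, hrYS, hA2 (by omega), hD2 (by omega), hYdisj⟩⟩

end BlockDiagonal

/-! ### Two blocks exchanged by the antilinear structure -/

section ConjugateBlocks

open Module

variable {V W U : Type*}
  [NormedAddCommGroup V] [NormedSpace ℂ V] [FiniteDimensional ℂ V]
  [NormedAddCommGroup W] [NormedSpace ℂ W] [FiniteDimensional ℂ W]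
  [NormedAddCommGroup U] [NormedSpace ℂ U] [FiniteDimensional ℂ U]

namespace Splitting

variable (s : Splitting V W U) {ε : ℝ} {σ : V →L⋆[ℂ] V}

omit [FiniteDimensional ℂ V] [FiniteDimensional ℂ W] [FiniteDimensional ℂ U] in
theorem i₂_p₂_of_p₁_eq_zero {v : V} (h : s.p₁ v = 0) : s.i₂ (s.p₂ v) = v := by
  conv_rhs => rw [← s.sum_eq v, h, map_zero, zero_add]

omit [FiniteDimensional ℂ V] [FiniteDimensional ℂ W] [FiniteDimensional ℂ U] in
theorem i₁_p₁_of_p₂_eq_zero {v : V} (h : s.p₂ v = 0) : s.i₁ (s.p₁ v) = v := by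
  conv_rhs => rw [← s.sum_eq v, h, map_zero, add_zero]

/-- An antilinear map exchanging the summands identifies them as real vector spaces. -/
noncomputable def swapEquiv (hε : ε * ε = 1) (hσ : ∀ v, σ (σ v) = (ε : ℂ) • v)
    (h₁ : ∀ x, s.p₁ (σ (s.i₁ x)) = 0) (h₂ : ∀ x, s.p₂ (σ (s.i₂ x)) = 0) : W ≃ₗ[ℝ] U where
  toFun x := s.p₂ (σ (s.i₁ x))
  invFun y := (ε : ℂ) • s.p₁ (σ (s.i₂ y))
  map_add' x y := by simp
  map_smul' r x := by
    simp only [← Complex.coe_smul, map_smul, map_eps_smul, RingHom.id_apply]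
  left_inv x := by
    simp only [s.i₂_p₂_of_p₁_eq_zero (h₁ x), hσ, map_smul, eps_smul_eps_smul hε, s.p₁_i₁]
  right_inv y := by
    simp only [map_smul, map_eps_smul, s.i₁_p₁_of_p₂_eq_zero (h₂ y), hσ, eps_smul_eps_smul hε,
      s.p₂_i₂]

omit [FiniteDimensional ℂ V] [FiniteDimensional ℂ W] [FiniteDimensional ℂ U] in
-- The antilinear bijection W → U induced by σ carries the first block of Z to the second, hence
-- conjugates eigenvalues.
theorem nul_swap (hε : ε * ε = 1) (hσ : ∀ v, σ (σ v) = (ε : ℂ) • v)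
    (h₁ : ∀ x, s.p₁ (σ (s.i₁ x)) = 0) (h₂ : ∀ x, s.p₂ (σ (s.i₂ x)) = 0) {Z : V →L[ℂ] V}
    (hZ : ∀ v, Z (σ v) = σ (Z v)) :
    nul (s.p₂.comp (Z.comp s.i₂)) =
      fun μ => nul (s.p₁.comp (Z.comp s.i₁)) (starRingEnd ℂ μ) := by
  funext μ j
  refine (nullity_eq_of_realEquiv _ _ _ _ (s.swapEquiv hε hσ h₁ h₂) (fun x => ?_) j).symm
  have h3 : ∀ x, s.swapEquiv hε hσ h₁ h₂ x = s.p₂ (σ (s.i₁ x)) := fun _ => rfl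
  rw [map_sub, h3, h3, h3]
  simp only [ContinuousLinearMap.coe_coe, ContinuousLinearMap.comp_apply, map_smul,
    ContinuousLinearMap.map_smulₛₗ, Complex.conj_conj]
  rw [s.i₂_p₂_of_p₁_eq_zero (h₁ x), hZ]
  conv_rhs => rw [← s.sum_eq (Z (s.i₁ x))]
  simp [h₂]

omit [FiniteDimensional ℂ V] [FiniteDimensional ℂ W] [FiniteDimensional ℂ U] in
theorem conj_projection (hε : ε * ε = 1) (hσ : ∀ v, σ (σ v) = (ε : ℂ) • v)
    (h₁ : ∀ x, s.p₁ (σ (s.i₁ x)) = 0) (h₂ : ∀ x, s.p₂ (σ (s.i₂ x)) = 0) (v : V) :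
    (ε : ℂ) • σ (s.i₁ (s.p₁ (σ v))) = s.i₂ (s.p₂ v) := by
  have : s.p₁ (σ v) = s.p₁ (σ (s.i₂ (s.p₂ v))) := by
    conv_lhs => rw [← s.sum_eq v, map_add, map_add, h₁, zero_add]
  rw [this, s.i₁_p₁_of_p₂_eq_zero (h₂ _), hσ, eps_smul_eps_smul hε]

end Splitting

omit [FiniteDimensional ℂ W] [FiniteDimensional ℂ U] in
theorem spectralSum_nul_of_conj {F : ℂ → (ℕ → ℕ) → ℕ} (hF : ∀ μ, F (starRingEnd ℂ μ) = F μ)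
    {A : W →L[ℂ] W} {D : U →L[ℂ] U} (h : nul D = fun μ => nul A (starRingEnd ℂ μ)) :
    spectralSum F (nul D) = spectralSum F (nul A) := by
  rw [h, spectralSum_comp_conj hF]

omit [FiniteDimensional ℂ W] [FiniteDimensional ℂ U] in
theorem spectralType_of_conj (J : ℕ) {A : W →L[ℂ] W} {D : U →L[ℂ] U}
    (h : nul D = fun μ => nul A (starRingEnd ℂ μ)) :
    spectralType J (nul D) = spectralType J (nul A) := by
  simp only [spectralType, spectralSum_nul_of_conj (F := eigenCount) (fun _ => rfl) h,
    spectralSum_nul_of_conj (F := eigenTotal J) (fun _ => rfl) h,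
    spectralSum_nul_of_conj (eigenCodim_conj J) h, SpectralType.mk.injEq, and_true]
  simp only [h, map_zero]

/-- An equivariant endomorphism is determined by its restriction to W, as τ carries W to U. So there
is no reality condition left: the parameters are an arbitrary complex map W → U and a point of the
stratum of A for κ = 0. -/
theorem hasLocalStratum_of_swap {J : ℕ} {ε : ℝ} (hε : ε * ε = 1)
    {τ : Fin 1 → V →L⋆[ℂ] V} (hτ : IsConjStructure ε τ) (τ₀ : Fin 0 → W →L⋆[ℂ] W)
    (s : Splitting V W U) (h₁ : ∀ x, s.p₁ (τ 0 (s.i₁ x)) = 0)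
    (h₂ : ∀ x, s.p₂ (τ 0 (s.i₂ x)) = 0) {A : W →L[ℂ] W} {D : U →L[ℂ] U}
    (hX : s.diag A D ∈ equivariantMaps τ τ) (hAD : ∀ μ, nul A μ = 0 ∨ nul D μ = 0)
    (hA : HasLocalStratum J τ₀ A) : HasLocalStratum J τ (s.diag A D) := by
  obtain ⟨r, hr, hrX, hGr, hrG⟩ := s.exists_local_inverse hAD
  set X := s.diag A D with hXdef
  set β := s.blockPart with hβ
  set a : (V →L[ℂ] V) → (W →L[ℂ] W) := fun Z => s.p₁.comp (Z.comp s.i₁) with ha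
  set b : (V →L[ℂ] V) → (U →L[ℂ] U) := fun Z => s.p₂.comp (Z.comp s.i₂) with hb
  have hac : Continuous a := by fun_prop
  have hbc : Continuous b := by fun_prop
  have haX : a X = A := by
    ext x; simp [ha, hXdef, Splitting.diag, s.p₁_i₁, s.p₂_i₁]
  have hbX : b X = D := by
    ext x; simp [hb, hXdef, Splitting.diag, s.p₂_i₂, s.p₁_i₂]
  have har : Tendsto (fun Y => a (r Y)) (𝓝 X) (𝓝 A) := by
    have := (hac.tendsto (r X)).comp hr.continuousAt.tendsto
    rwa [hrX, haX] at this
  have hbr : Tendsto (fun Y => b (r Y)) (𝓝 X) (𝓝 D) := by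
    have := (hbc.tendsto (r X)).comp hr.continuousAt.tendsto
    rwa [hrX, hbX] at this
  have hnul : ∀ Z, nul (sliceMap β Z) = nul (a Z) + nul (b Z) := fun Z => by
    rw [nul_sliceMap, hβ, s.nul_blockPart]
  have hnulX : nul X = nul A + nul D := s.nullity_diag A D
  let σ : (V →L[ℂ] V) →+* (V →L[ℂ] V) := conjRingHom ε hε (τ 0) (hτ 0)
  have hσv : ∀ Z v, σ Z v = (ε : ℂ) • τ 0 (Z (τ 0 v)) := fun _ _ => rfl
  have hσc : Continuous σ := continuous_conjMap ε (τ 0) (τ 0)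
  have hS : ∀ Z, Z ∈ equivariantMaps τ τ ↔ ∀ v, Z (τ 0 v) = τ 0 (Z v) := fun Z =>
    ⟨fun h => h 0, fun h t => by rw [Subsingleton.elim t 0]; exact h⟩
  have hσS : ∀ Z, Z ∈ equivariantMaps τ τ ↔ σ Z = Z := fun Z =>
    (hS Z).trans (conjMap_eq_self_iff hε (hτ 0) Z).symm
  have hσσ : ∀ Z, σ (σ Z) = Z := fun Z => by
    ext v
    rw [hσv, hσv, map_eps_smul, hτ 0, hτ 0, map_smul, eps_smul_eps_smul hε, eps_smul_eps_smul hε]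
  have hconj : ∀ Z ∈ equivariantMaps τ τ, nul (b Z) = fun μ => nul (a Z) (starRingEnd ℂ μ) :=
    fun Z hZ => s.nul_swap hε (hτ 0) h₁ h₂ ((hS Z).1 hZ)
  have hσβ : ∀ Z, β (σ Z) = σ (β Z) := by
    intro Z
    have hP : σ (s.i₁.comp s.p₁) = s.i₂.comp s.p₂ := by
      ext v
      exact s.conj_projection hε (hτ 0) h₁ h₂ v
    have hQ : σ (s.i₂.comp s.p₂) = s.i₁.comp s.p₁ := by rw [← hP, hσσ]
    rw [hβ, s.blockPart_eq_mul, s.blockPart_eq_mul, map_add, map_mul, map_mul, map_mul, map_mul,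
      hP, hQ, add_comm]
  have hσG : ∀ Z, sliceMap β (σ Z) = σ (sliceMap β Z) := sliceMap_map β σ hσc hσβ
  have hGS : ∀ Z ∈ equivariantMaps τ τ, sliceMap β Z ∈ equivariantMaps τ τ := fun Z hZ =>
    (hσS _).2 (by rw [← hσG, (hσS Z).1 hZ])
  have hrS : ∀ᶠ Y in 𝓝 X, Y ∈ equivariantMaps τ τ → r Y ∈ equivariantMaps τ τ := by
    filter_upwards [eventually_local_inverse_map hσc hσG ((hσS X).1 hX) hr.continuousAt hrX hGr
      hrG] with Y hY hYS
    exact (hσS _).2 (hY ((hσS Y).1 hYS))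
  have hdisj : ∀ᶠ Y in 𝓝 X, ∀ μ, nul (a (r Y)) μ = 0 ∨ nul (b (r Y)) μ = 0 :=
    (har.prodMk_nhds hbr).eventually (eventually_nullity_eq_zero_or hAD)
  have hconjX : nul D = fun μ => nul A (starRingEnd ℂ μ) := by
    have := hconj X hX
    rwa [haX, hbX] at this
  obtain ⟨MA, dA, hMA, hdimA, hMA', hevA⟩ := hA
  let M : Set (V →L[ℂ] V) := {Y | sliceMap β (r Y) = Y ∧ r Y ∈ equivariantMaps τ τ ∧
    a (r Y) ∈ MA ∧ ∀ μ, nul (a (r Y)) μ = 0 ∨ nul (b (r Y)) μ = 0}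
  let rr : (V →L[ℂ] V) → (W →L[ℂ] U) × (W →L[ℂ] W) := fun Y =>
    (s.p₂.comp ((r Y).comp s.i₁), a (r Y))
  let half : (W →L[ℂ] U) × (W →L[ℂ] W) → (V →L[ℂ] V) := fun y =>
    s.i₁.comp (y.2.comp s.p₁) + s.i₂.comp (y.1.comp s.p₁)
  -- `half` is the part living on W; adding its conjugate supplies the part on U and makes the sum
  -- equivariant.
  let asm : (W →L[ℂ] U) × (W →L[ℂ] W) → (V →L[ℂ] V) := fun y => half y + σ (half y)
  have hasmv : ∀ y v, asm y v = s.i₁ (y.2 (s.p₁ v)) + s.i₂ (y.1 (s.p₁ v)) +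
      (ε : ℂ) • τ 0 (s.i₁ (y.2 (s.p₁ (τ 0 v))) + s.i₂ (y.1 (s.p₁ (τ 0 v)))) := fun _ _ => rfl
  have hasm : ContDiff ℝ ω asm := by
    have h3 : ContDiff ℝ ω half := by
      have : ContDiff ℂ ω half := by
        simp only [half]
        fun_prop
      exact this.restrict_scalars ℝ
    exact h3.add ((σ.toAddMonoidHom.toRealLinearMap hσc).contDiff.comp h3)
  have hsplit : ContDiff ℝ ω fun Z : V →L[ℂ] V => (s.p₂.comp (Z.comp s.i₁), a Z) := by
    have : ContDiff ℂ ω fun Z : V →L[ℂ] V => (s.p₂.comp (Z.comp s.i₁), a Z) := by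
      simp only [ha]
      fun_prop
    exact this.restrict_scalars ℝ
  have hrr : ContDiffAt ℝ ω rr X := hsplit.contDiffAt.comp X hr
  have hsplit_asm : ∀ y, (s.p₂.comp ((asm y).comp s.i₁), a (asm y)) = y := by
    intro y
    refine Prod.ext ?_ ?_ <;> ext x <;>
      simp [hasmv, ha, s.p₁_i₁, s.p₂_i₁, s.p₁_i₂, s.p₂_i₂, h₁]
  have hasmS : ∀ y, asm y ∈ equivariantMaps τ τ := fun y => by
    rw [hσS]
    simp only [asm, map_add, hσσ]
    exact add_comm _ _
  have hasm_split : ∀ Z ∈ equivariantMaps τ τ, asm (s.p₂.comp (Z.comp s.i₁), a Z) = Z := by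
    intro Z hZ
    ext v
    have h3 : Z v = Z (s.i₁ (s.p₁ v)) + Z (s.i₂ (s.p₂ v)) := by rw [← map_add, s.sum_eq]
    rw [hasmv, h3, ← s.conj_projection hε (hτ 0) h₁ h₂ v, map_smul, (hS Z).1 hZ]
    simp only [ha, ContinuousLinearMap.comp_apply, s.sum_eq]
  have hasmX : asm (rr X) = X := (hasm_split (r X) (by rwa [hrX])).trans hrX
  have hrrX : (rr X).2 = A := by
    change a (r X) = A
    rw [hrX, haX]
  have hXM : X ∈ M := by
    refine ⟨hGr.self_of_nhds, by rwa [hrX], ?_, hdisj.self_of_nhds⟩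
    rw [hrX, haX]; exact hMA.1
  have hN : IsSubmanifoldAt (((⊤ : Submodule ℝ (W →L[ℂ] U)) : Set (W →L[ℂ] U)) ×ˢ MA) (rr X)
      (finrank ℝ (⊤ : Submodule ℝ (W →L[ℂ] U)) + dA) := by
    have : rr X = ((rr X).1, A) := by rw [← hrrX]
    rw [this]
    exact (Submodule.isSubmanifoldAt _ Submodule.mem_top).prod hMA
  refine ⟨M, _, IsSubmanifoldAt.transfer rr (fun y => sliceMap β (asm y)) hN hXM hrr ?_ ?_ ?_,
    ?_, ?_, ?_⟩
  · exact ((contDiff_sliceMap β).comp hasm).contDiffAt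
  · have h1 : Tendsto asm (𝓝 (rr X)) (𝓝 X) := by
      have := hasm.continuous.tendsto (rr X)
      rwa [hasmX] at this
    have h3 : ∀ᶠ y in 𝓝 (rr X), ∀ μ, nul (a (asm y)) μ = 0 ∨ nul (b (asm y)) μ = 0 := by
      have hc : Tendsto (fun Z => (a Z, b Z)) (𝓝 X) (𝓝 (A, D)) := by
        have := (hac.prodMk hbc).tendsto X
        rwa [haX, hbX] at this
      exact (hc.comp h1).eventually (eventually_nullity_eq_zero_or hAD)
    filter_upwards [h1.eventually hrG, h3] with y hy hy2 hyN
    have hsy := hsplit_asm y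
    have hsa : a (asm y) = y.2 := congrArg (fun z => z.2) hsy
    constructor
    · refine ⟨by rw [hy], by rw [hy]; exact hasmS y, ?_, ?_⟩
      · rw [hy, hsa]; exact hyN.2
      · rwa [hy]
    · simp only [rr, hy]
      exact hsy
  · refine Eventually.of_forall fun Y hY => ?_
    obtain ⟨hY1, hYS, hYA, -⟩ := hY
    refine ⟨⟨trivial, hYA⟩, ?_⟩
    rw [show asm (rr Y) = r Y from hasm_split (r Y) hYS, hY1]
  · have h3 := (s.swapEquiv hε (hτ 0) h₁ h₂).finrank_eq
    rw [finrank_real_of_complex, finrank_real_of_complex] at h3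
    have h4 : finrank ℂ U = finrank ℂ W := by omega
    rw [hnulX, spectralSum_nul_add (eigenCodim_zero J) hAD,
      spectralSum_nul_of_conj (eigenCodim_conj J) hconjX, s.finrank_eq, finrank_top,
      finrank_real_continuousLinearMap, h4]
    linear_combination 2 * hdimA
  · rintro Y ⟨hY1, hYS, hYA, hYdisj⟩
    have hnY : nul Y = nul (a (r Y)) + nul (b (r Y)) := by rw [← hnul, hY1]
    obtain ⟨-, hAim, hAt⟩ := hMA' _ hYA
    refine ⟨hY1 ▸ hGS _ hYS, ?_, ?_⟩
    · intro μ hμ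
      rcases hYdisj μ with h | h
      · rw [← Complex.conj_re]
        refine hAim _ fun h0 => hμ ?_
        rw [hnY, Pi.add_apply, h, hconj _ hYS]
        simp only [h0, add_zero]
      · refine hAim μ fun h0 => hμ ?_
        rw [hnY, Pi.add_apply, h, h0, add_zero]
    · rw [hnY, hnulX]
      refine spectralType_add hAD hYdisj hAt ?_
      rw [spectralType_of_conj J (hconj _ hYS), spectralType_of_conj J hconjX, hAt]
  · filter_upwards [hGr, hrS, hdisj, har.eventually hevA] with Y hY1 hYS' hYdisj hYA hYS hYim
    have hrYS := hYS' hYS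
    have hnY : nul Y = nul (a (r Y)) + nul (b (r Y)) := by rw [← hnul, hY1]
    have hYA1 := hYA (fun t => Fin.elim0 t)
      (fun μ hμ => hYim μ (by
        rw [hnY]; intro h0
        exact hμ (funext fun j => by have := congrFun h0 j; simp at this; exact this.1)))
    have hcY := hconj _ hrYS
    rw [hnY, hnulX]
    simp only [spectralSum_nul_add eigenCount_zero hAD, spectralSum_nul_add eigenCount_zero hYdisj,
      spectralSum_nul_add (eigenTotal_zero J) hAD, spectralSum_nul_add (eigenTotal_zero J) hYdisj,
      spectralSum_nul_of_conj (F := eigenCount) (fun _ => rfl) hcY,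
      spectralSum_nul_of_conj (F := eigenTotal J) (fun _ => rfl) hcY,
      spectralSum_nul_of_conj (F := eigenCount) (fun _ => rfl) hconjX,
      spectralSum_nul_of_conj (F := eigenTotal J) (fun _ => rfl) hconjX, Pi.add_apply]
    rw [hconjX, hcY]
    simp only [map_zero]
    -- Both blocks have the same invariants, and conjugation fixes the eigenvalue 0, so each total
    -- is twice the value for the first block.
    refine ⟨add_le_add hYA1.1 hYA1.1, fun hz hc => ?_⟩
    obtain ⟨hA1, hA2⟩ := hYA1.2 (by omega) (by omega)
    exact ⟨add_le_add hA1 hA1, fun ht => ⟨hY1, hrYS, hA2 (by omega), hYdisj⟩⟩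

end ConjugateBlocks

/-! ### Local strata in general, by splitting off eigenvalues -/

section LocalStructure

open Module

universe u

variable {κ : ℕ} {V : Type u} [NormedAddCommGroup V] [NormedSpace ℂ V] [FiniteDimensional ℂ V]

theorem nul_eq_zero_of_forall {X : V →L[ℂ] V} {μ : ℂ}
    (h : ∀ v, X v = μ • v → v = 0) : nul X μ = 0 := by
  refine nullity_eq_zero_of_not_hasEigenvalue fun hμ => ?_
  obtain ⟨v, hv⟩ := hμ.exists_hasEigenvector
  exact hv.2 (h v hv.apply_eq_smul)

theorem finrank_ne_zero_of_nul_ne_zero {X : V →L[ℂ] V} {μ : ℂ} (h : nul X μ ≠ 0) :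
    finrank ℂ V ≠ 0 := fun h0 => h <| funext fun j =>
  Nat.eq_zero_of_le_zero ((nullity_le_finrank (X : V →ₗ[ℂ] V) μ j).trans h0.le)

/-- The Fitting decomposition of an endomorphism commuting with `X`. -/
theorem exists_fitting_splitting {ε : ℝ} {τ : Fin κ → V →L⋆[ℂ] V} (hτ : IsConjStructure ε τ)
    (X f : V →L[ℂ] V) (hfX : ∀ v, f (X v) = X (f v)) {φ : ℂ → ℂ}
    (hφ : ∀ μ v, X v = μ • v → f v = φ μ • v) (hf : f ∈ equivariantMaps τ τ) :
    ∃ (K L : Submodule ℂ V) (s : Splitting V K L) (τ₁ : Fin κ → K →L⋆[ℂ] K)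
      (τ₂ : Fin κ → L →L⋆[ℂ] L) (A : K →L[ℂ] K) (D : L →L[ℂ] L),
      IsConjStructure ε τ₁ ∧ IsConjStructure ε τ₂ ∧ s.IsEquivariant τ τ₁ τ₂ ∧
      X = s.diag A D ∧ (∀ μ, φ μ ≠ 0 → nul A μ = 0) ∧ ∀ μ, φ μ = 0 → nul D μ = 0 := by
  -- N ≥ 1 ensures that vectors killed by f lie in ker f^N; this gives the claim about D.
  obtain ⟨N, hN, hc⟩ := ((eventually_ge_atTop 1).and
    (LinearMap.eventually_isCompl_ker_pow_range_pow (f : V →ₗ[ℂ] V))).exists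
  set F : V →ₗ[ℂ] V := (f : V →ₗ[ℂ] V) ^ N with hF
  have hpow : ∀ g : V → V, (∀ v, f (g v) = g (f v)) → ∀ v, F (g v) = g (F v) := by
    intro g hg
    have : ∀ k v, ((f : V →ₗ[ℂ] V) ^ k) (g v) = g (((f : V →ₗ[ℂ] V) ^ k) v) := by
      intro k
      induction k with
      | zero => intro v; simp
      | succ k ih =>
        intro v
        rw [pow_succ', Module.End.mul_apply, Module.End.mul_apply, ih]
        exact hg _
    exact this N
  have hker : ∀ g : V → V, g 0 = 0 → (∀ v, f (g v) = g (f v)) →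
      ∀ v ∈ LinearMap.ker F, g v ∈ LinearMap.ker F := by
    intro g h0 hg v hv
    rw [LinearMap.mem_ker] at hv ⊢
    rw [hpow g hg, hv, h0]
  have hrange : ∀ g : V → V, (∀ v, f (g v) = g (f v)) →
      ∀ v ∈ LinearMap.range F, g v ∈ LinearMap.range F := by
    rintro g hg _ ⟨v, rfl⟩
    exact ⟨g v, hpow g hg v⟩
  obtain ⟨τ₁, τ₂, hτ₁, hτ₂, hs⟩ := Splitting.ofIsCompl_isEquivariant hτ hc
    (fun t => hker (τ t) (map_zero _) (hf t)) (fun t => hrange (τ t) (hf t))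
  let A : LinearMap.ker F →L[ℂ] LinearMap.ker F :=
    (X.comp (LinearMap.ker F).subtypeL).codRestrict _ fun v => hker X (map_zero _) hfX v v.2
  let D : LinearMap.range F →L[ℂ] LinearMap.range F :=
    (X.comp (LinearMap.range F).subtypeL).codRestrict _ fun v => hrange X hfX v v.2
  refine ⟨_, _, Splitting.ofIsCompl hc, τ₁, τ₂, A, D, hτ₁, hτ₂, hs, ?_, ?_, ?_⟩
  · ext v
    conv_lhs => rw [← (Splitting.ofIsCompl hc).sum_eq v, map_add]
    rfl
  · intro μ hμ
    refine nul_eq_zero_of_forall fun v hv => ?_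
    have hv' : X (v : V) = μ • (v : V) := congrArg Subtype.val hv
    have h1 : ∀ k, ((f : V →ₗ[ℂ] V) ^ k) (v : V) = φ μ ^ k • (v : V) := by
      intro k
      induction k with
      | zero => simp
      | succ k ih =>
        rw [pow_succ', Module.End.mul_apply, ih, map_smul, ContinuousLinearMap.coe_coe,
          hφ μ _ hv', smul_smul, pow_succ]
    have h2 : F (v : V) = 0 := v.2
    have h3 := (h1 N).symm.trans h2
    rw [smul_eq_zero] at h3
    exact Subtype.ext (h3.resolve_left (pow_ne_zero _ hμ))
  · intro μ hμ
    refine nul_eq_zero_of_forall fun v hv => ?_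
    have hv' : X (v : V) = μ • (v : V) := congrArg Subtype.val hv
    have h1 : f (v : V) = 0 := by rw [hφ μ _ hv', hμ, zero_smul]
    have h2 : (v : V) ∈ LinearMap.ker F := by
      obtain ⟨k, rfl⟩ := Nat.exists_eq_add_of_le' hN
      have h3 : ((f : V →ₗ[ℂ] V) ^ (k + 1)) (v : V) = 0 := by
        rw [pow_succ, Module.End.mul_apply, ContinuousLinearMap.coe_coe, h1, map_zero]
      exact h3
    exact Subtype.ext (Submodule.disjoint_def.1 hc.disjoint _ h2 v.2)

/-- An antilinear map intertwining endomorphisms with non-conjugate spectra vanishes. -/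
theorem antilinear_eq_zero_of_intertwines {A : V →L[ℂ] V} {μ : ℂ} (T : V →L⋆[ℂ] V)
    (h : ∀ v, T (A v) = A (T v)) (h1 : ∀ ν, ν ≠ μ → nul A ν = 0) (hμ : starRingEnd ℂ μ ≠ μ)
    (v : V) : T v = 0 := by
  set g := (A : V →ₗ[ℂ] V) - algebraMap ℂ (End ℂ V) μ with hg
  set g' := (A : V →ₗ[ℂ] V) - algebraMap ℂ (End ℂ V) (starRingEnd ℂ μ) with hg'
  have h2 : ∀ k v, (g' ^ k) (T v) = T ((g ^ k) v) := by
    intro k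
    induction k with
    | zero => intro v; simp
    | succ k ih =>
      intro v
      rw [pow_succ, Module.End.mul_apply, pow_succ, Module.End.mul_apply, ← ih]
      congr 1
      simp [hg, hg', Module.algebraMap_end_apply, h]
  have h3 : LinearMap.ker (g ^ finrank ℂ V) = ⊤ :=
    Submodule.eq_top_of_finrank_eq (nullity_eq_finrank_of_forall_ne le_rfl h1)
  have h4 : LinearMap.ker (g' ^ finrank ℂ V) = ⊥ :=
    Submodule.finrank_eq_zero.1 (congrFun (h1 _ hμ) (finrank ℂ V))
  have h5 : T v ∈ LinearMap.ker (g' ^ finrank ℂ V) := by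
    rw [LinearMap.mem_ker, h2, LinearMap.mem_ker.1 (h3 ▸ Submodule.mem_top), map_zero]
  rwa [h4, Submodule.mem_bot] at h5

/-- The generalized eigenspaces of μ and of its conjugate are separated by a complex linear Fitting
decomposition. As μ is not real, the components of τ from either space to itself vanish, so τ
exchanges the two. -/
theorem hasLocalStratum_of_conj_pair {J : ℕ} (hJ : finrank ℂ V ≤ J) {ε : ℝ} (hε : ε * ε = 1)
    {τ : Fin 1 → V →L⋆[ℂ] V} (hτ : IsConjStructure ε τ) {X : V →L[ℂ] V}
    (hX : X ∈ equivariantMaps τ τ) {μ : ℂ} (hμ : μ ≠ 0) (hμre : μ.re = 0) (hXμ : nul X μ ≠ 0)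
    (h0 : ∀ ν, ν ≠ μ → ν ≠ starRingEnd ℂ μ → nul X ν = 0) : HasLocalStratum J τ X := by
  have hconj : starRingEnd ℂ μ ≠ μ := by
    intro h
    exact hμ (Complex.ext hμre (Complex.conj_eq_iff_im.1 h))
  let τ₀ : Fin 0 → V →L⋆[ℂ] V := fun t => Fin.elim0 t
  obtain ⟨K, L, s, τ₁, τ₂, A, D, -, -, -, hXs, hA, hD⟩ :=
    exists_fitting_splitting (τ := τ₀) (ε := ε) (fun t => Fin.elim0 t) X (X - μ • 1)
      (fun v => by simp) (φ := fun ν => ν - μ) (fun ν v hv => by simp [hv, sub_smul])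
      (fun t => Fin.elim0 t)
  have hnX : nul X = nul A + nul D := by rw [hXs]; exact s.nullity_diag A D
  have hA' : ∀ ν, ν ≠ μ → nul A ν = 0 := fun ν hν => hA ν (sub_ne_zero.2 hν)
  have hDμ : nul D μ = 0 := hD μ (sub_self μ)
  have hD' : ∀ ν, ν ≠ starRingEnd ℂ μ → nul D ν = 0 := by
    intro ν hν
    by_cases h : ν = μ
    · rw [h, hDμ]
    · have := h0 ν h hν
      rw [hnX] at this
      funext j
      have := congrFun this j
      simp only [Pi.add_apply, Pi.zero_apply] at this ⊢
      omega
  have hX0 := hX 0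
  have hXi₁ : ∀ x, X (s.i₁ x) = s.i₁ (A x) := fun x => by
    simp [hXs, Splitting.diag, s.p₁_i₁, s.p₂_i₁]
  have hXi₂ : ∀ x, X (s.i₂ x) = s.i₂ (D x) := fun x => by
    simp [hXs, Splitting.diag, s.p₁_i₂, s.p₂_i₂]
  have hXp₁ : ∀ v, s.p₁ (X v) = A (s.p₁ v) := fun x => by
    simp [hXs, Splitting.diag, s.p₁_i₁, s.p₁_i₂]
  have hXp₂ : ∀ v, s.p₂ (X v) = D (s.p₂ v) := fun x => by
    simp [hXs, Splitting.diag, s.p₂_i₁, s.p₂_i₂]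
  have h₁ : ∀ x, s.p₁ (τ 0 (s.i₁ x)) = 0 := fun x =>
    antilinear_eq_zero_of_intertwines (A := A) (s.p₁.comp ((τ 0).comp s.i₁))
      (fun v => by simp [← hXi₁, ← hXp₁, hX0]) hA' hconj x
  have h₂ : ∀ x, s.p₂ (τ 0 (s.i₂ x)) = 0 := fun x =>
    antilinear_eq_zero_of_intertwines (A := D) (s.p₂.comp ((τ 0).comp s.i₂))
      (fun v => by simp [← hXi₂, ← hXp₂, hX0]) hD' (by rw [Complex.conj_conj]; exact hconj.symm) x
  have hAμ : nul A μ ≠ 0 := fun h => hXμ (by rw [hnX, Pi.add_apply, h, hDμ, add_zero])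
  have hK : finrank ℂ K ≠ 0 := finrank_ne_zero_of_nul_ne_zero hAμ
  have hAD : ∀ ν, nul A ν = 0 ∨ nul D ν = 0 := fun ν => by
    by_cases h : ν = μ
    · exact Or.inr (h ▸ hDμ)
    · exact Or.inl (hA' ν h)
  rw [hXs]
  refine hasLocalStratum_of_swap hε hτ τ₁ s h₁ h₂ (hXs ▸ hX) hAD ?_
  exact hasLocalStratum_of_single ((Submodule.finrank_le K).trans hJ) hμ hμre hK hA'

/-- Induction on the dimension: a nonzero eigenvalue, together with its conjugate when κ = 1, is
split off equivariantly until the endomorphism is nilpotent. -/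
theorem hasLocalStratum {J : ℕ} (hJ : finrank ℂ V ≤ J) (hκ : κ ≤ 1) {ε : ℝ} (hε : ε * ε = 1)
    {τ : Fin κ → V →L⋆[ℂ] V} (hτ : IsConjStructure ε τ) {X : V →L[ℂ] V}
    (hX : X ∈ equivariantMaps τ τ) (hXim : ImaginarySupport (nul X)) : HasLocalStratum J τ X := by
  induction hn : finrank ℂ V using Nat.strong_induction_on generalizing V with
  | _ n ih =>
  subst hn
  by_cases h0 : ∀ μ, μ ≠ 0 → nul X μ = 0
  · exact hasLocalStratum_of_nilpotent hJ hκ hε hτ hX h0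
  push Not at h0
  obtain ⟨μ, hμ, hXμ⟩ := h0
  have hμre : μ.re = 0 := hXim μ hXμ
  obtain ⟨f, φ, hfX, hφ, hf, hφμ, hφ'⟩ : ∃ (f : V →L[ℂ] V) (φ : ℂ → ℂ),
      (∀ v, f (X v) = X (f v)) ∧ (∀ ν v, X v = ν • v → f v = φ ν • v) ∧
      f ∈ equivariantMaps τ τ ∧ φ μ = 0 ∧
      ∀ ν, ν ≠ μ → (κ = 1 → ν ≠ starRingEnd ℂ μ) → φ ν ≠ 0 := by
    obtain rfl | rfl : κ = 0 ∨ κ = 1 := by omega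
    · exact ⟨X - μ • 1, fun ν => ν - μ, fun v => by simp, fun ν v hv => by simp [hv, sub_smul],
        fun t => Fin.elim0 t, sub_self μ, fun ν hν _ => sub_ne_zero.2 hν⟩
    -- The product over the conjugate pair has real coefficients as a polynomial in X, so unlike X -
    -- μ it commutes with τ.
    · refine ⟨(X - μ • 1) * (X - starRingEnd ℂ μ • 1), fun ν => (ν - μ) * (ν - starRingEnd ℂ μ),
        fun v => by simp, fun ν v hv => ?_, fun t v => ?_, by simp, fun ν hν hν' => ?_⟩
      · simp only [mul_apply_eq_comp, sub_apply, smul_apply,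
          one_apply_eq_self, hv, map_sub, map_smul]
        module
      · have h1 : ∀ v, X (τ t v) = τ t (X v) := hX t
        simp only [mul_apply_eq_comp, sub_apply, smul_apply,
          one_apply_eq_self, map_sub, map_smul, ContinuousLinearMap.map_smulₛₗ, h1,
          Complex.conj_conj]
        module
      · exact mul_ne_zero (sub_ne_zero.2 hν) (sub_ne_zero.2 (hν' rfl))
  obtain ⟨K, L, s, τ₁, τ₂, A, D, hτ₁, hτ₂, hs, hXs, hA, hD⟩ :=
    exists_fitting_splitting hτ X f hfX hφ hf
  have hnX : nul X = nul A + nul D := by rw [hXs]; exact s.nullity_diag A D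
  have hDμ : nul D μ = 0 := hD μ hφμ
  have hAμ : nul A μ ≠ 0 := fun h => hXμ (by rw [hnX, Pi.add_apply, h, hDμ, add_zero])
  have hK : finrank ℂ K ≠ 0 := finrank_ne_zero_of_nul_ne_zero hAμ
  have hAD : ∀ ν, nul A ν = 0 ∨ nul D ν = 0 := fun ν => by
    by_cases h : φ ν = 0
    · exact Or.inr (hD ν h)
    · exact Or.inl (hA ν h)
  have hAS : A ∈ equivariantMaps τ₁ τ₁ := by
    have : A = s.p₁.comp (X.comp s.i₁) := by
      ext x; simp [hXs, Splitting.diag, s.p₁_i₁, s.p₂_i₁]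
    rw [this]
    exact comp_mem_equivariantMaps hs.p₁ (comp_mem_equivariantMaps hX hs.i₁)
  have hDS : D ∈ equivariantMaps τ₂ τ₂ := by
    have : D = s.p₂.comp (X.comp s.i₂) := by
      ext x; simp [hXs, Splitting.diag, s.p₁_i₂, s.p₂_i₂]
    rw [this]
    exact comp_mem_equivariantMaps hs.p₂ (comp_mem_equivariantMaps hX hs.i₂)
  have hDim : ImaginarySupport (nul D) := by
    intro ν hν
    refine hXim ν fun h => hν (funext fun j => ?_)
    have := congrFun (congrFun hnX ν) j
    rw [h] at this
    simp only [Pi.add_apply, Pi.zero_apply] at this ⊢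
    omega
  have hdim := s.finrank_eq
  have hJK := (Submodule.finrank_le K).trans hJ
  rw [hXs]
  refine hasLocalStratum_diag hκ hε hτ hτ₁ hτ₂ s hs (hXs ▸ hX) hAD ?_
    (ih (finrank ℂ L) (by omega) ((Submodule.finrank_le L).trans hJ) hτ₂ hDS hDim rfl)
  obtain rfl | rfl : κ = 0 ∨ κ = 1 := by omega
  · exact hasLocalStratum_of_single hJK hμ hμre hK fun ν hν => hA ν (hφ' ν hν (by simp))
  · exact hasLocalStratum_of_conj_pair hJK hε hτ₁ hAS hμ hμre hAμ
      fun ν hν hν' => hA ν (hφ' ν hν fun _ => hν')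

end LocalStructure

/-! ### Lower bounds for the codimension and cases of equality -/

section CodimensionBounds

open Module

variable {V : Type*} [AddCommGroup V] [Module ℂ V] [FiniteDimensional ℂ V] {J : ℕ}

/-- The eigenvalues of an endomorphism. -/
noncomputable def eigenvalueFinset (f : End ℂ V) : Finset ℂ := (finite_nullity_ne_zero f).toFinset

theorem mem_eigenvalueFinset {f : End ℂ V} {μ : ℂ} : μ ∈ eigenvalueFinset f ↔ nullity f μ ≠ 0 := by
  simp [eigenvalueFinset]

theorem spectralSum_nullity {F : ℂ → (ℕ → ℕ) → ℕ} (hF : ∀ μ, F μ 0 = 0) (f : End ℂ V) :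
    spectralSum F (nullity f) = ∑ μ ∈ eigenvalueFinset f, F μ (nullity f μ) :=
  spectralSum_eq_sum hF fun _ => mem_eigenvalueFinset.2

theorem sum_nullity_of_subset (f : End ℂ V) (hJ : finrank ℂ V ≤ J) {s : Finset ℂ}
    (hs : eigenvalueFinset f ⊆ s) : ∑ μ ∈ s, nullity f μ J = finrank ℂ V := by
  rw [← finsum_nullity f hJ, finsum_eq_sum_of_support_subset]
  intro μ hμ
  exact hs (mem_eigenvalueFinset.2 fun h => hμ (by simp only [h, Pi.zero_apply]))

theorem sum_nullity (f : End ℂ V) (hJ : finrank ℂ V ≤ J) :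
    ∑ μ ∈ eigenvalueFinset f, nullity f μ J = finrank ℂ V :=
  sum_nullity_of_subset f hJ subset_rfl

theorem sum_nullity_sub (f : End ℂ V) (μ : ℂ) (J : ℕ) :
    ∑ j ∈ Finset.range J, (nullity f μ (j + 1) - nullity f μ j) = nullity f μ J := by
  rw [Finset.sum_range_tsub (nullity_mono f μ), nullity_zero_right, Nat.sub_zero]

theorem nullity_pos_of_mem {f : End ℂ V} (hJ : finrank ℂ V ≤ J) {μ : ℂ}
    (hμ : μ ∈ eigenvalueFinset f) : 1 ≤ nullity f μ J :=
  Nat.one_le_iff_ne_zero.2 fun h =>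
    mem_eigenvalueFinset.1 hμ (nullity_eq_zero_of_eq_zero hJ h)

theorem nullity_le_sum_sq (f : End ℂ V) (μ : ℂ) (J : ℕ) :
    nullity f μ J ≤ ∑ j ∈ Finset.range J, (nullity f μ (j + 1) - nullity f μ j) ^ 2 := by
  rw [← sum_nullity_sub f μ J]
  exact Finset.sum_le_sum fun j _ => Nat.le_self_pow two_ne_zero _

/-- With multiplicity k ≥ 1 one has 2 ∑ w_j² - 1 ≥ 2k - 1 ≥ k; at μ = 0 nothing is subtracted and
the bound is 2k. -/
theorem le_eigenCodim {f : End ℂ V} (hJ : finrank ℂ V ≤ J) {μ : ℂ}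
    (hμ : μ ∈ eigenvalueFinset f) :
    nullity f μ J + (if μ = 0 then nullity f μ J else 0) ≤ eigenCodim J μ (nullity f μ) := by
  have h1 := nullity_pos_of_mem hJ hμ
  have h2 := nullity_le_sum_sq f μ J
  unfold eigenCodim
  split_ifs <;> omega

theorem finrank_add_eq_sum (f : End ℂ V) (hJ : finrank ℂ V ≤ J) :
    finrank ℂ V + nullity f 0 J = ∑ μ ∈ eigenvalueFinset f,
      (nullity f μ J + if μ = 0 then nullity f μ J else 0) := by
  rw [Finset.sum_add_distrib, sum_nullity f hJ, Finset.sum_ite_eq']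
  split_ifs with h
  · rfl
  · rw [mem_eigenvalueFinset, not_not] at h
    rw [h]; rfl

theorem finrank_add_le_spectralSum (f : End ℂ V) (hJ : finrank ℂ V ≤ J) :
    finrank ℂ V + nullity f 0 J ≤ spectralSum (eigenCodim J) (nullity f) := by
  rw [spectralSum_nullity (eigenCodim_zero J), finrank_add_eq_sum f hJ]
  exact Finset.sum_le_sum fun μ hμ => le_eigenCodim hJ hμ

/-- Equality of the sums forces equality at every eigenvalue. For μ ≠ 0 this reads k = 2 ∑ w_j² - 1
≥ 2k - 1, so k ≤ 1. -/
theorem nullity_le_one_of_spectralSum_eq {f : End ℂ V} (hJ : finrank ℂ V ≤ J)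
    (h0 : nullity f 0 J ≤ 1)
    (h : spectralSum (eigenCodim J) (nullity f) = finrank ℂ V + nullity f 0 J) (μ : ℂ) :
    nullity f μ J ≤ 1 := by
  by_cases hμ : μ ∈ eigenvalueFinset f
  · rw [spectralSum_nullity (eigenCodim_zero J), finrank_add_eq_sum f hJ] at h
    have h1 := (Finset.sum_eq_sum_iff_of_le fun μ hμ => le_eigenCodim hJ hμ).1 h.symm μ hμ
    have h2 := nullity_le_sum_sq f μ J
    by_cases hz : μ = 0
    · rwa [hz]
    · simp only [eigenCodim, if_neg hz] at h1
      omega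
  · rw [mem_eigenvalueFinset, not_not] at hμ
    rw [hμ]; exact Nat.zero_le _

theorem spectralType_of_nullity_le_one {f : End ℂ V} (hJ : finrank ℂ V ≤ J)
    (h : ∀ μ, nullity f μ J ≤ 1) :
    spectralType J (nullity f) = ⟨nullity f 0 J, finrank ℂ V, J * finrank ℂ V,
      finrank ℂ V + nullity f 0 J⟩ := by
  have h1 : ∀ μ ∈ eigenvalueFinset f, ∀ j < J, nullity f μ (j + 1) = 1 := by
    intro μ hμ j hj
    have h2 : nullity f μ 1 ≠ 0 :=
      (nullity_one_ne_zero_iff f μ).2 ((nullity_ne_zero_iff f μ).1 (mem_eigenvalueFinset.1 hμ))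
    have h3 := nullity_mono f μ (show 1 ≤ j + 1 by omega)
    have h4 := nullity_mono f μ (show j + 1 ≤ J by omega)
    have h5 := h μ
    omega
  have hJ1 : ∀ μ ∈ eigenvalueFinset f, nullity f μ J = 1 := fun μ hμ =>
    le_antisymm (h μ) (nullity_pos_of_mem hJ hμ)
  have hsq : ∀ μ, ∑ j ∈ Finset.range J, (nullity f μ (j + 1) - nullity f μ j) ^ 2 =
      nullity f μ J := by
    intro μ
    rw [← sum_nullity_sub f μ J]
    refine Finset.sum_congr rfl fun j hj => ?_
    have h4 := nullity_mono f μ (show j + 1 ≤ J by simpa using hj)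
    have h5 := h μ
    obtain h6 | h6 : nullity f μ (j + 1) - nullity f μ j = 0 ∨
      nullity f μ (j + 1) - nullity f μ j = 1 := by omega
    all_goals rw [h6]; rfl
  rw [spectralType, SpectralType.mk.injEq]
  refine ⟨rfl, ?_, ?_, ?_⟩
  · rw [spectralSum_nullity eigenCount_zero, ← sum_nullity f hJ]
    refine Finset.sum_congr rfl fun μ hμ => ?_
    have h2 : nullity f μ 1 ≠ 0 :=
      (nullity_one_ne_zero_iff f μ).2 ((nullity_ne_zero_iff f μ).1 (mem_eigenvalueFinset.1 hμ))
    rw [hJ1 μ hμ, eigenCount, if_neg h2]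
  · rw [spectralSum_nullity (eigenTotal_zero J), ← sum_nullity f hJ, Finset.mul_sum]
    refine Finset.sum_congr rfl fun μ hμ => ?_
    rw [eigenTotal, Finset.sum_range_succ', nullity_zero_right, add_zero,
      Finset.sum_congr rfl fun j hj => h1 μ hμ j (by simpa using hj), hJ1 μ hμ]
    simp
  · rw [spectralSum_nullity (eigenCodim_zero J), finrank_add_eq_sum f hJ]
    refine Finset.sum_congr rfl fun μ hμ => ?_
    rw [eigenCodim, hsq, hJ1 μ hμ]
    split_ifs <;> rfl

/-- As many distinct eigenvalues as the dimension leave room for no others and for no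
multiplicities. -/
theorem nullity_le_one_of_eigenvalues {f : End ℂ V} (hJ : finrank ℂ V ≤ J) {ι : Type*} [Fintype ι]
    (hι : Fintype.card ι = finrank ℂ V) {d : ι → ℂ} (hd : Function.Injective d)
    (h : ∀ i, f.HasEigenvalue (d i)) (μ : ℂ) :
    nullity f μ J ≤ 1 ∧ (nullity f μ ≠ 0 → ∃ i, d i = μ) := by
  classical
  set s := Finset.univ.image d with hs
  have hcard : s.card = finrank ℂ V := by
    rw [hs, Finset.card_image_of_injective _ hd, Finset.card_univ, hι]
  have hsub : s ⊆ eigenvalueFinset f := by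
    intro ν hν
    obtain ⟨i, -, rfl⟩ := Finset.mem_image.1 hν
    exact mem_eigenvalueFinset.2 ((nullity_ne_zero_iff f _).2 (h i))
  have h1 := sum_nullity f hJ
  have h2 : (eigenvalueFinset f).card ≤ finrank ℂ V := by
    rw [← h1, Finset.card_eq_sum_ones]
    exact Finset.sum_le_sum fun μ hμ => nullity_pos_of_mem hJ hμ
  have h3 : s = eigenvalueFinset f := Finset.eq_of_subset_of_card_le hsub (h2.trans hcard.ge)
  constructor
  · by_cases hμ : μ ∈ eigenvalueFinset f
    · have h4 : ∑ μ ∈ eigenvalueFinset f, 1 = ∑ μ ∈ eigenvalueFinset f, nullity f μ J := by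
        rw [h1, ← Finset.card_eq_sum_ones, ← h3, hcard]
      exact ((Finset.sum_eq_sum_iff_of_le fun μ hμ => nullity_pos_of_mem hJ hμ).1 h4 μ hμ).ge
    · rw [mem_eigenvalueFinset, not_not] at hμ
      rw [hμ]; exact Nat.zero_le _
  · intro hμ
    have h4 : μ ∈ s := h3 ▸ mem_eigenvalueFinset.2 hμ
    obtain ⟨i, -, hi⟩ := Finset.mem_image.1 h4
    exact ⟨i, hi⟩

theorem spectralSum_le_mul_finrank {F : ℂ → (ℕ → ℕ) → ℕ} (hF : ∀ μ, F μ 0 = 0) {f : End ℂ V}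
    (hJ : finrank ℂ V ≤ J) {C : ℕ}
    (h : ∀ μ ∈ eigenvalueFinset f, F μ (nullity f μ) ≤ C * nullity f μ J) :
    spectralSum F (nullity f) ≤ C * finrank ℂ V := by
  rw [spectralSum_nullity hF, ← sum_nullity f hJ, Finset.mul_sum]
  exact Finset.sum_le_sum h

theorem spectralSum_eigenCount_le (f : End ℂ V) (hJ : finrank ℂ V ≤ J) :
    spectralSum eigenCount (nullity f) ≤ finrank ℂ V := by
  refine (spectralSum_le_mul_finrank (C := 1) eigenCount_zero hJ fun μ hμ => ?_).trans
    (one_mul _).le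
  have := nullity_pos_of_mem hJ hμ
  unfold eigenCount
  split_ifs <;> omega

theorem spectralSum_eigenTotal_le (f : End ℂ V) (hJ : finrank ℂ V ≤ J) :
    spectralSum (eigenTotal J) (nullity f) ≤ (J + 1) * finrank ℂ V := by
  refine spectralSum_le_mul_finrank (eigenTotal_zero J) hJ fun μ _ => ?_
  refine (Finset.sum_le_card_nsmul _ _ (nullity f μ J) fun j hj => ?_).trans (by simp)
  exact nullity_mono f μ (by simpa [Nat.lt_succ_iff] using hj)

/-- The multiplicity of zero has the parity of the dimension if the other eigenvalues are
imaginary and come in conjugate pairs. -/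
theorem nullity_zero_mod_two {f : End ℂ V} (hJ : finrank ℂ V ≤ J)
    (hf : ImaginarySupport (nullity f)) (hc : ∀ μ, nullity f (starRingEnd ℂ μ) = nullity f μ) :
    nullity f 0 J % 2 = finrank ℂ V % 2 := by
  have h1 : ∑ μ ∈ (eigenvalueFinset f).erase 0, (nullity f μ J : ZMod 2) = 0 := by
    refine Finset.sum_involution (fun μ _ => starRingEnd ℂ μ) (fun μ _ => ?_) (fun μ hμ _ h => ?_)
      (fun μ hμ => ?_) (fun μ _ => Complex.conj_conj μ)
    · rw [hc]; exact CharTwo.add_self_eq_zero _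
    · rw [Finset.mem_erase, mem_eigenvalueFinset] at hμ
      exact hμ.1 (Complex.ext (hf μ hμ.2) (Complex.conj_eq_iff_im.1 h))
    · rw [Finset.mem_erase, mem_eigenvalueFinset] at hμ ⊢
      rw [hc]
      exact ⟨(map_ne_zero _).2 hμ.1, hμ.2⟩
  have h2 : finrank ℂ V = nullity f 0 J + ∑ μ ∈ (eigenvalueFinset f).erase 0, nullity f μ J := by
    rw [← Finset.sum_insert (f := fun μ => nullity f μ J) (Finset.notMem_erase _ _),
      sum_nullity_of_subset f hJ]
    exact Finset.insert_erase_subset _ _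
  have h3 : ((finrank ℂ V : ℕ) : ZMod 2) = (nullity f 0 J : ℕ) := by
    rw [h2, Nat.cast_add, Nat.cast_sum, h1, add_zero]
  exact ((ZMod.natCast_eq_natCast_iff' _ _ 2).1 h3).symm

theorem eigenCodim_eq_of_nilpotent {f : End ℂ V} (hJ : finrank ℂ V ≤ J)
    (hf : nullity f 0 J = finrank ℂ V) : spectralSum (eigenCodim J) (nullity f) =
      2 * ∑ j ∈ Finset.range J, (nullity f 0 (j + 1) - nullity f 0 j) ^ 2 := by
  rw [spectralSum_of_forall_ne (eigenCodim_zero J) 0 fun ν hν => nullity_eq_zero_of_ne hJ hf hν]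
  simp [eigenCodim]

theorem mul_le_sq_of_dvd {a m : ℕ} (h : a ∣ m) : a * m ≤ m ^ 2 := by
  obtain ⟨c, rfl⟩ := h
  rcases Nat.eq_zero_or_pos c with rfl | hc
  · simp
  · rw [sq]
    exact Nat.mul_le_mul_right _ (Nat.le_mul_of_pos_right _ hc)

/-- Each increment w_j is a multiple of a, so w_j² ≥ a w_j, and the w_j add up to the dimension. -/
theorem two_mul_finrank_le_spectralSum {f : End ℂ V} (hJ : finrank ℂ V ≤ J)
    (hf : nullity f 0 J = finrank ℂ V) {a : ℕ} (ha : ∀ j, a ∣ nullity f 0 j) :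
    2 * a * finrank ℂ V ≤ spectralSum (eigenCodim J) (nullity f) := by
  rw [eigenCodim_eq_of_nilpotent hJ hf, ← hf, ← sum_nullity_sub f 0 J, mul_assoc,
    Finset.mul_sum _ _ a]
  refine Nat.mul_le_mul_left 2 (Finset.sum_le_sum fun j _ => ?_)
  exact mul_le_sq_of_dvd (Nat.dvd_sub (ha _) (ha _))

/-- Every increment is at most the first one, hence at most a; being a multiple of a, it is 0 or a.
-/
theorem spectralSum_eq_of_nullity_one_le {f : End ℂ V} (hJ : finrank ℂ V ≤ J)
    (hf : nullity f 0 J = finrank ℂ V) {a : ℕ} (ha : ∀ j, a ∣ nullity f 0 j)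
    (h1 : nullity f 0 1 ≤ a) :
    spectralSum (eigenCodim J) (nullity f) = 2 * a * finrank ℂ V := by
  rw [eigenCodim_eq_of_nilpotent hJ hf, ← hf, ← sum_nullity_sub f 0 J, mul_assoc,
    Finset.mul_sum _ _ a]
  congr 1
  refine Finset.sum_congr rfl fun j _ => ?_
  have h2 := nullity_succ_le f 0 j
  obtain ⟨c, hc⟩ := Nat.dvd_sub (ha (j + 1)) (ha j)
  have h3 : a * c ≤ a * 1 := by omega
  rcases Nat.eq_zero_or_pos a with rfl | ha'
  · simp [hc]
  · have h4 : c ≤ 1 := Nat.le_of_mul_le_mul_left h3 ha'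
    rw [hc]
    obtain rfl | rfl : c = 0 ∨ c = 1 := by omega
    · simp
    · simp [sq]

/-- Equality forces w_j² = a w_j, so every increment is 0 or a. After the first increment 0 the
kernels are stationary and fill the whole space. -/
theorem nullity_eq_min_of_spectralSum_eq {f : End ℂ V} (hJ : finrank ℂ V ≤ J)
    (hf : nullity f 0 J = finrank ℂ V) {a : ℕ} (ha' : 0 < a) (ha : ∀ j, a ∣ nullity f 0 j)
    (h : spectralSum (eigenCodim J) (nullity f) = 2 * a * finrank ℂ V) (j : ℕ) :
    nullity f 0 j = min (a * j) (finrank ℂ V) := by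
  have hD : ∀ j, nullity f 0 (j + 1) = nullity f 0 j ∨ nullity f 0 (j + 1) = nullity f 0 j + a := by
    intro j
    have hm : nullity f 0 j ≤ nullity f 0 (j + 1) := nullity_mono f 0 (Nat.le_succ j)
    rcases lt_or_ge j J with hj | hj
    · rw [eigenCodim_eq_of_nilpotent hJ hf, ← hf, ← sum_nullity_sub f 0 J, mul_assoc,
        Finset.mul_sum _ _ a] at h
      have h1 := (Finset.sum_eq_sum_iff_of_le fun j _ =>
        mul_le_sq_of_dvd (Nat.dvd_sub (ha (j + 1)) (ha j))).1
          (Nat.eq_of_mul_eq_mul_left two_pos h).symm j (Finset.mem_range.2 hj)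
      rw [sq] at h1
      rcases Nat.eq_zero_or_pos (nullity f 0 (j + 1) - nullity f 0 j) with h2 | h2
      · left; omega
      · right
        have := Nat.eq_of_mul_eq_mul_right h2 h1
        omega
    · left
      rw [nullity_eq_of_finrank_le f 0 (hJ.trans hj),
        nullity_eq_of_finrank_le f 0 (hJ.trans (hj.trans (Nat.le_succ j)))]
  induction j with
  | zero => simp
  | succ j ih =>
    have hN := nullity_le_finrank f 0 (j + 1)
    rw [Nat.mul_succ]
    rcases hD j with h1 | h1
    · have h2 := nullity_eq_of_stationary h1 J
      have h3 := nullity_mono f 0 (Nat.le_add_left J j)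
      have h4 := nullity_le_finrank f 0 (j + J)
      omega
    · omega

end CodimensionBounds

/-! ### Global stratification by spectral type -/

section Stratification

open Module

universe u

variable {κ : ℕ} {V : Type u} [NormedAddCommGroup V] [NormedSpace ℂ V] [FiniteDimensional ℂ V]

theorem finite_setOf_spectralType_bounded (B : ℕ) :
    {t : SpectralType | t.zeroMult ≤ B ∧ t.count ≤ B ∧ t.total ≤ B ∧ t.codim ≤ B}.Finite := by
  refine ((Set.finite_Iic ((B, B, B, B) : ℕ × ℕ × ℕ × ℕ)).image
    fun q => SpectralType.mk q.1 q.2.1 q.2.2.1 q.2.2.2).subset ?_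
  rintro ⟨p, q, r, s⟩ h
  exact ⟨(p, q, r, s), ⟨h.1, h.2.1, h.2.2.1, h.2.2.2⟩, rfl⟩

variable {𝒜 : Type*} [NormedRing 𝒜] [NormedAlgebra ℝ 𝒜] [FiniteDimensional ℝ 𝒜]

omit [FiniteDimensional ℂ V] [FiniteDimensional ℝ 𝒜] in
theorem nul_conj_unit (L : 𝒜 →ₐ[ℝ] (V →L[ℂ] V)) (X : 𝒜) (C : 𝒜ˣ) :
    nul (L ((C : 𝒜) * X * ((C⁻¹ : 𝒜ˣ) : 𝒜))) = nul (L X) := by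
  have h1 : ∀ v, L ((C⁻¹ : 𝒜ˣ) : 𝒜) (L (C : 𝒜) v) = v := fun v => by
    rw [← mul_apply_eq_comp, ← map_mul, Units.inv_mul, map_one, one_apply_eq_self]
  have h2 : ∀ v, L (C : 𝒜) (L ((C⁻¹ : 𝒜ˣ) : 𝒜) v) = v := fun v => by
    rw [← mul_apply_eq_comp, ← map_mul, Units.mul_inv, map_one, one_apply_eq_self]
  refine (nullity_eq_of_equiv _ _ (LinearEquiv.ofLinearMap (L (C : 𝒜) : V →ₗ[ℂ] V)
    (L ((C⁻¹ : 𝒜ˣ) : 𝒜) : V →ₗ[ℂ] V) (LinearMap.ext h2) (LinearMap.ext h1)) fun v => ?_).symm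
  change L (C : 𝒜) (L X v) = L (C * X * ((C⁻¹ : 𝒜ˣ) : 𝒜)) (L (C : 𝒜) v)
  rw [map_mul, map_mul, mul_apply_eq_comp, mul_apply_eq_comp, h1]

/-- Stratification by spectral types of a set of matrices with imaginary spectrum. -/
theorem isDisjointUnionOfSubmanifolds_of_spectralType (hκ : κ ≤ 1) {ε : ℝ} (hε : ε * ε = 1)
    {τ : Fin κ → V →L⋆[ℂ] V} (hτ : IsConjStructure ε τ) (L : 𝒜 →ₐ[ℝ] (V →L[ℂ] V))
    (hL : Function.Injective L) (hLτ : ∀ f, f ∈ equivariantMaps τ τ ↔ ∃ X, L X = f)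
    (P : SpectralType → Prop) {S : Set 𝒜}
    (hS : ∀ X, X ∈ S ↔ ImaginarySupport (nul (L X)) ∧
      P (spectralType (finrank ℂ V) (nul (L X)))) {b : ℕ}
    (hb : ∀ X ∈ S, (1 + κ) * b ≤ spectralSum (eigenCodim (finrank ℂ V)) (nul (L X)))
    {X₁ : 𝒜} (hX₁ : X₁ ∈ S)
    (hX₁b : spectralSum (eigenCodim (finrank ℂ V)) (nul (L X₁)) = (1 + κ) * b)
    (huniq : ∀ X ∈ S, spectralSum (eigenCodim (finrank ℂ V)) (nul (L X)) = (1 + κ) * b →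
      spectralType (finrank ℂ V) (nul (L X)) = spectralType (finrank ℂ V) (nul (L X₁))) :
    IsDisjointUnionOfSubmanifolds S b := by
  set N := finrank ℂ V with hN
  let ty : 𝒜 → SpectralType := fun X => spectralType N (nul (L X))
  have hLc : ContDiff ℝ ω L := L.toLinearMap.toContinuousLinearMap.contDiff
  obtain ⟨ψ, hψ⟩ := L.toLinearMap.exists_leftInverse_of_injective
    (LinearMap.ker_eq_bot.2 hL)
  have hψ' : ∀ X, ψ (L X) = X := fun X => LinearMap.congr_fun hψ X
  have hψc : ContDiff ℝ ω ψ := ψ.toContinuousLinearMap.contDiff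
  have hF : (1 + κ) * finrank ℝ 𝒜 = 2 * (N * N) := by
    rw [← finrank_equivariantMaps hκ hε hτ hτ]
    have : LinearMap.range L.toLinearMap = equivariantMaps τ τ :=
      Submodule.ext fun f => (hLτ f).symm
    rw [← this, LinearMap.finrank_range_of_inj hL]
  have hlocal : ∀ X ∈ S, ∃ d, IsSubmanifoldAt {Y | Y ∈ S ∧ ty Y = ty X} X d ∧
      (1 + κ) * d + (ty X).codim = (1 + κ) * finrank ℝ 𝒜 := by
    intro X hX
    obtain ⟨M, d, hM, hd, hM1, hM2⟩ := hasLocalStratum (J := N) le_rfl hκ hε hτ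
      ((hLτ _).2 ⟨X, rfl⟩) ((hS X).1 hX).1
    refine ⟨d, IsSubmanifoldAt.transfer L ψ hM ⟨hX, rfl⟩ hLc.contDiffAt hψc.contDiffAt ?_ ?_,
      hd.trans hF.symm⟩
    · refine Eventually.of_forall fun y hy => ?_
      obtain ⟨hy1, hy2, hy3⟩ := hM1 y hy
      obtain ⟨Z, rfl⟩ := (hLτ y).1 hy1
      rw [hψ']
      refine ⟨⟨(hS Z).2 ⟨hy2, ?_⟩, hy3⟩, rfl⟩
      rw [hy3]
      exact ((hS X).1 hX).2
    · filter_upwards [hLc.continuous.continuousAt.eventually hM2] with Y hY hYS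
      obtain ⟨hYS, hYt⟩ := hYS
      simp only [ty, spectralType, SpectralType.mk.injEq] at hYt
      exact ⟨((hY ((hLτ _).2 ⟨Y, rfl⟩) ((hS Y).1 hYS).1).2 hYt.1 hYt.2.1).2 hYt.2.2.1, hψ' Y⟩
  -- All four entries are bounded in terms of N; the codimension is bounded by 2N² through the
  -- dimension formula.
  have hfin : (ty '' S).Finite := by
    refine (finite_setOf_spectralType_bounded ((N + 1) * N + 2 * (N * N))).subset ?_
    rintro _ ⟨X, hX, rfl⟩
    obtain ⟨d, -, hd⟩ := hlocal X hX
    have h1 : nul (L X) 0 N ≤ N := nullity_le_finrank _ _ _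
    have h2 : spectralSum eigenCount (nul (L X)) ≤ N := spectralSum_eigenCount_le _ le_rfl
    have h3 : spectralSum (eigenTotal N) (nul (L X)) ≤ (N + 1) * N :=
      spectralSum_eigenTotal_le _ le_rfl
    have h4 : N ≤ (N + 1) * N := Nat.le_mul_of_pos_left _ (Nat.succ_pos _)
    exact ⟨by simp only [ty, spectralType]; omega, by simp only [ty, spectralType]; omega,
      by simp only [ty, spectralType]; omega, by omega⟩
  have : Finite (ty '' S) := hfin
  let e := Finite.equivFin (ty '' S)
  -- The division by 1 + κ is exact, by the dimension formula.
  have hcodim : ∀ {k d F : ℕ}, (1 + κ) * d + k = (1 + κ) * F →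
      d + k / (1 + κ) = F ∧ (1 + κ) * (k / (1 + κ)) = k := by
    intro k d F h
    obtain rfl | rfl : κ = 0 ∨ κ = 1 := by omega
    all_goals omega
  refine ⟨_, fun i => {Y | Y ∈ S ∧ ty Y = e.symm i}, fun i => (e.symm i).1.codim / (1 + κ),
    ?_, ?_, ?_, ?_, ?_, ?_, ?_⟩
  · ext X
    simp only [Set.mem_iUnion, Set.mem_ofPred_eq]
    exact ⟨fun ⟨_, h, _⟩ => h, fun h => ⟨e ⟨ty X, X, h, rfl⟩, h,
      by rw [Equiv.symm_apply_apply]⟩⟩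
  · refine fun i j hij => Set.disjoint_left.2 fun X hi hj => hij ?_
    exact e.symm.injective (Subtype.ext (hi.2.symm.trans hj.2))
  · intro i
    obtain ⟨X, hX, hXi⟩ := (e.symm i).2
    exact ⟨X, hX, hXi⟩
  · rintro i X ⟨hX, hXi⟩ C
    have h := nul_conj_unit L X C
    refine ⟨(hS _).2 ?_, ?_⟩
    · rw [h]; exact (hS X).1 hX
    · rw [← hXi]; simp only [ty, h]
  · intro i
    obtain ⟨X, hX, hXi⟩ := (e.symm i).2
    obtain ⟨d, -, hd⟩ := hlocal X hX
    refine isEmbeddedSubmanifoldOfCodim_of_isSubmanifoldAt (d := d) ?_ ?_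
    · simp only [← hXi]; exact (hcodim hd).1
    · rintro Y ⟨hY, hYi⟩
      -- `ty` does not record which block sizes occur at which eigenvalue; its `codim` entry is what
      -- makes the dimension constant along the stratum.
      obtain ⟨d', hM, hd'⟩ := hlocal Y hY
      rw [hYi, ← hXi] at hd'
      have h1 := (hcodim hd).1
      have h2 := (hcodim hd').1
      obtain rfl : d' = d := by omega
      rwa [hYi] at hM
  · intro i
    obtain ⟨X, hX, hXi⟩ := (e.symm i).2
    have h1 := hb X hX
    simp only [← hXi]
    exact (Nat.le_div_iff_mul_le (by omega)).2 (by rw [mul_comm]; exact h1)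
  · refine ⟨e ⟨ty X₁, X₁, hX₁, rfl⟩, ?_, fun i hi => ?_⟩
    · simp only [Equiv.symm_apply_apply]
      exact Nat.div_eq_of_eq_mul_right (by omega) hX₁b
    · obtain ⟨X, hX, hXi⟩ := (e.symm i).2
      obtain ⟨d, -, hd⟩ := hlocal X hX
      simp only [← hXi] at hi
      have h1 := (hcodim hd).2
      rw [hi] at h1
      rw [← e.symm_apply_eq]
      exact Subtype.ext (hXi.symm.trans (huniq X hX h1.symm))

theorem eq_of_nilpotent_of_spectralSum_eq {X Y : V →L[ℂ] V} {a : ℕ} (ha : 0 < a)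
    (hX0 : nul X 0 (finrank ℂ V) = finrank ℂ V) (hY0 : nul Y 0 (finrank ℂ V) = finrank ℂ V)
    (hXa : ∀ j, a ∣ nul X 0 j) (hYa : ∀ j, a ∣ nul Y 0 j)
    (hX : spectralSum (eigenCodim (finrank ℂ V)) (nul X) = 2 * a * finrank ℂ V)
    (hY : spectralSum (eigenCodim (finrank ℂ V)) (nul Y) = 2 * a * finrank ℂ V) :
    nul X = nul Y := by
  funext μ
  by_cases hμ : μ = 0
  · subst hμ
    funext j
    rw [nul, nul, nullity_eq_min_of_spectralSum_eq le_rfl hX0 ha hXa hX,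
      nullity_eq_min_of_spectralSum_eq le_rfl hY0 ha hYa hY]
  · rw [nul, nul, nullity_eq_zero_of_ne le_rfl hX0 hμ, nullity_eq_zero_of_ne le_rfl hY0 hμ]

omit [FiniteDimensional ℝ 𝒜] in
theorem isNilpotent_iff_nul {L : 𝒜 →ₐ[ℝ] (V →L[ℂ] V)} (hL : Function.Injective L) (X : 𝒜) :
    IsNilpotent X ↔ nul (L X) 0 (finrank ℂ V) = finrank ℂ V := by
  rw [← isNilpotent_iff_nullity _ le_rfl, ← IsNilpotent.map_iff hL]
  exact (IsNilpotent.map_iff (f := (ContinuousLinearMap.toLinearMapRingHom :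
    (V →L[ℂ] V) →+* (V →ₗ[ℂ] V))) ContinuousLinearMap.coe_injective).symm

/-- The number a is a common divisor of all kernel dimensions: 1 for real and complex matrices, 2
for quaternionic ones. The witness `f` is a nilpotent with the smallest possible kernel. -/
theorem isDisjointUnionOfSubmanifolds_isNilpotent (hκ : κ ≤ 1) {ε : ℝ} (hε : ε * ε = 1)
    {τ : Fin κ → V →L⋆[ℂ] V} (hτ : IsConjStructure ε τ) (L : 𝒜 →ₐ[ℝ] (V →L[ℂ] V))
    (hL : Function.Injective L) (hLτ : ∀ f, f ∈ equivariantMaps τ τ ↔ ∃ X, L X = f)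
    {a b : ℕ} (ha : 0 < a) (hab : (1 + κ) * b = 2 * a * finrank ℂ V)
    (hdvd : ∀ f ∈ equivariantMaps τ τ, ∀ j, a ∣ nul f 0 j)
    {f : V →L[ℂ] V} (hf : f ∈ equivariantMaps τ τ) (hf0 : ∀ μ, μ ≠ 0 → nul f μ = 0)
    (hf1 : nul f 0 1 ≤ a) :
    IsDisjointUnionOfSubmanifolds {X : 𝒜 | IsNilpotent X} b := by
  obtain ⟨X₁, rfl⟩ := (hLτ f).1 hf
  have hdvd' : ∀ X j, a ∣ nul (L X) 0 j := fun X => hdvd _ ((hLτ _).2 ⟨X, rfl⟩)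
  have hX₁ := nullity_eq_finrank_of_forall_ne (f := (L X₁ : V →ₗ[ℂ] V)) le_rfl hf0
  have hX₁b := spectralSum_eq_of_nullity_one_le le_rfl hX₁ (hdvd' X₁) hf1
  refine isDisjointUnionOfSubmanifolds_of_spectralType hκ hε hτ L hL hLτ
    (fun t => t.zeroMult = finrank ℂ V) (fun X => ?_) (fun X hX => ?_)
    ((isNilpotent_iff_nul hL X₁).2 hX₁) (hX₁b.trans hab.symm) fun X hX h => ?_
  · rw [Set.mem_ofPred_eq, isNilpotent_iff_nul hL]
    refine ⟨fun h => ⟨fun μ hμ => ?_, h⟩, fun h => h.2⟩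
    by_contra h0
    exact hμ (nullity_eq_zero_of_ne le_rfl h (fun h1 => h0 (by rw [h1]; rfl)))
  · rw [hab]
    exact two_mul_finrank_le_spectralSum le_rfl ((isNilpotent_iff_nul hL X).1 hX) (hdvd' X)
  · rw [eq_of_nilpotent_of_spectralSum_eq ha ((isNilpotent_iff_nul hL X).1 hX) hX₁ (hdvd' X)
      (hdvd' X₁) (h.trans hab) hX₁b]

/-- The number m is the multiplicity of 0 that cannot be avoided: n mod 2 for real matrices, 0
otherwise. The witness `f` has simple spectrum and attains it. -/
theorem isDisjointUnionOfSubmanifolds_imaginary (hκ : κ ≤ 1) {ε : ℝ} (hε : ε * ε = 1)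
    {τ : Fin κ → V →L⋆[ℂ] V} (hτ : IsConjStructure ε τ) (L : 𝒜 →ₐ[ℝ] (V →L[ℂ] V))
    (hL : Function.Injective L) (hLτ : ∀ f, f ∈ equivariantMaps τ τ ↔ ∃ X, L X = f)
    {b m : ℕ} (hm : m ≤ 1) (hbm : (1 + κ) * b = finrank ℂ V + m)
    (hle : ∀ f ∈ equivariantMaps τ τ, ImaginarySupport (nul f) → m ≤ nul f 0 (finrank ℂ V))
    {f : V →L[ℂ] V} (hf : f ∈ equivariantMaps τ τ) (hfim : ImaginarySupport (nul f))
    (hf0 : nul f 0 (finrank ℂ V) = m) (hf1 : ∀ μ, nul f μ (finrank ℂ V) ≤ 1) :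
    IsDisjointUnionOfSubmanifolds {X : 𝒜 | ImaginarySupport (nul (L X))} b := by
  obtain ⟨X₁, rfl⟩ := (hLτ f).1 hf
  have htype := spectralType_of_nullity_le_one le_rfl hf1
  have hle' : ∀ X, ImaginarySupport (nul (L X)) → finrank ℂ V + m ≤ finrank ℂ V +
      nul (L X) 0 (finrank ℂ V) := fun X hX =>
    Nat.add_le_add_left (hle _ ((hLτ _).2 ⟨X, rfl⟩) hX) _
  have hle2 : ∀ X, finrank ℂ V + nul (L X) 0 (finrank ℂ V) ≤ _ := fun X =>
    finrank_add_le_spectralSum (L X : V →ₗ[ℂ] V) le_rfl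
  refine isDisjointUnionOfSubmanifolds_of_spectralType hκ hε hτ L hL hLτ
    (fun _ => True) (fun X => by simp) (fun X hX => ?_) hfim ?_ fun X hX h => ?_
  · rw [hbm]
    exact (hle' X hX).trans (hle2 X)
  · rw [hbm, ← hf0]
    exact congrArg SpectralType.codim htype
  · rw [hbm] at h
    have h0 : nul (L X) 0 (finrank ℂ V) = m := by
      have h1 := hle' X hX
      have h2 := hle2 X
      rw [h] at h2
      omega
    have h3 := nullity_le_one_of_spectralSum_eq (f := (L X : V →ₗ[ℂ] V)) le_rfl
      (h0.le.trans hm) (h.trans (by rw [← h0]))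
    rw [htype, nul, spectralType_of_nullity_le_one le_rfl h3]
    change SpectralType.mk (nul (L X) 0 _) _ _ (_ + nul (L X) 0 _) =
      SpectralType.mk (nul (L X₁) 0 _) _ _ (_ + nul (L X₁) 0 _)
    rw [h0, hf0]

end Stratification

/-! ### Parity and conjugation symmetry of kernels -/

section QuaternionicParity

open Module

/-- In a basis, σ is a matrix A followed by conjugation, with A Ā = -1. Taking determinants, |det
A|² = (-1)^dim, so the dimension is even. -/
theorem even_finrank_of_quaternionic {V : Type*} [NormedAddCommGroup V] [NormedSpace ℂ V]
    [FiniteDimensional ℂ V] (σ : V →L⋆[ℂ] V) (hσ : ∀ v, σ (σ v) = -v) : Even (finrank ℂ V) := by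
  let B := finBasis ℂ V
  let A : Matrix (Fin (finrank ℂ V)) (Fin (finrank ℂ V)) ℂ :=
    Matrix.of fun i j => B.repr (σ (B j)) i
  have h1 : ∀ j, σ (B j) = ∑ i, A i j • B i := fun j => (B.sum_repr (σ (B j))).symm
  have h2 : A * A.map (starRingEnd ℂ) = -1 := by
    ext k j
    have h3 : σ (σ (B j)) = ∑ k, (∑ i, A k i * starRingEnd ℂ (A i j)) • B k := by
      rw [h1 j, map_sum]
      simp only [ContinuousLinearMap.map_smulₛₗ, h1, Finset.smul_sum, Finset.sum_smul, smul_smul]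
      rw [Finset.sum_comm]
      exact Finset.sum_congr rfl fun _ _ => Finset.sum_congr rfl fun _ _ => by rw [mul_comm]
    have h4 := congrArg (fun v => B.repr v k) h3
    rw [hσ] at h4
    simp only [B.repr_sum_self, map_neg, Basis.repr_self, Finsupp.coe_neg, Pi.neg_apply] at h4
    rw [Matrix.mul_apply, Matrix.neg_apply, Matrix.one_apply]
    simp only [Matrix.map_apply]
    rw [← h4, Finsupp.single_apply]
    simp only [eq_comm]
  have h3 := congrArg Matrix.det h2
  have h4 : (A.map (starRingEnd ℂ)).det = starRingEnd ℂ A.det := ((starRingEnd ℂ).map_det A).symm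
  rw [Matrix.det_mul, h4, Complex.mul_conj, Matrix.det_neg, Matrix.det_one, mul_one,
    Fintype.card_fin] at h3
  rcases Nat.even_or_odd (finrank ℂ V) with h | h
  · exact h
  · rw [h.neg_one_pow] at h3
    have h5 : Complex.normSq A.det = -1 := by exact_mod_cast h3
    linarith [Complex.normSq_nonneg A.det]

theorem two_dvd_nul {V : Type*} [NormedAddCommGroup V] [NormedSpace ℂ V] [FiniteDimensional ℂ V]
    {σ : V →L⋆[ℂ] V} (hσ : ∀ v, σ (σ v) = -v) {f : V →L[ℂ] V} (hf : ∀ v, f (σ v) = σ (f v))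
    (j : ℕ) : 2 ∣ nul f 0 j := by
  have hinv : ∀ j v, (((f : V →ₗ[ℂ] V) - algebraMap ℂ (End ℂ V) 0) ^ j) (σ v) =
      σ ((((f : V →ₗ[ℂ] V) - algebraMap ℂ (End ℂ V) 0) ^ j) v) := by
    intro j
    induction j with
    | zero => intro v; simp
    | succ j ih =>
      intro v
      rw [pow_succ, Module.End.mul_apply, Module.End.mul_apply, ← ih]
      simp [hf]
  refine (even_finrank_of_quaternionic (restrictConj σ (LinearMap.ker
    (((f : V →ₗ[ℂ] V) - algebraMap ℂ (End ℂ V) 0) ^ j)) fun v hv => ?_) fun v => ?_).two_dvd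
  · rw [LinearMap.mem_ker] at hv ⊢
    rw [hinv, hv, map_zero]
  · exact Subtype.ext (hσ v)

/-- The nullities are invariant under conjugation of the eigenvalue. -/
theorem nul_conj {V : Type*} [NormedAddCommGroup V] [NormedSpace ℂ V] {ε : ℝ} (hε : ε * ε = 1)
    {σ : V →L⋆[ℂ] V} (hσ : ∀ v, σ (σ v) = (ε : ℂ) • v) {f : V →L[ℂ] V}
    (hf : ∀ v, f (σ v) = σ (f v)) (μ : ℂ) : nul f (starRingEnd ℂ μ) = nul f μ := by
  let e : V ≃ₗ[ℝ] V :=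
    { toFun := σ
      map_add' := map_add σ
      map_smul' := fun r v => by
        simp only [← Complex.coe_smul, map_eps_smul, RingHom.id_apply]
      invFun := fun v => (ε : ℂ) • σ v
      left_inv := fun v => by
        change (ε : ℂ) • σ (σ v) = v
        rw [hσ, eps_smul_eps_smul hε]
      right_inv := fun v => by rw [map_eps_smul, hσ, eps_smul_eps_smul hε] }
  have he : ∀ v, e v = σ v := fun _ => rfl
  funext j
  refine (nullity_eq_of_realEquiv _ _ _ _ e (fun v => ?_) j).symm
  rw [he, he, map_sub, ContinuousLinearMap.map_smulₛₗ, ContinuousLinearMap.coe_coe, hf]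

end QuaternionicParity

/-! ### Weighted shifts and matrices acting on coordinate spaces -/

section Coordinates

open Module

variable {ι : Type*} [Fintype ι]

/-- The operator `v ↦ w i * v (π i)`. -/
def weightedComp (w : ι → ℂ) (π : ι → ι) : (ι → ℂ) →L[ℂ] (ι → ℂ) where
  toFun v i := w i * v (π i)
  map_add' u v := by ext i; simp [mul_add]
  map_smul' c v := by ext i; simp; ring
  cont := by fun_prop

/-- The antilinear operator `v ↦ s i * conj (v (ρ i))`. -/
def conjWeightedComp (s : ι → ℝ) (ρ : ι → ι) : (ι → ℂ) →L⋆[ℂ] (ι → ℂ) where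
  toFun v i := s i * starRingEnd ℂ (v (ρ i))
  map_add' u v := by ext i; simp [mul_add]
  map_smul' c v := by ext i; simp; ring
  cont := by fun_prop

omit [Fintype ι] in
@[simp] theorem weightedComp_apply (w : ι → ℂ) (π : ι → ι) (v : ι → ℂ) (i : ι) :
    weightedComp w π v i = w i * v (π i) := rfl

omit [Fintype ι] in
@[simp] theorem conjWeightedComp_apply (s : ι → ℝ) (ρ : ι → ι) (v : ι → ℂ) (i : ι) :
    conjWeightedComp s ρ v i = s i * starRingEnd ℂ (v (ρ i)) := rfl

/-- The eigenvector equation expresses v i through a coordinate of smaller height, so v vanishes by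
induction on the height. -/
theorem nul_weightedComp_of_height {w : ι → ℂ} {π : ι → ι} (h : ι → ℕ)
    (hh : ∀ i, w i ≠ 0 → h (π i) < h i) {μ : ℂ} (hμ : μ ≠ 0) : nul (weightedComp w π) μ = 0 := by
  refine nul_eq_zero_of_forall fun v hv => ?_
  have h1 : ∀ i, w i * v (π i) = μ * v i := fun i => congrFun hv i
  have h2 : ∀ k i, h i = k → v i = 0 := by
    intro k
    induction k using Nat.strong_induction_on with
    | _ k ih =>
      intro i hi
      have h3 : w i * v (π i) = 0 := by
        by_cases hw : w i = 0
        · rw [hw, zero_mul]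
        · rw [ih _ (hi ▸ hh i hw) _ rfl, mul_zero]
      rw [h1] at h3
      exact (mul_eq_zero.1 h3).resolve_left hμ
  exact funext fun i => h2 _ i rfl

/-- A vector in the kernel vanishes at π j whenever w j ≠ 0, so it is determined by its coordinates
in B. -/
theorem nul_weightedComp_one_le {w : ι → ℂ} {π : ι → ι} (B : Finset ι)
    (hB : ∀ i, i ∉ B → ∃ j, w j ≠ 0 ∧ π j = i) : nul (weightedComp w π) 0 1 ≤ B.card := by
  let r : (ι → ℂ) →ₗ[ℂ] (B → ℂ) := LinearMap.funLeft ℂ ℂ Subtype.val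
  have h1 : finrank ℂ (B → ℂ) = B.card := by simp
  rw [← h1]
  refine LinearMap.finrank_le_finrank_of_injective (f := r.domRestrict _) ?_
  refine (injective_iff_map_eq_zero _).2 fun v hv => Subtype.ext (funext fun i => ?_)
  by_cases hi : i ∈ B
  · exact congrFun hv ⟨i, hi⟩
  · obtain ⟨j, hj, rfl⟩ := hB i hi
    have h2 := LinearMap.mem_ker.1 v.2
    have h3 : ((weightedComp w π : (ι → ℂ) →ₗ[ℂ] (ι → ℂ)) - algebraMap ℂ (End ℂ (ι → ℂ)) 0) ^ 1 =
        (weightedComp w π : (ι → ℂ) →ₗ[ℂ] (ι → ℂ)) := by rw [map_zero, sub_zero, pow_one]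
    have h4 : w j * (v : ι → ℂ) (π j) = 0 :=
      congrFun ((LinearMap.congr_fun h3 (v : ι → ℂ)).symm.trans h2) j
    exact (mul_eq_zero.1 h4).resolve_left hj

omit [Fintype ι] in
theorem hasEigenvalue_diagonal [DecidableEq ι] (d : ι → ℂ) (i : ι) :
    End.HasEigenvalue (weightedComp d id : (ι → ℂ) →ₗ[ℂ] (ι → ℂ)) (d i) := by
  refine End.hasEigenvalue_of_hasEigenvector (x := Pi.single i 1)
    ⟨End.mem_eigenspace_iff.2 (funext fun k => ?_), by simp⟩
  by_cases hk : k = i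
  · subst hk; simp
  · simp [hk]

/-- Evaluation of matrices as continuous endomorphisms. -/
noncomputable def matrixToCLM [DecidableEq ι] : Matrix ι ι ℂ ≃ₐ[ℂ] ((ι → ℂ) →L[ℂ] (ι → ℂ)) :=
  Matrix.toLinAlgEquiv'.trans (Module.End.toContinuousLinearMap _)

theorem matrixToCLM_apply [DecidableEq ι] (Z : Matrix ι ι ℂ) (v : ι → ℂ) (i : ι) :
    matrixToCLM Z v i = ∑ j, Z i j * v j := rfl

theorem matrixToCLM_single [DecidableEq ι] (Z : Matrix ι ι ℂ) (i j : ι) :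
    matrixToCLM Z (Pi.single j 1) i = Z i j := by
  rw [matrixToCLM_apply]
  simp [Pi.single_apply]

theorem hasImaginarySpectrum_iff [DecidableEq ι] (Z : Matrix ι ι ℂ) :
    HasImaginarySpectrum Z ↔ ImaginarySupport (nul (matrixToCLM Z)) := by
  have h : ∀ μ, μ ∈ spectrum ℂ Z ↔ nul (matrixToCLM Z) μ ≠ 0 := fun μ => by
    rw [nul, nullity_ne_zero_iff, End.hasEigenvalue_iff_mem_spectrum, ← Matrix.spectrum_toLin']
    rfl
  simp only [HasImaginarySpectrum, ImaginarySupport, h]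

end Coordinates

/-! ### The three matrix algebras and their minimal strata -/

section MatrixAlgebras

open Module

variable {n : ℕ}

/-- The index shift used by a nilpotent Jordan block. -/
def shiftIndex (i : Fin n) : Fin n := if h : i.val + 1 < n then ⟨i.val + 1, h⟩ else i

/-- The weights of a nilpotent Jordan block. -/
def shiftWeight (i : Fin n) : ℂ := if i.val + 1 < n then 1 else 0

theorem conj_shiftWeight (i : Fin n) : starRingEnd ℂ (shiftWeight i) = shiftWeight i := by
  unfold shiftWeight; split_ifs <;> simp

theorem shiftIndex_height (i : Fin n) (hi : shiftWeight i ≠ 0) :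
    n - (shiftIndex i).val < n - i.val := by
  have h : i.val + 1 < n := by
    by_contra h
    exact hi (by rw [shiftWeight, if_neg h])
  rw [shiftIndex, dif_pos h]
  simp only
  omega

/-- The indices outside the image of the shift. -/
def shiftBoundary (n : ℕ) : Finset (Fin n) := Finset.univ.filter fun i => i.val = 0

theorem card_shiftBoundary_le : (shiftBoundary n).card ≤ 1 :=
  Finset.card_le_one.2 fun i hi j hj => by
    simp only [shiftBoundary, Finset.mem_filter] at hi hj
    exact Fin.ext (hi.2.trans hj.2.symm)

theorem exists_shiftIndex_eq (i : Fin n) (hi : i ∉ shiftBoundary n) :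
    ∃ j, shiftWeight j ≠ 0 ∧ shiftIndex j = i := by
  have h0 : i.val ≠ 0 := fun h => hi (by simp [shiftBoundary, h])
  have h1 : i.val - 1 + 1 < n := by omega
  refine ⟨⟨i.val - 1, by omega⟩, ?_, ?_⟩
  · simp [shiftWeight, h1]
  · rw [shiftIndex, dif_pos h1]
    exact Fin.ext (by simp only; omega)

theorem nul_shift_of_ne {μ : ℂ} (hμ : μ ≠ 0) :
    nul (weightedComp (shiftWeight (n := n)) shiftIndex) μ = 0 :=
  nul_weightedComp_of_height (fun i => n - i.val) shiftIndex_height hμ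

theorem nul_shift_one_le : nul (weightedComp (shiftWeight (n := n)) shiftIndex) 0 1 ≤ 1 :=
  (nul_weightedComp_one_le _ exists_shiftIndex_eq).trans card_shiftBoundary_le

theorem imaginarySupport_of_eigenvalues {V ι : Type*} [NormedAddCommGroup V] [NormedSpace ℂ V]
    [FiniteDimensional ℂ V] [Fintype ι] (f : V →L[ℂ] V) (hι : Fintype.card ι = finrank ℂ V)
    {d : ι → ℂ} (hd : Function.Injective d) (h : ∀ i, End.HasEigenvalue (f : V →ₗ[ℂ] V) (d i))
    (hre : ∀ i, (d i).re = 0) : ImaginarySupport (nul f) := fun μ hμ => by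
  obtain ⟨i, rfl⟩ := (nullity_le_one_of_eigenvalues le_rfl hι hd h μ).2 hμ
  exact hre i

theorem nul_zero_eq_zero_of_eigenvalues {V ι : Type*} [NormedAddCommGroup V] [NormedSpace ℂ V]
    [FiniteDimensional ℂ V] [Fintype ι] (f : V →L[ℂ] V) (hι : Fintype.card ι = finrank ℂ V)
    {d : ι → ℂ} (hd : Function.Injective d) (h : ∀ i, End.HasEigenvalue (f : V →ₗ[ℂ] V) (d i))
    (hne : ∀ i, d i ≠ 0) (j : ℕ) : nul f 0 j = 0 := by
  by_contra h0
  obtain ⟨i, hi⟩ := (nullity_le_one_of_eigenvalues le_rfl hι hd h 0).2 fun h1 => h0 (by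
    rw [nul, h1]; rfl)
  exact hne i hi

theorem isDisjointUnionOfSubmanifolds_complex (n : ℕ) :
    IsDisjointUnionOfSubmanifolds {X : Matrix (Fin n) (Fin n) ℂ | IsNilpotent X} (2 * n) ∧
      IsDisjointUnionOfSubmanifolds {X : Matrix (Fin n) (Fin n) ℂ | HasImaginarySpectrum X} n := by
  let τ : Fin 0 → (Fin n → ℂ) →L⋆[ℂ] (Fin n → ℂ) := fun t => Fin.elim0 t
  let L : Matrix (Fin n) (Fin n) ℂ →ₐ[ℝ] ((Fin n → ℂ) →L[ℂ] (Fin n → ℂ)) :=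
    (matrixToCLM (ι := Fin n)).toAlgHom.restrictScalars ℝ
  have hL : Function.Injective L := matrixToCLM.injective
  have hτ : ∀ f, f ∈ equivariantMaps τ τ := fun f t => Fin.elim0 t
  have hLτ : ∀ f, f ∈ equivariantMaps τ τ ↔ ∃ X, L X = f := fun f =>
    ⟨fun _ => matrixToCLM.surjective f, fun _ => hτ f⟩
  have hτ' : IsConjStructure 1 τ := fun t => Fin.elim0 t
  have hfr : finrank ℂ (Fin n → ℂ) = n := by simp
  constructor
  · refine isDisjointUnionOfSubmanifolds_isNilpotent zero_le_one (one_mul 1) hτ' L hL hLτ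
      one_pos ?_ (fun _ _ _ => one_dvd _) (hτ _) (fun μ => nul_shift_of_ne) nul_shift_one_le
    rw [hfr]; omega
  · have hset : {X : Matrix (Fin n) (Fin n) ℂ | HasImaginarySpectrum X} =
        {X | ImaginarySupport (nul (L X))} := Set.ext fun X => hasImaginarySpectrum_iff X
    rw [hset]
    -- The shift by 1 keeps 0 out of the spectrum.
    let d : Fin n → ℂ := fun i => ((i.val : ℂ) + 1) * Complex.I
    have hd : Function.Injective d := fun i j hij => by
      have h1 := mul_right_cancel₀ Complex.I_ne_zero hij
      exact Fin.ext (by exact_mod_cast add_right_cancel h1)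
    have hcard : Fintype.card (Fin n) = finrank ℂ (Fin n → ℂ) := by simp
    refine isDisjointUnionOfSubmanifolds_imaginary zero_le_one (one_mul 1) hτ' L hL hLτ
      (m := 0) zero_le_one ?_ (fun _ _ _ => Nat.zero_le _) (hτ (weightedComp d id))
      (imaginarySupport_of_eigenvalues _ hcard hd (hasEigenvalue_diagonal d) fun i => by simp [d])
      (nul_zero_eq_zero_of_eigenvalues _ hcard hd (hasEigenvalue_diagonal d) (fun i => ?_) _)
      fun μ => (nullity_le_one_of_eigenvalues le_rfl hcard hd (hasEigenvalue_diagonal d) μ).1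
    · rw [hfr]; omega
    · exact mul_ne_zero (Nat.cast_add_one_ne_zero _) Complex.I_ne_zero

/-- Complex conjugation of coordinates. -/
def coordConj (n : ℕ) : Fin 1 → (Fin n → ℂ) →L⋆[ℂ] (Fin n → ℂ) :=
  fun _ => conjWeightedComp (fun _ => 1) id

/-- A real skew-diagonal operator with simple imaginary eigenvalues. -/
def reversal (n : ℕ) : (Fin n → ℂ) →L[ℂ] (Fin n → ℂ) :=
  weightedComp (fun i => ((2 * (i.val : ℤ) + 1 - n : ℤ) : ℂ)) Fin.rev

/-- The weights change sign under `Fin.rev`, so e_i + I e_(rev i) is an eigenvector. A middle index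
fixed by `Fin.rev` has weight 0 and yields the simple eigenvalue 0 when n is odd. -/
theorem hasEigenvalue_reversal (i : Fin n) :
    End.HasEigenvalue (reversal n : (Fin n → ℂ) →ₗ[ℂ] (Fin n → ℂ))
      (((2 * (i.val : ℤ) + 1 - n : ℤ) : ℂ) * Complex.I) := by
  refine End.hasEigenvalue_of_hasEigenvector
    (x := fun k => (if k = i then 1 else 0) + Complex.I * (if k.rev = i then 1 else 0))
    ⟨End.mem_eigenspace_iff.2 (funext fun k => ?_), fun h => ?_⟩
  · change ((2 * (k.val : ℤ) + 1 - n : ℤ) : ℂ) * ((if k.rev = i then 1 else 0) +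
      Complex.I * (if k.rev.rev = i then 1 else 0)) =
      (((2 * (i.val : ℤ) + 1 - n : ℤ) : ℂ) * Complex.I) *
        ((if k = i then 1 else 0) + Complex.I * (if k.rev = i then 1 else 0))
    rw [Fin.rev_rev]
    have hrev : k.rev = i → (2 * (i.val : ℤ) + 1 - n) = -(2 * (k.val : ℤ) + 1 - n) := by
      rintro rfl
      have := k.isLt
      rw [Fin.val_rev]
      omega
    by_cases h1 : k.rev = i
    · rw [hrev h1]
      have h2 : Complex.I * Complex.I = -1 := Complex.I_mul_I
      by_cases h3 : k = i
      · have h4 := hrev h1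
        rw [← h3] at h4
        have h5 : (2 * (k.val : ℤ) + 1 - n) = 0 := by omega
        rw [h5]; simp
      · simp only [if_pos h1, if_neg h3, Int.cast_neg]
        linear_combination ((2 * (k.val : ℤ) + 1 - n : ℤ) : ℂ) * h2
    · by_cases h3 : k = i
      · subst h3
        simp only [if_neg h1, if_true]
        ring
      · simp [h1, h3]
  · have h1 := congrArg Complex.re (congrFun h i)
    by_cases h2 : i.rev = i <;> simp [h2] at h1

theorem natCeil_half (n : ℕ) : ⌈(n : ℚ) / 2⌉₊ = (n + 1) / 2 := by
  obtain ⟨k, rfl | rfl⟩ := Nat.even_or_odd' n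
  · have h1 : ((2 * k : ℕ) : ℚ) / 2 = k := by push_cast; ring
    rw [h1, Nat.ceil_natCast]; omega
  · have h1 : ((2 * k + 1 : ℕ) : ℚ) / 2 = k + 1 / 2 := by push_cast; ring
    rw [h1, (by omega : (2 * k + 1 + 1) / 2 = k + 1), Nat.ceil_eq_iff (by omega)]
    constructor <;> push_cast <;> norm_num

theorem isDisjointUnionOfSubmanifolds_real (n : ℕ) :
    IsDisjointUnionOfSubmanifolds {X : Matrix (Fin n) (Fin n) ℝ | IsNilpotent X} n ∧
      IsDisjointUnionOfSubmanifolds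
        {X : Matrix (Fin n) (Fin n) ℝ | HasImaginarySpectrum (X.map (algebraMap ℝ ℂ))}
        ⌈(n : ℚ) / 2⌉₊ := by
  let L : Matrix (Fin n) (Fin n) ℝ →ₐ[ℝ] ((Fin n → ℂ) →L[ℂ] (Fin n → ℂ)) :=
    ((matrixToCLM (ι := Fin n)).toAlgHom.restrictScalars ℝ).comp
      (AlgHom.mapMatrix (Algebra.ofId ℝ ℂ))
  have hLX : ∀ X, L X = matrixToCLM (X.map (algebraMap ℝ ℂ)) := fun _ => rfl
  have hL : Function.Injective L := matrixToCLM.injective.comp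
    (Matrix.map_injective (algebraMap ℝ ℂ).injective)
  have hconj : ∀ v i, coordConj n 0 v i = starRingEnd ℂ (v i) := fun v i => by simp [coordConj]
  have hmem : ∀ f, f ∈ equivariantMaps (coordConj n) (coordConj n) ↔
      ∀ v, f (coordConj n 0 v) = coordConj n 0 (f v) := fun f =>
    ⟨fun h => h 0, fun h t => by rw [Subsingleton.elim t 0]; exact h⟩
  have hLτ : ∀ f, f ∈ equivariantMaps (coordConj n) (coordConj n) ↔ ∃ X, L X = f := by
    intro f
    rw [hmem]
    constructor
    · intro hf
      obtain ⟨Z, rfl⟩ := matrixToCLM.surjective f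
      refine ⟨Z.map Complex.re, ?_⟩
      rw [hLX]
      congr 1
      ext i j
      have h1 := congrFun (hf (Pi.single j 1)) i
      have h2 : coordConj n 0 (Pi.single j 1) = Pi.single j 1 := by
        ext k
        rw [hconj]
        by_cases hk : k = j
        · subst hk; simp
        · simp [hk]
      rw [h2, hconj, matrixToCLM_single] at h1
      exact Complex.conj_eq_iff_re.1 h1.symm
    · rintro ⟨X, rfl⟩ v
      ext i
      rw [hLX, hconj, matrixToCLM_apply, matrixToCLM_apply, map_sum]
      exact Finset.sum_congr rfl fun j _ => by simp [hconj]
  have hτ : IsConjStructure 1 (coordConj n) := fun t v => by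
    rw [Subsingleton.elim t 0]
    ext i
    rw [hconj, hconj]
    simp
  have hfr : finrank ℂ (Fin n → ℂ) = n := by simp
  constructor
  · refine isDisjointUnionOfSubmanifolds_isNilpotent le_rfl (one_mul 1) hτ L hL hLτ
      one_pos ?_ (fun _ _ _ => one_dvd _) ((hmem _).2 fun v => ?_) (fun μ => nul_shift_of_ne)
      nul_shift_one_le
    · rw [hfr]; omega
    · ext i
      simp [hconj, conj_shiftWeight]
  · have hset : {X : Matrix (Fin n) (Fin n) ℝ | HasImaginarySpectrum (X.map (algebraMap ℝ ℂ))} =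
        {X | ImaginarySupport (nul (L X))} := Set.ext fun X => hasImaginarySpectrum_iff _
    rw [hset]
    have hd : Function.Injective fun i : Fin n =>
        ((2 * (i.val : ℤ) + 1 - n : ℤ) : ℂ) * Complex.I := fun i j hij => by
      have h1 : (2 * (i.val : ℤ) + 1 - n) = 2 * (j.val : ℤ) + 1 - n := by
        exact_mod_cast mul_right_cancel₀ Complex.I_ne_zero hij
      exact Fin.ext (by omega)
    have hcard : Fintype.card (Fin n) = finrank ℂ (Fin n → ℂ) := by simp
    have hmod : ∀ f ∈ equivariantMaps (coordConj n) (coordConj n), ImaginarySupport (nul f) →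
        nul f 0 (finrank ℂ (Fin n → ℂ)) % 2 = n % 2 := fun f hf hfim => by
      rw [nullity_zero_mod_two le_rfl hfim fun μ => nul_conj (one_mul 1) (hτ 0) (hf 0) μ, hfr]
    have hR : reversal n ∈ equivariantMaps (coordConj n) (coordConj n) := (hmem _).2 fun v => by
      ext i
      simp only [hconj, reversal, weightedComp_apply, map_mul, map_intCast]
    have hRim := imaginarySupport_of_eigenvalues _ hcard hd hasEigenvalue_reversal
      fun i => by simp
    have hR1 : ∀ μ, nul (reversal n) μ (finrank ℂ (Fin n → ℂ)) ≤ 1 := fun μ =>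
      (nullity_le_one_of_eigenvalues le_rfl hcard hd hasEigenvalue_reversal μ).1
    refine isDisjointUnionOfSubmanifolds_imaginary le_rfl (one_mul 1) hτ L hL hLτ
      (m := n % 2) (by omega) ?_ (fun f hf hfim => ?_) hR hRim ?_ hR1
    · rw [hfr, natCeil_half]; omega
    · rw [← hmod f hf hfim]; exact Nat.mod_le _ _
    -- The multiplicity of 0 is at most 1 and has the parity of n, so it is n mod 2.
    · have h1 := hmod _ hR hRim
      have h2 := hR1 0
      omega

/-- The antilinear operator defining the quaternionic structure. -/
def quaternionicConj (n : ℕ) : Fin 1 → (Fin n ⊕ Fin n → ℂ) →L⋆[ℂ] (Fin n ⊕ Fin n → ℂ) :=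
  fun _ => conjWeightedComp (Sum.elim (fun _ => 1) fun _ => -1) Sum.swap

/-- The structure is (u, v) ↦ (v̄, -ū). Commutation on the first n basis vectors already expresses
the right half of the columns through the left half, which is the block form. -/
theorem mem_quaternionicMatrices_iff (Z : Matrix (Fin n ⊕ Fin n) (Fin n ⊕ Fin n) ℂ) :
    Z ∈ quaternionicMatrices n ↔
      ∀ v, matrixToCLM Z (quaternionicConj n 0 v) = quaternionicConj n 0 (matrixToCLM Z v) := by
  constructor
  · rintro ⟨X, Y, rfl⟩ v
    ext i
    rcases i with i | i <;>
      simp [quaternionicConj, matrixToCLM_apply, Finset.sum_neg_distrib, add_comm]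
  · intro h
    refine ⟨Z.toBlocks₁₁, Z.toBlocks₁₂, ?_⟩
    have h1 : ∀ j, quaternionicConj n 0 (Pi.single (Sum.inl j) 1) =
        -Pi.single (Sum.inr j) 1 := fun j => by
      ext k
      rcases k with k | k
      · simp [quaternionicConj]
      · by_cases hk : k = j
        · subst hk; simp [quaternionicConj]
        · simp [quaternionicConj, hk]
    have h2 : ∀ i j, -Z i (Sum.inr j) =
        quaternionicConj n 0 (matrixToCLM Z (Pi.single (Sum.inl j) 1)) i := fun i j => by
      rw [← h, h1, map_neg, Pi.neg_apply, matrixToCLM_single]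
    ext i j
    rcases i with i | i <;> rcases j with j | j
    · rfl
    · rfl
    · have h3 := h2 (Sum.inl i) j
      simp only [quaternionicConj, conjWeightedComp_apply, Sum.swap_inl, matrixToCLM_single] at h3
      have h4 := congrArg (starRingEnd ℂ) h3
      simpa [Matrix.toBlocks₁₂] using h4.symm
    · have h3 := h2 (Sum.inr i) j
      simp only [quaternionicConj, conjWeightedComp_apply, Sum.swap_inr, matrixToCLM_single] at h3
      simpa [Matrix.toBlocks₁₁] using h3

theorem isDisjointUnionOfSubmanifolds_quaternionic (n : ℕ) :
    IsDisjointUnionOfSubmanifolds {X : quaternionicMatrices n | IsNilpotent X} (4 * n) ∧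
      IsDisjointUnionOfSubmanifolds {X : quaternionicMatrices n |
        HasImaginarySpectrum (X : Matrix (Fin n ⊕ Fin n) (Fin n ⊕ Fin n) ℂ)} n := by
  let L : quaternionicMatrices n →ₐ[ℝ] ((Fin n ⊕ Fin n → ℂ) →L[ℂ] (Fin n ⊕ Fin n → ℂ)) :=
    ((matrixToCLM (ι := Fin n ⊕ Fin n)).toAlgHom.restrictScalars ℝ).comp
      (quaternionicMatrices n).val
  have hLX : ∀ X : quaternionicMatrices n, L X =
      matrixToCLM (X : Matrix (Fin n ⊕ Fin n) (Fin n ⊕ Fin n) ℂ) := fun _ => rfl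
  have hL : Function.Injective L := matrixToCLM.injective.comp Subtype.val_injective
  have hmem : ∀ f, f ∈ equivariantMaps (quaternionicConj n) (quaternionicConj n) ↔
      ∀ v, f (quaternionicConj n 0 v) = quaternionicConj n 0 (f v) := fun f =>
    ⟨fun h => h 0, fun h t => by rw [Subsingleton.elim t 0]; exact h⟩
  have hLτ : ∀ f, f ∈ equivariantMaps (quaternionicConj n) (quaternionicConj n) ↔
      ∃ X, L X = f := by
    intro f
    rw [hmem]
    obtain ⟨Z, rfl⟩ := matrixToCLM.surjective f
    rw [← mem_quaternionicMatrices_iff]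
    constructor
    · exact fun hZ => ⟨⟨Z, hZ⟩, rfl⟩
    · rintro ⟨X, hX⟩
      rw [← matrixToCLM.injective ((hLX X).symm.trans hX)]
      exact X.2
  have hsq : ∀ v, quaternionicConj n 0 (quaternionicConj n 0 v) = -v := fun v => by
    ext i
    rcases i with i | i <;> simp [quaternionicConj]
  have hτ : IsConjStructure (-1) (quaternionicConj n) := fun t v => by
    rw [Subsingleton.elim t 0, hsq]
    simp
  have hfr : finrank ℂ (Fin n ⊕ Fin n → ℂ) = n + n := by simp
  constructor
  · refine isDisjointUnionOfSubmanifolds_isNilpotent le_rfl (by norm_num) hτ L hL hLτ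
      two_pos ?_ (fun f hf j => two_dvd_nul hsq (hf 0) j)
      (f := weightedComp (Sum.elim shiftWeight shiftWeight) (Sum.map shiftIndex shiftIndex))
      ((hmem _).2 fun v => ?_)
      (fun μ => nul_weightedComp_of_height (Sum.elim (fun i => n - i.val) fun i => n - i.val) ?_)
      ((nul_weightedComp_one_le ((shiftBoundary n).disjSum (shiftBoundary n)) ?_).trans ?_)
    · rw [hfr]; omega
    · ext i
      rcases i with i | i <;> simp [quaternionicConj, conj_shiftWeight]
    · rintro (i | i) hi <;> exact shiftIndex_height i hi
    · rintro (i | i) hi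
      · obtain ⟨j, hj, rfl⟩ := exists_shiftIndex_eq i (by simpa using hi)
        exact ⟨Sum.inl j, hj, rfl⟩
      · obtain ⟨j, hj, rfl⟩ := exists_shiftIndex_eq i (by simpa using hi)
        exact ⟨Sum.inr j, hj, rfl⟩
    · rw [Finset.card_disjSum]
      have := card_shiftBoundary_le (n := n)
      omega
  · have hset : {X : quaternionicMatrices n |
        HasImaginarySpectrum (X : Matrix (Fin n ⊕ Fin n) (Fin n ⊕ Fin n) ℂ)} =
        {X | ImaginarySupport (nul (L X))} := Set.ext fun X => hasImaginarySpectrum_iff _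
    rw [hset]
    -- Equivariance of a diagonal operator requires conjugate entries in the two halves; hence the
    -- opposite signs. All entries are distinct and nonzero.
    let k : Fin n ⊕ Fin n → ℤ := Sum.elim (fun i => (i.val : ℤ) + 1) fun i => -((i.val : ℤ) + 1)
    let d : Fin n ⊕ Fin n → ℂ := fun i => (k i : ℂ) * Complex.I
    have hd : Function.Injective d := fun i j hij => by
      have h1 : k i = k j := by exact_mod_cast mul_right_cancel₀ Complex.I_ne_zero hij
      rcases i with i | i <;> rcases j with j | j <;>
        simp only [k, Sum.elim_inl, Sum.elim_inr] at h1
      · rw [Fin.ext (show i.val = j.val by omega)]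
      · omega
      · omega
      · rw [Fin.ext (show i.val = j.val by omega)]
    have hk : ∀ i, k i ≠ 0 := by
      rintro (i | i) <;> simp only [k, Sum.elim_inl, Sum.elim_inr] <;> omega
    have hcard : Fintype.card (Fin n ⊕ Fin n) = finrank ℂ (Fin n ⊕ Fin n → ℂ) := by simp
    refine isDisjointUnionOfSubmanifolds_imaginary le_rfl (by norm_num) hτ L hL hLτ
      (m := 0) zero_le_one ?_ (fun _ _ _ => Nat.zero_le _) (f := weightedComp d id)
      ((hmem _).2 fun v => ?_)
      (imaginarySupport_of_eigenvalues _ hcard hd (hasEigenvalue_diagonal d) fun i => by simp [d])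
      (nul_zero_eq_zero_of_eigenvalues _ hcard hd (hasEigenvalue_diagonal d) (fun i => ?_) _)
      fun μ => (nullity_le_one_of_eigenvalues le_rfl hcard hd (hasEigenvalue_diagonal d) μ).1
    · rw [hfr]; omega
    · ext i
      rcases i with i | i <;> simp [quaternionicConj, d, k] <;> ring
    · exact mul_ne_zero (Int.cast_ne_zero.2 (hk i)) Complex.I_ne_zero

end MatrixAlgebras

theorem theorem5p1 (n : ℕ) :
    (IsDisjointUnionOfSubmanifolds {X : Matrix (Fin n) (Fin n) ℝ | IsNilpotent X} n ∧
      IsDisjointUnionOfSubmanifolds {X : Matrix (Fin n) (Fin n) ℂ | IsNilpotent X} (2 * n) ∧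
      IsDisjointUnionOfSubmanifolds {X : quaternionicMatrices n | IsNilpotent X} (4 * n)) ∧
    (IsDisjointUnionOfSubmanifolds
        {X : Matrix (Fin n) (Fin n) ℝ | HasImaginarySpectrum (X.map (algebraMap ℝ ℂ))}
        ⌈(n : ℚ) / 2⌉₊ ∧
      IsDisjointUnionOfSubmanifolds {X : Matrix (Fin n) (Fin n) ℂ | HasImaginarySpectrum X} n ∧
      IsDisjointUnionOfSubmanifolds
        {X : quaternionicMatrices n |
          HasImaginarySpectrum (X : Matrix (Fin n ⊕ Fin n) (Fin n ⊕ Fin n) ℂ)} n) :=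
  have hr := isDisjointUnionOfSubmanifolds_real n
  have hc := isDisjointUnionOfSubmanifolds_complex n
  have hq := isDisjointUnionOfSubmanifolds_quaternionic n
  ⟨⟨hr.1, hc.1, hq.1⟩, hr.2, hc.2, hq.2⟩
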